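/- **Setting.** Let $X$ be a connected (hence integral) regular locally Noetherian scheme over $\mathrm{Spec}\,\mathbf Z[\frac12]$, let $G$ be a finite group acting on $X$, let $H\subseteq G$ be a subgroup, and let $$X\xrightarrow{\ \lambda\ }V=X/H\xrightarrow{\ \gamma\ }Y=X/G,\qquad \pi=\gamma\circ\lambda,$$ be the quotients: $\lambda$ and $\pi$ are affine and invariant, $O_V=(\lambda_*O_X)^H$ and $O_Y=(\pi_*O_X)^G$. Assume that $\pi$ is flat, that the action is generically free (the inertia group of the generic point is trivial), and that for every $x\in X$ the order of the inertia group of $x$ is odd and prime to the residue characteristic of $x$. For $f=\pi$ or $f=\gamma$, with source $Z=X$ or $Z=V$ respectively, put ${\mathcal D}^{-1/2}_{Z/Y}=O_Z\big(\sum_z\frac{e_z-1}{2}\,\overline{\{z\}}\big)$, a subsheaf of the constant sheaf of rational functions, where $z$ runs over the points of codimension one of $Z$ and $e_z$ is the ramification index of $f$ at $z$. A *symmetric bundle* on $Y$ is a locally free $O_Y$-module of finite rank with an $O_Y$-valued symmetric bilinear form whose adjoint map to the dual is an isomorphism. If $M$ is an $R$-module with an action of $G$ and a $G$-invariant symmetric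 form $t$, and if $M^G=\{\sum_{g}gm : m\in M\}$, the form $t^G$ on $M^G$ is given by $t^G(x,y)=t(m,y)$ for any $m$ with $\sum_g gm=x$, provided that this does not depend on the choice of $m$. Let $E=O_Y[G/H]$ be the free $O_Y$-module on the left cosets of $H$, let $q$ be the form on $E$ for which the cosets are an orthonormal basis, and let $\rho$ be the representation of $G$ on $E$ by permutation of the cosets. The *twist* of $(E,q)$ by $\rho$ is $$E_{\rho,X}=\big(E\otimes_{O_Y}\pi_*{\mathcal D}^{-1/2}_{X/Y}\big)^G,\qquad q_{\rho,X}=(q\otimes \mathrm{Tr}_{X/Y})^G,$$ with $G$ acting diagonally (the form being defined over affine open subschemes of $Y$). Here $\mathrm{Tr}_{X/Y}$ denotes the form $(x,y)\mapsto\mathrm{Tr}_{K(X)/K(Y)}(xy)$, and $\mathrm{Tr}_{V/Y}$ the form $(x,y)\mapsto\mathrm{Tr}_{K(V)/K(Y)}(xy)$, where $K(V)=K(X)^H$. **Proposition.** (i) The form $q_{\rho,X}$ is well defined, the twist $(E_{\rho,X},q_{\rho,X})$ and the pair $\big((\pi_*{\mathcal D}^{-1/2}_{X/Y})^H,\mathrm{Tr}_{V/Y}\big)$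 are symmetric bundles on $Y$, and they are isometric. (ii) If $\lambda$ is flat, then $(\pi_*{\mathcal D}^{-1/2}_{X/Y})^H=\gamma_*({\mathcal D}^{-1/2}_{V/Y})$ inside $K(X)^H=K(V)$, so that $\big((\pi_*{\mathcal D}^{-1/2}_{X/Y})^H,\mathrm{Tr}_{V/Y}\big)$ is the symmetric bundle $\big(\gamma_*({\mathcal D}^{-1/2}_{V/Y}),\mathrm{Tr}_{V/Y}\big)$. -/

import Mathlib

open CategoryTheory AlgebraicGeometry
open scoped TensorProduct

universe u v w w'

namespace FrohlichTwist

noncomputable section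

/-! ### Function fields -/

theorem generic_specializes {X Y : Scheme.{u}} [IsIntegral X] [IsIntegral Y] (f : X ⟶ Y)
    [IsDominant f] : f (genericPoint X) ⤳ genericPoint Y := by
  rw [specializes_iff_mem_closure]
  have h : closure {f (genericPoint X)} = (Set.univ : Set Y) := by
    have := (genericPoint_spec X).image f.continuous
    rw [isGenericPoint_def] at this
    rw [this, Set.image_univ]
    exact f.denseRange.closure_range
  rw [h]; trivial

/-- The pull-back map `K(Y) → K(X)` of a dominant morphism of integral schemes: the stalk map at
the generic point of `X`, whose image is the generic point of `Y`. -/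
def ffMap {X Y : Scheme.{u}} [IsIntegral X] [IsIntegral Y] (f : X ⟶ Y) [IsDominant f] :
    Y.functionField →+* X.functionField :=
  (Y.presheaf.stalkSpecializes (generic_specializes f) ≫ f.stalkMap (genericPoint X)).hom

theorem stalk_algebraMap (X : Scheme.{u}) [IsIntegral X] (x : X) :
    algebraMap (X.presheaf.stalk x) X.functionField =
      (X.presheaf.stalkSpecializes ((genericPoint_spec X).specializes trivial)).hom := rfl

theorem ffMap_algebraMap {X Y : Scheme.{u}} [IsIntegral X] [IsIntegral Y] (f : X ⟶ Y)
    [IsDominant f] (x : X) (a : Y.presheaf.stalk (f x)) :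
    ffMap f (algebraMap _ Y.functionField a) =
      algebraMap _ X.functionField ((f.stalkMap x).hom a) := by
  have h := (genericPoint_spec X).specializes (Set.mem_univ x)
  have e := Scheme.Hom.stalkSpecializes_stalkMap f (genericPoint X) x h
  rw [stalk_algebraMap, stalk_algebraMap, ffMap, ← CommRingCat.comp_apply, ← CommRingCat.comp_apply,
    TopCat.Presheaf.stalkSpecializes_comp_assoc, ← e]

theorem ffMap_germ {X Y : Scheme.{u}} [IsIntegral X] [IsIntegral Y] (f : X ⟶ Y)
    [IsDominant f] (U : Y.Opens) [Nonempty U] (x : X) (hx : f x ∈ U) (a : Γ(Y, U)) :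
    ffMap f (algebraMap _ Y.functionField a) =
      algebraMap _ X.functionField ((f.stalkMap x).hom (Y.presheaf.germ U (f x) hx a)) := by
  rw [← ffMap_algebraMap, Scheme.algebraMap_germ_eq_germToFunctionField]; rfl

theorem ffMap_id (X : Scheme.{u}) [IsIntegral X] (z : X.functionField) : ffMap (𝟙 X) z = z := by
  rw [ffMap, Scheme.Hom.stalkMap_id]
  exact congrArg (fun f : X.functionField ⟶ X.functionField => f.hom z)
    ((Category.comp_id _).trans (TopCat.Presheaf.stalkSpecializes_refl X.presheaf (genericPoint X)))

theorem ffMap_comp {X Y Z : Scheme.{u}} [IsIntegral X] [IsIntegral Y] [IsIntegral Z]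
    (f : X ⟶ Y) (g : Y ⟶ Z) [IsDominant f] [IsDominant g] (z : Z.functionField) :
    ffMap (f ≫ g) z = ffMap f (ffMap g z) := by
  have e := Scheme.Hom.stalkSpecializes_stalkMap g _ _ (generic_specializes f)
  rw [ffMap, ffMap, ffMap, ← CommRingCat.comp_apply, Scheme.Hom.stalkMap_comp, Category.assoc,
    ← reassoc_of% e, TopCat.Presheaf.stalkSpecializes_comp_assoc]
  rfl

theorem ffMap_congr {X Y : Scheme.{u}} [IsIntegral X] [IsIntegral Y] {f g : X ⟶ Y}
    [IsDominant f] [IsDominant g] (h : f = g) (z : Y.functionField) : ffMap f z = ffMap g z := by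
  subst h; rfl

/-- The function field of `X`, seen as an extension of the function field of `Y` by means of
`f : X ⟶ Y`. -/
def ExtField {X Y : Scheme.{u}} [IsIntegral X] [IsIntegral Y] (_f : X ⟶ Y) : Type u :=
  X.functionField

section ExtField

variable {X Y : Scheme.{u}} [IsIntegral X] [IsIntegral Y] (f : X ⟶ Y)

instance : Field (ExtField f) := inferInstanceAs (Field X.functionField)

variable [IsDominant f]

instance : Algebra Y.functionField (ExtField f) := (ffMap f).toAlgebra

instance (U : Y.Opens) [Nonempty U] : Algebra Γ(Y, U) (ExtField f) :=
  ((ffMap f).comp (algebraMap Γ(Y, U) Y.functionField)).toAlgebra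

instance (U : Y.Opens) [Nonempty U] : IsScalarTower Γ(Y, U) Y.functionField (ExtField f) :=
  IsScalarTower.of_algebraMap_eq' rfl

/-- The trace `Tr_{X/Y} : K(X) → K(Y)`. -/
abbrev fieldTrace : ExtField f →ₗ[Y.functionField] Y.functionField :=
  Algebra.trace Y.functionField (ExtField f)

end ExtField

/-! ### The square root of the codifferent -/

/-- The ramification index of `f` at `x`: the largest `n` with `𝔪_{f x} O_{X,x} ⊆ 𝔪_x ^ n`. -/
def ramIdx {X Y : Scheme.{u}} (f : X ⟶ Y) (x : X) : ℕ :=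
  sSup {n | (IsLocalRing.maximalIdeal (Y.presheaf.stalk (f x))).map (f.stalkMap x).hom ≤
    IsLocalRing.maximalIdeal (X.presheaf.stalk x) ^ n}

/-- `z ∈ K(X)` is a section over `W` of `D_{X/Y}^{-1/2} = O_X(∑ₓ ((eₓ - 1) / 2) · x̄)`, where `x`
runs through the points of codimension one of `X` and `eₓ` is the ramification index of `f` at `x`:
for each such `x` in `W` the product of `z` with `𝔪ₓ ^ ((eₓ - 1) / 2)` lies in `O_{X,x}`. If
`O_{X,x}` is a discrete valuation ring, this says that `ordₓ z ≥ - (eₓ - 1) / 2`. -/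
def MemSqrtCodiff {X Y : Scheme.{u}} [IsIntegral X] (f : X ⟶ Y) (W : X.Opens)
    (z : X.functionField) : Prop :=
  ∀ x ∈ W, ringKrullDim (X.presheaf.stalk x) = 1 →
    ∀ a ∈ IsLocalRing.maximalIdeal (X.presheaf.stalk x) ^ ((ramIdx f x - 1) / 2),
      ∃ b : X.presheaf.stalk x, algebraMap _ X.functionField b = algebraMap _ _ a * z

/-- The non-empty affine open subschemes of `Y`. -/
structure NAffine (Y : Scheme.{u}) where
  /-- the open subscheme -/
  opens : Y.Opens
  isAffine : IsAffineOpen opens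
  nonempty : Nonempty opens

instance {Y : Scheme.{u}} (U : NAffine Y) : Nonempty U.opens := U.nonempty

/-- The sections of `f_* D_{X/Y}^{-1/2}` over `U`. -/
def pushSqrtCodiff {X Y : Scheme.{u}} [IsIntegral X] [IsIntegral Y] (f : X ⟶ Y) [IsDominant f]
    (U : NAffine Y) : Submodule Γ(Y, U.opens) (ExtField f) where
  carrier := {z | MemSqrtCodiff f (f ⁻¹ᵁ U.opens) z}
  zero_mem' x _ _ a _ := ⟨0, by rw [map_zero]; exact (mul_zero _).symm⟩
  add_mem' {y z} hy hz x hx hd a ha := by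
    obtain ⟨b, hb⟩ := hy x hx hd a ha
    obtain ⟨c, hc⟩ := hz x hx hd a ha
    exact ⟨b + c, by rw [map_add, hb, hc]; exact (mul_add _ _ _).symm⟩
  smul_mem' r z hz x hx hd a ha := by
    obtain ⟨b, hb⟩ := hz x hx hd a ha
    refine ⟨(f.stalkMap x).hom (Y.presheaf.germ U.opens (f x) hx r) * b, ?_⟩
    rw [map_mul, hb, ← ffMap_germ f U.opens x hx r]
    exact mul_left_comm _ _ _

/-! ### Group actions and quotients -/

section Action

variable {G : Type v} [Group G] {X Y : Scheme.{u}}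

/-- The automorphism of `X` by which `g` acts. -/
def act (φ : G →* Aut X) (g : G) : X ≅ X := φ g

theorem act_one (φ : G →* Aut X) : (act φ 1).hom = 𝟙 X := by
  rw [act, map_one]; rfl

theorem act_mul (φ : G →* Aut X) (g h : G) :
    (act φ (g * h)).hom = (act φ h).hom ≫ (act φ g).hom := by
  rw [act, map_mul]; rfl

/-- `π : X ⟶ Y` is the quotient of `X` by the action `φ` of the group `G`: `π` is affine and
`G`-invariant and `O_Y` is the subsheaf of `G`-invariants of `π_* O_X`. -/
structure IsQuotient (φ : G →* Aut X) (π : X ⟶ Y) : Prop where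
  isAffineHom : IsAffineHom π
  invariant : ∀ g, (act φ g).hom ≫ π = π
  injective : ∀ U : Y.Opens, Function.Injective (π.app U).hom
  surjective : ∀ (U : Y.Opens) (s : Γ(X, π ⁻¹ᵁ U)),
    (∀ (g : G) (h : π ⁻¹ᵁ U ≤ (act φ g).hom ⁻¹ᵁ π ⁻¹ᵁ U), ((act φ g).hom.appLE _ _ h).hom s = s) →
      ∃ t : Γ(Y, U), (π.app U).hom t = s

/-- The inertia group of a point `x`: the elements that fix `x` and act trivially on its residue
field. -/
def inertia (φ : G →* Aut X) (x : X) : Subgroup G where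
  carrier := {g | X.fromSpecResidueField x ≫ (act φ g).hom = X.fromSpecResidueField x}
  one_mem' := by
    change _ ≫ (act φ 1).hom = _
    rw [act_one, Category.comp_id]
  mul_mem' {g h} hg hh := by
    change _ ≫ (act φ (g * h)).hom = _
    rw [act_mul, ← Category.assoc]
    exact (congrArg (· ≫ (act φ g).hom) hh).trans hg
  inv_mem' {g} hg := by
    change _ ≫ (act φ g⁻¹).hom = _
    have h : (act φ g).hom ≫ (act φ g⁻¹).hom = 𝟙 X := by
      rw [← act_mul, inv_mul_cancel, act_one]
    have hg' : X.fromSpecResidueField x ≫ (act φ g).hom = X.fromSpecResidueField x := hg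
    conv_lhs => rw [← hg', Category.assoc, h, Category.comp_id]

/-- The isomorphism of local rings induced by an automorphism. -/
def stalkEquiv (g : X ⟶ X) [IsIso g] (x : X) :
    X.presheaf.stalk (g x) ≃+* X.presheaf.stalk x :=
  RingEquiv.ofBijective (g.stalkMap x).hom (ConcreteCategory.bijective_of_isIso (g.stalkMap x))

theorem mem_maximalIdeal_pow_iff (g : X ⟶ X) [IsIso g] (x : X) (n : ℕ)
    (a : X.presheaf.stalk (g x)) :
    (g.stalkMap x).hom a ∈ IsLocalRing.maximalIdeal (X.presheaf.stalk x) ^ n ↔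
      a ∈ IsLocalRing.maximalIdeal (X.presheaf.stalk (g x)) ^ n := by
  have h := IsLocalRing.map_ringEquiv_maximalIdeal (stalkEquiv g x)
  rw [← h, ← Ideal.map_pow]
  constructor
  · intro ha
    obtain ⟨b, hb, hba⟩ := (Ideal.mem_map_iff_of_surjective _ (stalkEquiv g x).surjective).1 ha
    rwa [(stalkEquiv g x).injective hba] at hb
  · exact fun ha => Ideal.mem_map_of_mem (stalkEquiv g x) ha

theorem ramIdx_iso_comp (g : X ⟶ X) [IsIso g] (f : X ⟶ Y) (x : X) :
    ramIdx (g ≫ f) x = ramIdx f (g x) := by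
  unfold ramIdx
  congr 1
  ext n
  simp only [Set.mem_ofPred_eq, Ideal.map_le_iff_le_comap]
  refine forall₂_congr fun a _ => ?_
  refine Iff.trans ?_ (mem_maximalIdeal_pow_iff g x n ((f.stalkMap (g x)).hom a))
  rw [Scheme.Hom.stalkMap_comp]
  rfl

theorem IsQuotient.nonempty_preimage {φ : G →* Aut X} {π : X ⟶ Y} (hπ : IsQuotient φ π)
    (U : Y.Opens) [hU : Nonempty U] : Nonempty (π ⁻¹ᵁ U) := by
  by_contra hne
  have hb : π ⁻¹ᵁ U = ⊥ := by
    ext x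
    exact ⟨fun hx => hne ⟨⟨x, hx⟩⟩, fun hx => hx.elim⟩
  have h0 : Subsingleton Γ(X, π ⁻¹ᵁ U) := by
    rw [hb]; infer_instance
  have h1 : Subsingleton Γ(Y, U) := (hπ.injective U).subsingleton
  obtain ⟨y, hy⟩ := hU
  have : Subsingleton (Y.presheaf.stalk y) :=
    (Y.presheaf.germ U y hy).hom.codomain_trivial
  exact false_of_nontrivial_of_subsingleton (Y.presheaf.stalk y)

theorem IsQuotient.isDominant {φ : G →* Aut X} {π : X ⟶ Y} (hπ : IsQuotient φ π) :
    IsDominant π := by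
  refine ⟨dense_iff_inter_open.mpr fun U hU hne => ?_⟩
  have : Nonempty (⟨U, hU⟩ : Y.Opens) := hne.to_subtype
  obtain ⟨x, hx⟩ := hπ.nonempty_preimage ⟨U, hU⟩
  exact ⟨π x, hx, x, rfl⟩

variable [IsIntegral X]

/-- The action of `g ∈ G` on the function field: `z ↦ z ∘ g⁻¹`. -/
def galMap (φ : G →* Aut X) (g : G) : X.functionField →+* X.functionField :=
  ffMap (act φ g⁻¹).hom

theorem galMap_one (φ : G →* Aut X) (z : X.functionField) : galMap φ 1 z = z := by
  have h : (act φ 1⁻¹).hom = 𝟙 X := by rw [inv_one, act_one]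
  exact (ffMap_congr h z).trans (ffMap_id X z)

theorem galMap_mul (φ : G →* Aut X) (g h : G) (z : X.functionField) :
    galMap φ (g * h) z = galMap φ g (galMap φ h z) := by
  have e : (act φ (g * h)⁻¹).hom = (act φ g⁻¹).hom ≫ (act φ h⁻¹).hom := by
    rw [mul_inv_rev, act_mul]
  exact (ffMap_congr e z).trans (ffMap_comp _ _ z)

theorem IsQuotient.isIntegral {φ : G →* Aut X} {π : X ⟶ Y} (hπ : IsQuotient φ π) :
    IsIntegral Y where
  nonempty := ⟨π (genericPoint X)⟩
  component_integral U hU := by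
    have := hπ.nonempty_preimage U
    exact (hπ.injective U).isDomain (π.app U).hom

theorem MemSqrtCodiff.galMap {φ : G →* Aut X} {π : X ⟶ Y}
    (hinv : ∀ g, (act φ g).hom ≫ π = π)
    (U : Y.Opens) (g : G) {z : X.functionField} (hz : MemSqrtCodiff π (π ⁻¹ᵁ U) z) :
    MemSqrtCodiff π (π ⁻¹ᵁ U) (galMap φ g z) := by
  intro x hx hd a ha
  set k : X ⟶ X := (act φ g⁻¹).hom with hk
  have hkx : π (k x) = π x := congrArg (fun q : X ⟶ Y => q x) (hinv g⁻¹)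
  have hr : ramIdx π (k x) = ramIdx π x := by
    rw [← ramIdx_iso_comp, hinv g⁻¹]
  obtain ⟨a', rfl⟩ := (stalkEquiv k x).surjective a
  obtain ⟨b, hb⟩ := hz (k x) (show π (k x) ∈ U from hkx ▸ hx)
    ((ringKrullDim_eq_of_ringEquiv (stalkEquiv k x)).trans hd) a'
    ((mem_maximalIdeal_pow_iff k x _ a').1 (hr ▸ ha))
  refine ⟨(k.stalkMap x).hom b, ?_⟩
  rw [← ffMap_algebraMap, hb, map_mul, ffMap_algebraMap]
  rfl

/-- The representation of `G` on the sections of `π_* D_{X/Y}^{-1/2}`. -/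
def galRep [IsIntegral Y] (φ : G →* Aut X) (π : X ⟶ Y) [IsDominant π]
    (hinv : ∀ g, (act φ g).hom ≫ π = π) (U : NAffine Y) :
    Representation Γ(Y, U.opens) G (pushSqrtCodiff π U) where
  toFun g :=
    { toFun := fun z => ⟨galMap φ g z.1, MemSqrtCodiff.galMap hinv U.opens g z.2⟩
      map_add' := fun y z => Subtype.ext (map_add (galMap φ g) y.1 z.1)
      map_smul' := fun r z => Subtype.ext <| by
        have h : ∀ c : Y.functionField, galMap φ g (ffMap π c) = ffMap π c := fun c =>
          (ffMap_comp _ _ c).symm.trans (ffMap_congr (hinv g⁻¹) c)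
        exact (map_mul (galMap φ g) _ _).trans (congrArg (· * galMap φ g z.1) (h _)) }
  map_one' := LinearMap.ext fun z => Subtype.ext (galMap_one φ z.1)
  map_mul' g h := LinearMap.ext fun z => Subtype.ext (galMap_mul φ g h z.1)

end Action

/-! ### Symmetric bundles -/

/-- An `O_Y`-module with a pairing, given by its sections over the non-empty affine open subschemes
of the integral scheme `Y`. The values of the pairing are viewed in the function field `K(Y)`, which
contains all the rings `O_Y(U)`. -/
structure PairedModule (Y : Scheme.{u}) [IsIntegral Y] where
  /-- the sections over `U` -/
  sec : NAffine Y → Type w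
  [addCommGroup : ∀ U, AddCommGroup (sec U)]
  [module : ∀ U, Module Γ(Y, U.opens) (sec U)]
  /-- the restriction maps -/
  res : ∀ {U W : NAffine Y} (h : W.opens ≤ U.opens),
    sec U →ₛₗ[(Y.presheaf.map (homOfLE h).op).hom] sec W
  res_refl : ∀ (U : NAffine Y) (x : sec U), res (le_refl U.opens) x = x
  res_trans : ∀ {U W Z : NAffine Y} (h : W.opens ≤ U.opens) (h' : Z.opens ≤ W.opens) (x : sec U),
    res h' (res h x) = res (h'.trans h) x
  /-- the pairing -/
  form : ∀ U, sec U → sec U → Y.functionField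

attribute [instance] PairedModule.addCommGroup PairedModule.module

/-- `M` is a symmetric bundle on `Y`: a quasi-coherent `O_Y`-module that is locally free of finite
rank, with a symmetric bilinear pairing with values in `O_Y` whose adjoint map to the dual module
is an isomorphism. -/
structure PairedModule.IsSymmetricBundle {Y : Scheme.{u}} [IsIntegral Y]
    (M : PairedModule.{u, w} Y) : Prop where
  /-- over a basic open `D(f)` of `U`, two sections over `U` agree only if they agree after
  multiplication by a power of `f` -/
  res_eq_zero : ∀ {U W : NAffine Y} (f : Γ(Y, U.opens)) (hW : W.opens = Y.basicOpen f)
    (x : M.sec U), M.res (hW ▸ Y.basicOpen_le f) x = 0 → ∃ n : ℕ, f ^ n • x = 0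
  /-- over a basic open `D(f)` of `U`, every section becomes the restriction of a section over `U`
  after multiplication by a power of `f` -/
  res_surj : ∀ {U W : NAffine Y} (f : Γ(Y, U.opens)) (hW : W.opens = Y.basicOpen f)
    (y : M.sec W), ∃ (n : ℕ) (x : M.sec U),
      M.res (hW ▸ Y.basicOpen_le f) x =
        (Y.presheaf.map (homOfLE (hW ▸ Y.basicOpen_le f : W.opens ≤ U.opens)).op).hom f ^ n • y
  locally_free : ∀ y : Y, ∃ U : NAffine Y, y ∈ U.opens ∧
    Module.Free Γ(Y, U.opens) (M.sec U) ∧ Module.Finite Γ(Y, U.opens) (M.sec U)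
  form_linear : ∀ (U : NAffine Y) (x : M.sec U), IsLinearMap Γ(Y, U.opens) (M.form U x)
  form_symm : ∀ (U : NAffine Y) (x y : M.sec U), M.form U x y = M.form U y x
  form_integral : ∀ (U : NAffine Y) (x y : M.sec U),
    ∃ r : Γ(Y, U.opens), algebraMap _ Y.functionField r = M.form U x y
  form_res : ∀ {U W : NAffine Y} (h : W.opens ≤ U.opens) (x y : M.sec U),
    M.form W (M.res h x) (M.res h y) = M.form U x y
  unimodular : ∀ (U : NAffine Y) (l : Module.Dual Γ(Y, U.opens) (M.sec U)),
    ∃! x : M.sec U, ∀ y, M.form U x y = algebraMap _ Y.functionField (l y)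

/-- An isometry of `O_Y`-modules with pairings. -/
structure PairedModule.Isometry {Y : Scheme.{u}} [IsIntegral Y]
    (M : PairedModule.{u, w} Y) (N : PairedModule.{u, w'} Y) where
  /-- the isomorphism on sections over `U` -/
  equiv : ∀ U, M.sec U ≃ₗ[Γ(Y, U.opens)] N.sec U
  equiv_res : ∀ {U W : NAffine Y} (h : W.opens ≤ U.opens) (x : M.sec U),
    equiv W (M.res h x) = N.res h (equiv U x)
  form_equiv : ∀ (U : NAffine Y) (x y : M.sec U), N.form U (equiv U x) (equiv U y) = M.form U x y

section Trace

variable {X Y : Scheme.{u}} [IsIntegral X] [IsIntegral Y] (f : X ⟶ Y) [IsDominant f]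

theorem algebraMap_map_extField {U W : NAffine Y} (h : W.opens ≤ U.opens) (r : Γ(Y, U.opens)) :
    algebraMap Γ(Y, W.opens) (ExtField f) ((Y.presheaf.map (homOfLE h).op).hom r) =
      algebraMap Γ(Y, U.opens) (ExtField f) r := by
  have : algebraMap Γ(Y, W.opens) Y.functionField ((Y.presheaf.map (homOfLE h).op).hom r) =
      algebraMap Γ(Y, U.opens) Y.functionField r :=
    TopCat.Presheaf.germ_res_apply Y.presheaf (homOfLE h) (genericPoint Y) _ r
  exact congrArg (ffMap f) this

/-- The restriction maps of `f_* D_{X/Y}^{-1/2}`: inclusions inside the function field of `X`. -/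
def pushRes {U W : NAffine Y} (h : W.opens ≤ U.opens) :
    pushSqrtCodiff f U →ₛₗ[(Y.presheaf.map (homOfLE h).op).hom] pushSqrtCodiff f W where
  toFun z := ⟨z.1, fun x hx => z.2 x (h hx)⟩
  map_add' _ _ := rfl
  map_smul' r z := Subtype.ext <| by
    refine (Algebra.smul_def r z.1).trans ?_
    rw [← algebraMap_map_extField f h]
    exact (Algebra.smul_def _ _).symm

/-- `(f_* D_{X/Y}^{-1/2}, Tr_{X/Y})`. -/
def sqrtCodiffBundle : PairedModule.{u, u} Y where
  sec U := pushSqrtCodiff f U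
  res h := pushRes f h
  res_refl _ _ := rfl
  res_trans _ _ _ := rfl
  form _ x y := fieldTrace f (x.1 * y.1)

end Trace

/-! ### Twists -/

section Algebra

variable {R : Type u} [CommRing R] {G : Type v} [Group G]

/-- The tensor product of a bilinear form `q` on `E` and a bilinear map `b` on `F`. -/
def tensorForm {E : Type*} {F : Type*} {L : Type*} [AddCommGroup E] [AddCommGroup F]
    [AddCommGroup L] [Module R E] [Module R F] [Module R L]
    (q : LinearMap.BilinForm R E) (b : LinearMap.BilinMap R F L) :
    LinearMap.BilinMap R (E ⊗[R] F) L :=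
  (LinearMap.BilinMap.tmul q b).compr₂ (TensorProduct.lid R L).toLinearMap

/-- The form `t^G` induced on the invariants `M^G` by a form `t` on `M`: `t^G (x, y) = t (m, y)` for
any `m` with `∑ g, g m = x`. -/
def invariantsForm [Fintype G] {M : Type*} {L : Type*} [AddCommGroup M] [Module R M]
    (r : Representation R G M) (t : M → M → L) (x y : r.invariants) : L :=
  t (Classical.epsilon fun m : M => ∑ g, r g m = x) y

/-- `M^G` is the image of `∑ g`, and `t (m, y)` depends only on `∑ g, g m`: the form `t^G` on the
invariants is well-defined. -/
def InvariantsFormWellDefined [Fintype G] {M : Type*} {L : Type*} [AddCommGroup M] [Module R M]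
    (r : Representation R G M) (t : M → M → L) : Prop :=
  (∀ x : r.invariants, ∃ m : M, ∑ g, r g m = x) ∧
    ∀ m m' : M, ∑ g, r g m = ∑ g, r g m' → ∀ y : r.invariants, t m y = t m' y

variable (H : Subgroup G)

variable (R) in
/-- The permutation representation of `G` on `R[G/H]`. -/
def permRep : Representation R G (G ⧸ H →₀ R) where
  toFun g := Finsupp.lmapDomain R R (g • ·)
  map_one' := by ext; simp
  map_mul' _ _ := by ext; simp [mul_smul]

variable (R) in
/-- The form on `R[G/H]` for which the cosets are an orthonormal basis. -/
def standardForm : LinearMap.BilinForm R (G ⧸ H →₀ R) :=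
  LinearMap.mk₂ R (fun x y => y.sum fun a c => x a * c)
    (fun x x' y => by simp [Finsupp.sum, add_mul, Finset.sum_add_distrib])
    (fun c x y => by simp [Finsupp.sum, mul_assoc, Finset.mul_sum])
    (fun x y y' => Finsupp.sum_add_index' (by simp) (by simp [mul_add]))
    (fun c x y => by
      rw [Finsupp.sum_smul_index (by simp), smul_eq_mul, Finsupp.mul_sum]
      exact Finsupp.sum_congr fun a _ => by ring)

/-- The base change `R[G/H] → S[G/H]`. -/
def permRes {S : Type u} [CommRing S] (σ : R →+* S) : (G ⧸ H →₀ R) →ₛₗ[σ] (G ⧸ H →₀ S) where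
  toFun x := x.mapRange σ (map_zero σ)
  map_add' x y := Finsupp.mapRange_add (map_add σ) x y
  map_smul' c x := by ext; simp

theorem permRep_permRes {S : Type u} [CommRing S] (σ : R →+* S) (g : G) (x : G ⧸ H →₀ R) :
    permRep S H g (permRes H σ x) = permRes H σ (permRep R H g x) :=
  Finsupp.mapDomain_mapRange (g • ·) x σ (map_zero σ) (map_add σ)

end Algebra

/-- An integral scheme `X` with an action of `G`, and its quotients `lam : X ⟶ V = X/H` and
`lam ≫ gam : X ⟶ Y = X/G`. -/
structure QuotientTower {G : Type v} [Group G] (H : Subgroup G) where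
  X : Scheme.{u}
  V : Scheme.{u}
  Y : Scheme.{u}
  lam : X ⟶ V
  gam : V ⟶ Y
  /-- the action of `G` on `X` -/
  φ : G →* Aut X
  isIntegral : IsIntegral X
  quotientH : IsQuotient (φ.comp H.subtype) lam
  quotientG : IsQuotient φ (lam ≫ gam)

namespace QuotientTower

variable {G : Type v} [Group G] {H : Subgroup G} (T : QuotientTower.{u} H)

instance : IsIntegral T.X := T.isIntegral
instance : IsIntegral T.V := T.quotientH.isIntegral
instance : IsIntegral T.Y := T.quotientG.isIntegral
instance : IsDominant T.lam := T.quotientH.isDominant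

/-- The quotient map `π : X ⟶ Y = X/G`. -/
abbrev pi : T.X ⟶ T.Y := T.lam ≫ T.gam

instance : IsDominant T.gam :=
  have : IsDominant (T.lam ≫ T.gam) := T.quotientG.isDominant
  IsDominant.of_comp T.lam T.gam

/-- The representation of `G` on the sections of `O_Y[G/H] ⊗ π_* D_{X/Y}^{-1/2}`: the permutation
representation on the first factor, the given action on the second. -/
def tensorRep (U : NAffine T.Y) : Representation Γ(T.Y, U.opens) G
    ((G ⧸ H →₀ Γ(T.Y, U.opens)) ⊗[Γ(T.Y, U.opens)] pushSqrtCodiff T.pi U) :=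
  (permRep _ H).tprod (galRep T.φ T.pi T.quotientG.invariant U)

/-- The form `Tr_{X/Y}` on the sections of `π_* D_{X/Y}^{-1/2}`. -/
def traceBilin (U : NAffine T.Y) :
    LinearMap.BilinMap Γ(T.Y, U.opens) (pushSqrtCodiff T.pi U) T.Y.functionField :=
  LinearMap.mk₂ _ (fun x y => fieldTrace T.pi (x.1 * y.1))
    (fun x x' y => by simp [add_mul])
    (fun c x y => (congrArg _ (smul_mul_assoc c x.1 y.1)).trans
      ((fieldTrace T.pi).map_smul_of_tower c _))
    (fun x y y' => by simp [mul_add])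
    (fun c x y => (congrArg _ (mul_smul_comm c x.1 y.1)).trans
      ((fieldTrace T.pi).map_smul_of_tower c _))

/-- The form `q ⊗ Tr_{X/Y}`, for the form `q` on `O_Y[G/H]` that has the cosets as an orthonormal
basis. -/
def tensorTrace (U : NAffine T.Y) : LinearMap.BilinMap Γ(T.Y, U.opens)
    ((G ⧸ H →₀ Γ(T.Y, U.opens)) ⊗[Γ(T.Y, U.opens)] pushSqrtCodiff T.pi U) T.Y.functionField :=
  tensorForm (standardForm _ H) (T.traceBilin U)

/-- The restriction maps of `O_Y[G/H] ⊗ π_* D_{X/Y}^{-1/2}`. -/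
def tensorRes {U W : NAffine T.Y} (h : W.opens ≤ U.opens) :=
  TensorProduct.map (permRes (G := G) H (T.Y.presheaf.map (homOfLE h).op).hom) (pushRes T.pi h)

theorem tensorRep_tensorRes {U W : NAffine T.Y} (h : W.opens ≤ U.opens) (g : G) (x) :
    T.tensorRep W g (T.tensorRes h x) = T.tensorRes h (T.tensorRep U g x) := by
  induction x with
  | zero => simp
  | add x y hx hy => rw [map_add, map_add, hx, hy, map_add, map_add]
  | tmul e z =>
    change permRep _ H g (permRes H _ e) ⊗ₜ _ = permRes H _ (permRep _ H g e) ⊗ₜ _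
    rw [permRep_permRes]; rfl

theorem tensorRes_refl (U : NAffine T.Y) (x) : T.tensorRes (le_refl U.opens) x = x := by
  induction x with
  | zero => simp
  | add x y hx hy => rw [map_add, hx, hy]
  | tmul e z =>
    change permRes H _ e ⊗ₜ z = _
    congr 1
    ext a
    change (T.Y.presheaf.map (𝟙 _)).hom (e a) = e a
    rw [CategoryTheory.Functor.map_id]; rfl

theorem tensorRes_trans {U W Z : NAffine T.Y} (h : W.opens ≤ U.opens) (h' : Z.opens ≤ W.opens)
    (x) : T.tensorRes h' (T.tensorRes h x) = T.tensorRes (h'.trans h) x := by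
  induction x with
  | zero => simp
  | add x y hx hy => rw [map_add, map_add, hx, hy, map_add]
  | tmul e z =>
    change permRes H _ (permRes H _ e) ⊗ₜ pushRes T.pi (h'.trans h) z = permRes H _ e ⊗ₜ _
    congr 1
    ext a
    exact congrArg (fun f : Γ(T.Y, U.opens) ⟶ Γ(T.Y, Z.opens) => f.hom (e a))
      (T.Y.presheaf.map_comp (homOfLE h).op (homOfLE h').op).symm

/-- The twist of `(O_Y[G/H], q)` by the permutation representation: the fixed submodule
`(O_Y[G/H] ⊗ π_* D_{X/Y}^{-1/2})^G` with the form `(q ⊗ Tr_{X/Y})^G`. -/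
def twist [Fintype G] : PairedModule.{u, max u v} T.Y where
  sec U := (T.tensorRep U).invariants
  res {U W} h :=
    { toFun := fun x => ⟨T.tensorRes h x.1, fun g => by
        rw [tensorRep_tensorRes, x.2 g]⟩
      map_add' := fun x y => Subtype.ext (map_add (T.tensorRes h) x.1 y.1)
      map_smul' := fun r x => Subtype.ext (map_smulₛₗ (T.tensorRes h) r x.1) }
  res_refl U x := Subtype.ext (T.tensorRes_refl U x.1)
  res_trans h h' x := Subtype.ext (T.tensorRes_trans h h' x.1)
  form U := invariantsForm (T.tensorRep U) fun x y => T.tensorTrace U x y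

/-- The sections of `(π_* D_{X/Y}^{-1/2})^H`. -/
def fixedSections (U : NAffine T.Y) : Submodule Γ(T.Y, U.opens) (ExtField T.pi) where
  carrier := {z | z ∈ pushSqrtCodiff T.pi U ∧ ∀ h ∈ H, galMap T.φ h z = z}
  zero_mem' := ⟨zero_mem _, fun h _ => map_zero (galMap T.φ h)⟩
  add_mem' {y z} hy hz := ⟨add_mem hy.1 hz.1, fun h hh =>
    (map_add (galMap T.φ h) y z).trans (congrArg₂ (· + ·) (hy.2 h hh) (hz.2 h hh))⟩
  smul_mem' r z hz := ⟨Submodule.smul_mem _ r hz.1, fun h hh => by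
    have e := congrArg Subtype.val
      ((galRep T.φ T.pi T.quotientG.invariant U h).map_smul r ⟨z, hz.1⟩)
    exact e.trans (congrArg (r • ·) (hz.2 h hh : (galMap T.φ h z : ExtField T.pi) = z))⟩

/-- The trace `Tr_{V/Y}` of an `H`-invariant element of `K(X)`, that is, of an element of
`K(X)^H = K(V)`. -/
def traceVY (z : ExtField T.pi) : T.Y.functionField :=
  fieldTrace T.gam (Function.invFun (ffMap T.lam) z)

/-- `((π_* D_{X/Y}^{-1/2})^H, Tr_{V/Y})`. -/
def fixedBundle : PairedModule.{u, u} T.Y where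
  sec U := T.fixedSections U
  res {U W} h :=
    { toFun := fun z => ⟨z.1, (pushRes T.pi h ⟨z.1, z.2.1⟩).2, z.2.2⟩
      map_add' := fun _ _ => rfl
      map_smul' := fun r z => Subtype.ext (by
        have e := congrArg Subtype.val ((pushRes T.pi h).map_smulₛₗ r ⟨z.1, z.2.1⟩)
        exact e) }
  res_refl _ _ := rfl
  res_trans _ _ _ := rfl
  form _ x y := T.traceVY (x.1 * y.1)

/-- A section of `(π_* D_{X/Y}^{-1/2})^H`, as an element of the function field of `X`. -/
def fixedVal {U : NAffine T.Y} (x : T.fixedBundle.sec U) : T.X.functionField :=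
  (x : T.fixedSections U).1

end QuotientTower

end

end FrohlichTwist

/-!
The statement is local on `Y`: for an affine open `U` it concerns the ring `A` of sections over `U`,
the ring `B` of sections of `π_* O_X` over `U`, with `A = B ^ G`, and their fraction fields `K` and
`L`. The proof has four ingredients.

Tameness. If the order of the inertia group of a prime `P` of `B` is not in `P`, independence of
characters shows that the trace `∑ g, g b` is not in `P` for some `b`
(`exists_sum_mul_smul_notMem`). It follows that `∑ g, g b = 1` for some `b : B`
(`exists_sum_smul_eq_one`), for subgroups as well, so that every `H`-invariant section is a sum over
`H`, and that the ramification index of a prime of height one divides the order of its inertia group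
(`IsPrimeVal.dvd_card_inertia`). In particular it is odd.

Duality. The square root of the codifferent is an invertible `B`-module (`isUnit_ringSqrtCodiff`):
locally at each point, a ramified prime of height one is generated by an element `g b - b`
(`exists_locally_principal`). Order estimates show that it is its own dual for the trace form:
`Tr (x y)` has order larger than `-e` at a prime with ramification index `e`, for `x` and `y` of
order at least `-(e - 1) / 2`, and orders less than `-(e - 1) / 2` are excluded because the trace
takes unit values. As `B` is flat over `A`, and then finite (`finite_of_flat`), the square root of the
codifferent is projective over `A` and the trace form on it is unimodular
(`existsUnique_trace_mul_eq`). The `H`-invariants are a direct summand, on which the form `Tr_{V/Y}`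
is unimodular by transitivity of the trace (`existsUnique_form_eq_of_fixed`). Quasi-coherence
(`exists_pow_mul_mem_pushSqrtCodiff`) yields the symmetric bundle of `H`-invariants.

The twist. A `G`-invariant element of `A[G/H] ⊗ M` is determined by its coefficient at the coset
`H`, which is an arbitrary `H`-invariant element of `M`. If the latter is `∑ h, h m`, the former is
`∑ g, g (H ⊗ m)`. This makes the form on the twist well defined, identifies the twist with the
`H`-invariants (`QuotientTower.twistMap`), and turns its form into
`Tr_{X/Y} (m n) = Tr_{V/Y} ((∑ h, h m) n)` (`QuotientTower.traceVY_twistMap`).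

The bundle on `V`. At a point of codimension one of `X` let `m` and `n` be the ramification indices
over `V` and over `Y`. The order on `X` of a function on `V` is a multiple of `m`, and `m` and `n`
are odd. Therefore it is at least `-(n - 1) / 2` if and only if the order on `V`, its quotient by
`m`, is at least `-(n / m - 1) / 2` (`QuotientTower.forall_mem_pow_lam_iff`).
-/

namespace FrohlichTwist

set_option linter.unusedSectionVars false

/-! ### Regular local rings -/

section Regular

open IsLocalRing

variable {R : Type*} [CommRing R]

/-- A parameter outside `𝔪 ^ 2` is a member of a minimal system of generators of `𝔪`, so one
generator fewer is enough for the maximal ideal of the quotient. -/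
theorem spanFinrank_maximalIdeal_quotient_lt [IsLocalRing R] [IsNoetherianRing R] {x : R}
    (hx : x ∈ maximalIdeal R) (hx2 : x ∉ maximalIdeal R ^ 2)
    [IsLocalRing (R ⧸ Ideal.span {x})] :
    (maximalIdeal (R ⧸ Ideal.span {x})).spanFinrank + 1 ≤ (maximalIdeal R).spanFinrank := by
  classical
  obtain ⟨s, hs, hspan⟩ :=
    (IsNoetherian.noetherian (maximalIdeal R)).exists_span_finset_card_eq_spanFinrank
  have hsm : ∀ i ∈ s, i ∈ maximalIdeal R := fun i hi => hspan ▸ Submodule.subset_span hi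
  have hxs : x ∈ Submodule.span R (s : Set R) := by rw [hspan]; exact hx
  obtain ⟨a, ha⟩ := Submodule.mem_span_finset.1 hxs
  obtain ⟨i, hi, hai⟩ : ∃ i ∈ s, IsUnit (a i) := by
    by_contra hcon
    push Not at hcon
    refine hx2 (ha.2 ▸ Ideal.sum_mem _ fun i hi => ?_)
    rw [pow_two]
    exact Ideal.mul_mem_mul ((mem_maximalIdeal _).2 (hcon i hi)) (hsm i hi)
  set q := Ideal.Quotient.mk (Ideal.span {x}) with hq
  have hqs : Function.Surjective q := Ideal.Quotient.mk_surjective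
  have hmap : maximalIdeal (R ⧸ Ideal.span {x}) =
      Ideal.span (((s.erase i).image q : Finset _) : Set (R ⧸ Ideal.span {x})) := by
    have h1 : maximalIdeal (R ⧸ Ideal.span {x}) = (maximalIdeal R).map q := by
      refine (eq_maximalIdeal ?_).symm
      refine (Ideal.map_eq_top_or_isMaximal_of_surjective q hqs inferInstance).resolve_left ?_
      intro htop
      have h2 : (maximalIdeal R).map q = ⊤ → maximalIdeal R ⊔ Ideal.span {x} = ⊤ := fun h => by
        have h3 := Ideal.comap_map_of_surjective q hqs (maximalIdeal R)
        rw [h, Ideal.comap_top, ← RingHom.ker_eq_comap_bot, Ideal.mk_ker] at h3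
        exact h3.symm
      refine (maximalIdeal.isMaximal R).ne_top (top_le_iff.1 ((h2 htop) ▸ ?_))
      exact sup_le le_rfl ((Ideal.span_singleton_le_iff_mem _).2 hx)
    rw [h1]
    apply le_antisymm
    · rw [Ideal.map_le_iff_le_comap, ← hspan]
      refine Submodule.span_le.2 fun j hj => ?_
      by_cases hji : j = i
      · subst hji
        have h0 : q x = 0 := Ideal.Quotient.eq_zero_iff_mem.2 (Ideal.mem_span_singleton_self x)
        have h2 : q (a j) * q j = - ∑ k ∈ s.erase j, q (a k) * q k := by
          rw [eq_neg_iff_add_eq_zero]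
          refine Eq.trans ?_ ((congrArg q ha.2).trans h0)
          rw [map_sum, ← Finset.add_sum_erase _ _ hj]
          simp
        obtain ⟨b, hb⟩ := hai.exists_left_inv
        have h3 : q j = q b * (q (a j) * q j) := by
          rw [← mul_assoc, ← map_mul, hb, map_one, one_mul]
        refine Ideal.mem_comap.2 ?_
        rw [h3, h2]
        refine Ideal.mul_mem_left _ _ (neg_mem (Ideal.sum_mem _ fun k hk =>
          Ideal.mul_mem_left _ _ (Ideal.subset_span ?_)))
        exact Finset.mem_coe.2 (Finset.mem_image_of_mem _ hk)
      · exact Ideal.subset_span (Finset.mem_coe.2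
          (Finset.mem_image_of_mem _ (Finset.mem_erase.2 ⟨hji, hj⟩)))
    · refine Ideal.span_le.2 fun y hy => ?_
      obtain ⟨k, hk, rfl⟩ := Finset.mem_image.1 (Finset.mem_coe.1 hy)
      exact Ideal.mem_map_of_mem q (hsm k (Finset.mem_of_mem_erase hk))
  have h5 : (maximalIdeal (R ⧸ Ideal.span {x})).spanFinrank ≤ (s.erase i).card := by
    rw [hmap]
    refine (Submodule.spanFinrank_span_le_ncard_of_finite (Finset.finite_toSet _)).trans ?_
    rw [Set.ncard_coe_finset]
    exact Finset.card_image_le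
  have := Finset.card_erase_add_one hi
  omega

theorem isLocalRing_quotient_span_singleton [IsLocalRing R] {x : R}
    (hx : x ∈ maximalIdeal R) : IsLocalRing (R ⧸ Ideal.span {x}) := by
  have : Nontrivial (R ⧸ Ideal.span {x}) := Ideal.Quotient.nontrivial_iff.2 fun h =>
    (mem_maximalIdeal x).1 hx (Ideal.span_singleton_eq_top.1 h)
  exact .of_surjective' _ Ideal.Quotient.mk_surjective

theorem isRegularLocalRing_quotient [IsRegularLocalRing R] {x : R}
    (hx : x ∈ maximalIdeal R) (hx2 : x ∉ maximalIdeal R ^ 2) :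
    IsRegularLocalRing (R ⧸ Ideal.span {x}) := by
  have := isLocalRing_quotient_span_singleton hx
  refine .of_spanFinrank_maximalIdeal_le _ ?_
  have h1 := spanFinrank_maximalIdeal_quotient_lt hx hx2
  have h2 : ringKrullDim R ≤ ringKrullDim (R ⧸ Ideal.span {x}) + 1 := by
    have h := ringKrullDim_le_ringKrullDim_quotient_add_card (R := R) {x}
      (by rw [IsLocalRing.ringJacobson_eq_maximalIdeal]; simpa using hx)
    rw [Finset.coe_singleton] at h
    simpa using h
  rw [← IsRegularLocalRing.spanFinrank_maximalIdeal (R := R)] at h2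
  have h3 : (((maximalIdeal (R ⧸ Ideal.span {x})).spanFinrank + 1 : ℕ) : WithBot ℕ∞) ≤
      ringKrullDim (R ⧸ Ideal.span {x}) + 1 := le_trans (by exact_mod_cast h1) h2
  push_cast at h3
  exact (ENat.WithBot.add_le_add_one_right_iff).1 h3

/-- A regular local ring is a domain, by induction on the dimension: prime avoidance gives a
parameter `x ∉ 𝔪 ^ 2` outside the minimal primes, `(x)` is prime by induction, and a minimal prime
`q ⊆ (x)` satisfies `q = x q`, so that `q = 0`. -/
theorem isDomain_of_isRegularLocalRing (R : Type*) [CommRing R] [IsRegularLocalRing R] :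
    IsDomain R := by
  induction h : (maximalIdeal R).spanFinrank generalizing R with
  | zero =>
    have h0 := (Submodule.spanFinrank_eq_zero_iff_eq_bot
      (IsNoetherian.noetherian (maximalIdeal R))).1 h
    exact (isField_iff_maximalIdeal_eq.2 h0).isDomain
  | succ n ih =>
    have hdim := IsRegularLocalRing.spanFinrank_maximalIdeal (R := R)
    have hne : maximalIdeal R ≠ ⊥ := fun h0 => by
      rw [(Submodule.spanFinrank_eq_zero_iff_eq_bot
        (IsNoetherian.noetherian (maximalIdeal R))).2 h0] at h
      omega
    obtain ⟨x, hx, hx2, hxq⟩ : ∃ x ∈ maximalIdeal R, x ∉ maximalIdeal R ^ 2 ∧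
        ∀ q ∈ minimalPrimes R, x ∉ q := by
      by_contra hcon
      push Not at hcon
      have hfin : (insert (maximalIdeal R ^ 2) (minimalPrimes R)).Finite :=
        (minimalPrimes.finite_of_isNoetherianRing R).insert _
      have := (Ideal.subset_union_prime_finite hfin (f := fun I => I) (I := maximalIdeal R)
        (maximalIdeal R ^ 2) (maximalIdeal R ^ 2) (fun i hi hne _ =>
          (hi.resolve_left hne).isPrime)).1 (fun x hx => by
            rw [Set.mem_iUnion₂]
            by_cases h2 : x ∈ maximalIdeal R ^ 2
            · exact ⟨_, Set.mem_insert _ _, h2⟩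
            · obtain ⟨q, hq, hxq⟩ := hcon x hx h2
              exact ⟨q, Set.mem_insert_of_mem _ hq, hxq⟩)
      obtain ⟨q, hq | hq, hle⟩ := this
      · refine hne (Submodule.eq_bot_of_le_smul_of_le_jacobson_bot (maximalIdeal R) _
          (IsNoetherian.noetherian _) ?_ (maximalIdeal_le_jacobson _))
        rw [smul_eq_mul, ← pow_two, ← hq]
        exact hle
      · have hqp := hq.isPrime
        have he : maximalIdeal R = q := le_antisymm hle (le_maximalIdeal hqp.ne_top)
        have h0 : (maximalIdeal R).height = 0 := by
          rw [he]
          exact Ideal.height_eq_zero_iff.2 hq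
        rw [← maximalIdeal_height_eq_ringKrullDim, h0, h] at hdim
        norm_cast at hdim
    have hreg := isRegularLocalRing_quotient hx hx2
    have hle := spanFinrank_maximalIdeal_quotient_lt hx hx2
    have hle2 : (maximalIdeal (R ⧸ Ideal.span {x})).spanFinrank = n := by
      refine le_antisymm (by omega) ?_
      have h2 := ringKrullDim_le_ringKrullDim_quotient_add_card (R := R) {x}
        (by rw [IsLocalRing.ringJacobson_eq_maximalIdeal]; simpa using hx)
      rw [← hdim, h, Finset.coe_singleton,
        ← IsRegularLocalRing.spanFinrank_maximalIdeal (R := R ⧸ Ideal.span {x})] at h2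
      norm_cast at h2
      simp at h2
      omega
    have hdom := ih (R ⧸ Ideal.span {x}) hle2
    have hprime : (Ideal.span {x}).IsPrime := (Ideal.Quotient.isDomain_iff_prime _).1 hdom
    obtain ⟨q, hq, hqx⟩ := Ideal.exists_minimalPrimes_le (bot_le : ⊥ ≤ Ideal.span {x})
    have hqp : q.IsPrime := hq.isPrime
    have hbot : q = ⊥ := by
      refine Submodule.eq_bot_of_le_smul_of_le_jacobson_bot (maximalIdeal R) _
        (IsNoetherian.noetherian _) ?_ (maximalIdeal_le_jacobson _)
      intro y hy
      obtain ⟨z, rfl⟩ := Ideal.mem_span_singleton'.1 (hqx hy)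
      rw [mul_comm, ← smul_eq_mul]
      exact Submodule.smul_mem_smul hx
        ((hqp.mem_or_mem hy).resolve_right (hxq q hq))
    rw [hbot] at hqp
    exact IsDomain.of_bot_isPrime R

/-- A parameter outside `𝔪 ^ 2` of a regular local ring is prime, as the quotient is regular too. -/
theorem prime_span_singleton_of_notMem_sq [IsRegularLocalRing R] {x : R}
    (hx : x ∈ maximalIdeal R) (hx2 : x ∉ maximalIdeal R ^ 2) : (Ideal.span {x}).IsPrime := by
  have := isRegularLocalRing_quotient hx hx2
  exact (Ideal.Quotient.isDomain_iff_prime _).1 (isDomain_of_isRegularLocalRing _)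

/-- A regular local ring of dimension at least two has depth at least two: if the maximal ideal is
the annihilator of the class of `c` modulo `b ≠ 0`, the dimension is at most one. -/
theorem ringKrullDim_le_one_of_maximalIdeal_mul [IsRegularLocalRing R] {b c : R} (hb : b ≠ 0)
    (hbm : ∀ x ∈ maximalIdeal R, b ∣ x * c) (hc : ¬ b ∣ c) : ringKrullDim R ≤ 1 := by
  have hdom := isDomain_of_isRegularLocalRing R
  by_cases hbot : maximalIdeal R = ⊥
  · rw [ringKrullDim_eq_zero_of_isField (isField_iff_maximalIdeal_eq.2 hbot)]
    exact zero_le_one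
  obtain ⟨x, hx, hx2⟩ : ∃ x ∈ maximalIdeal R, x ∉ maximalIdeal R ^ 2 := by
    by_contra hcon
    push Not at hcon
    refine hbot (Submodule.eq_bot_of_le_smul_of_le_jacobson_bot (maximalIdeal R) _
      (IsNoetherian.noetherian _) ?_ (maximalIdeal_le_jacobson _))
    rw [smul_eq_mul, ← pow_two]
    exact hcon
  have hp := prime_span_singleton_of_notMem_sq hx hx2
  have hx0 : x ≠ 0 := fun h => hx2 (h ▸ zero_mem _)
  have hxp : Prime x := (Ideal.span_singleton_prime hx0).1 hp
  have hle : maximalIdeal R ≤ Ideal.span {x} := by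
    intro y hy
    by_contra hyx
    rw [Ideal.mem_span_singleton] at hyx
    obtain ⟨s, hs⟩ := hbm x hx
    obtain ⟨t, ht⟩ := hbm y hy
    have h1 : y * s = x * t := mul_left_cancel₀ hb (by
      linear_combination (-y) * hs + x * ht)
    obtain ⟨s', rfl⟩ := (hxp.dvd_or_dvd (Dvd.intro _ h1.symm)).resolve_left hyx
    exact hc ⟨s', mul_left_cancel₀ hx0 (by linear_combination hs)⟩
  rw [← IsRegularLocalRing.spanFinrank_maximalIdeal (R := R),
    le_antisymm hle ((Ideal.span_singleton_le_iff_mem _).2 hx)]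
  have h1 : (Submodule.span R {x}).spanFinrank = 1 := Submodule.spanFinrank_singleton hx0
  change (((Submodule.span R {x}).spanFinrank : ℕ) : WithBot ℕ∞) ≤ 1
  rw [h1]
  norm_num

/-- Dimension one in a regular local ring means a discrete valuation ring. -/
theorem isDiscreteValuationRing_of_regular [IsDomain R] [IsRegularLocalRing R]
    (h : ringKrullDim R = 1) : IsDiscreteValuationRing R := by
  rw [← finrank_CotangentSpace_eq_one_iff]
  have := (IsRegularLocalRing.iff_finrank_cotangentSpace R).1 inferInstance
  rw [h] at this
  exact_mod_cast this

end Regular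

/-! ### Valuations attached to prime ideals -/

section PrimeVal

open IsLocalRing WithZero

/-- `v` is a discrete valuation of the field `F` whose valuation ring is the localization of `C` at
the prime ideal `P`, with values in `e ℤ`: the elements of `P` have order at least `e`, and some
element has order `e`. The valuation need not be normalized, so that a normalized valuation of an
extension field restricts to one of this kind, `e` being the ramification index. -/
structure IsPrimeVal {C F : Type*} [CommRing C] [Field F] [Algebra C F] (P : Ideal C)
    (v : Valuation F ℤᵐ⁰) (e : ℕ) : Prop where
  le_one : ∀ c, v (algebraMap C F c) ≤ 1
  lt_one_iff : ∀ c, v (algebraMap C F c) < 1 ↔ c ∈ P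
  exists_mul : ∀ z, v z ≤ 1 → ∃ s ∉ P, ∃ c, algebraMap C F c = algebraMap C F s * z
  pos : 0 < e
  exists_uniformizer : ∃ t ∈ P, v (algebraMap C F t) = exp (-(e : ℤ))
  le_exp : ∀ c ∈ P, v (algebraMap C F c) ≤ exp (-(e : ℤ))

namespace IsPrimeVal

variable {C F : Type*} [CommRing C] [Field F] [Algebra C F] {P : Ideal C}
  {v v' : Valuation F ℤᵐ⁰} {e e' : ℕ}

theorem eq_one (h : IsPrimeVal P v e) {s : C} (hs : s ∉ P) : v (algebraMap C F s) = 1 :=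
  le_antisymm (h.le_one s) (not_lt.1 fun h' => hs ((h.lt_one_iff s).1 h'))

theorem isPrime (h : IsPrimeVal P v e) : P.IsPrime := by
  refine ⟨?_, fun {a b} hab => ?_⟩
  · rw [Ideal.ne_top_iff_one, ← h.lt_one_iff, map_one, map_one]
    exact lt_irrefl _
  · by_contra hcon
    push Not at hcon
    have := (h.lt_one_iff _).2 hab
    rw [map_mul, map_mul, h.eq_one hcon.1, h.eq_one hcon.2, one_mul] at this
    exact lt_irrefl _ this

theorem exists_eq_exp (h : IsPrimeVal P v e) {z : F} (hz : z ≠ 0) :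
    ∃ k : ℤ, v z = exp (k * e) := by
  obtain ⟨t, ht, hvt⟩ := h.exists_uniformizer
  have he : (0 : ℤ) < e := by exact_mod_cast h.pos
  have hvz : v z ≠ 0 := (Valuation.ne_zero_iff v).2 hz
  obtain ⟨n, hn⟩ : ∃ n : ℤ, v z = exp n := ⟨log (v z), (exp_log hvz).symm⟩
  set q := n / e
  set r := n % e
  have hqr : n = q * e + r := by rw [mul_comm]; exact (Int.mul_ediv_add_emod n e).symm
  have hr0 : 0 ≤ r := Int.emod_nonneg _ he.ne'
  have hre : r < e := Int.emod_lt_of_pos _ he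
  have hv : v ((z * algebraMap C F t ^ q)⁻¹) = exp (-r) := by
    rw [map_inv₀, map_mul, map_zpow₀, hn, hvt, ← exp_zsmul, ← exp_add, ← exp_neg]
    congr 1
    rw [hqr]
    simp
  obtain ⟨s, hs, c, hc⟩ := h.exists_mul _ (by rw [hv, ← exp_zero, exp_le_exp]; omega)
  have hvc : v (algebraMap C F c) = exp (-r) := by
    rw [hc, map_mul, h.eq_one hs, one_mul, hv]
  have hr : r = 0 := by
    by_contra hr
    have h1 : c ∈ P := by
      rw [← h.lt_one_iff, hvc, ← exp_zero, exp_lt_exp]; omega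
    have h2 := h.le_exp c h1
    rw [hvc, exp_le_exp] at h2
    omega
  exact ⟨q, by rw [hn, hqr, hr, add_zero]⟩

theorem le_exp_of_mem_pow (h : IsPrimeVal P v e) {n : ℕ} {c : C} (hc : c ∈ P ^ n) :
    v (algebraMap C F c) ≤ exp (-(n * e : ℤ)) := by
  induction n generalizing c with
  | zero => simpa using h.le_one c
  | succ n ih =>
    rw [pow_succ] at hc
    induction hc using Submodule.mul_induction_on' with
    | mem_mul_mem a ha b hb =>
      rw [map_mul, map_mul]
      refine (mul_le_mul' (ih ha) (h.le_exp b hb)).trans_eq ?_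
      rw [← exp_add]
      congr 1
      push_cast
      ring
    | add a _ b _ ha hb =>
      rw [map_add]
      exact v.map_add_le ha hb

/-- Elements of order at least `n e` lie in the symbolic power `P ^ (n)`. -/
theorem exists_mul_mem_pow (h : IsPrimeVal P v e) (hinj : Function.Injective (algebraMap C F))
    {n : ℕ} {c : C} (hc : v (algebraMap C F c) ≤ exp (-(n * e : ℤ))) :
    ∃ s ∉ P, s * c ∈ P ^ n := by
  obtain ⟨t, ht, hvt⟩ := h.exists_uniformizer
  have ht0 : algebraMap C F t ≠ 0 := (Valuation.ne_zero_iff v).1 (by rw [hvt]; exact exp_ne_zero)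
  obtain ⟨s, hs, b, hb⟩ := h.exists_mul (algebraMap C F c / algebraMap C F t ^ n) (by
    rw [map_div₀, map_pow, hvt, ← exp_nsmul, div_le_one₀ (exp_pos)]
    simpa using hc)
  refine ⟨s, hs, ?_⟩
  have : s * c = b * t ^ n := hinj (by
    rw [map_mul, map_mul, map_pow, hb]; field_simp)
  rw [this]
  exact Ideal.mul_mem_left _ _ (Ideal.pow_mem_pow ht n)

theorem le_one_iff (h : IsPrimeVal P v e) {z : F} :
    v z ≤ 1 ↔ ∃ s ∉ P, ∃ c, algebraMap C F c = algebraMap C F s * z := by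
  refine ⟨h.exists_mul z, fun ⟨s, hs, c, hc⟩ => ?_⟩
  have := h.le_one c
  rwa [hc, map_mul, h.eq_one hs, one_mul] at this

theorem index_unique (h : IsPrimeVal P v e) (h' : IsPrimeVal P v e') : e = e' := by
  obtain ⟨t, ht, hvt⟩ := h.exists_uniformizer
  obtain ⟨t', ht', hvt'⟩ := h'.exists_uniformizer
  have h1 := h'.le_exp t ht
  have h2 := h.le_exp t' ht'
  rw [hvt, exp_le_exp] at h1
  rw [hvt', exp_le_exp] at h2
  omega

/-- A discrete valuation is determined by its valuation ring and by its value group. -/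
theorem unique (h : IsPrimeVal P v e) (h' : IsPrimeVal P v' e) : v = v' := by
  have hle : ∀ z, v z ≤ 1 ↔ v' z ≤ 1 := fun z => by rw [h.le_one_iff, h'.le_one_iff]
  have hge : ∀ z, z ≠ 0 → (1 ≤ v z ↔ 1 ≤ v' z) := fun z hz => by
    have := hle z⁻¹
    rwa [map_inv₀, map_inv₀, inv_le_one₀ (zero_lt_iff.2 ((Valuation.ne_zero_iff _).2 hz)),
      inv_le_one₀ (zero_lt_iff.2 ((Valuation.ne_zero_iff _).2 hz))] at this
  have hone : ∀ z, v z = 1 → v' z = 1 := fun z hz =>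
    le_antisymm ((hle z).1 hz.le) ((hge z (fun h0 => by simp [h0] at hz)).1 hz.ge)
  obtain ⟨t, ht, hvt⟩ := h.exists_uniformizer
  obtain ⟨t', ht', hvt'⟩ := h'.exists_uniformizer
  have ht0 : algebraMap C F t ≠ 0 := (Valuation.ne_zero_iff v).1 (by rw [hvt]; exact exp_ne_zero)
  have ht : v' (algebraMap C F t) = exp (-(e : ℤ)) := by
    refine le_antisymm (h'.le_exp t ht) ?_
    have h1 : v (algebraMap C F t' / algebraMap C F t) ≤ 1 := by
      rw [map_div₀, hvt, div_le_one₀ exp_pos]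
      exact h.le_exp t' ht'
    rw [hle, map_div₀, hvt', div_le_one₀ (zero_lt_iff.2 ((Valuation.ne_zero_iff _).2 ht0))] at h1
    exact h1
  ext z
  by_cases hz : z = 0
  · simp [hz]
  obtain ⟨k, hk⟩ := h.exists_eq_exp hz
  have h1 := hone (z * algebraMap C F t ^ k) (by
    rw [map_mul, map_zpow₀, hk, hvt, ← exp_zsmul, ← exp_add, ← exp_zero]
    congr 1
    simp)
  rw [map_mul, map_zpow₀, ht, ← exp_zsmul] at h1
  rw [hk, eq_comm, eq_div_of_mul_eq exp_ne_zero h1, one_div, ← exp_neg]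
  congr 1
  simp

/-- Passage to the local ring at `P`. -/
theorem localization [P.IsPrime] {O : Type*} [CommRing O] [Algebra C O]
    [IsLocalization.AtPrime O P] [IsLocalRing O] [Algebra O F] [IsScalarTower C O F] :
    IsPrimeVal (maximalIdeal O) v e ↔ IsPrimeVal P v e := by
  have hmem : ∀ c, algebraMap C O c ∈ maximalIdeal O ↔ c ∈ P := fun c =>
    IsLocalization.AtPrime.to_map_mem_maximal_iff O P c
  constructor
  · intro h
    have hmul : ∀ z, v z ≤ 1 → ∃ s ∉ P, ∃ c, algebraMap C F c = algebraMap C F s * z := by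
      intro z hz
      obtain ⟨s, hs, a, ha⟩ := h.exists_mul z hz
      obtain ⟨⟨c, d⟩, hc⟩ := IsLocalization.surj P.primeCompl
        (a * ((notMem_maximalIdeal.1 hs).unit⁻¹ : Oˣ))
      refine ⟨d, d.2, c, ?_⟩
      have h1 : algebraMap O F (((notMem_maximalIdeal.1 hs).unit⁻¹ : Oˣ) : O) *
          algebraMap O F s = 1 := by
        rw [← map_mul, IsUnit.val_inv_mul, map_one]
      rw [IsScalarTower.algebraMap_apply C O F, ← hc, map_mul, map_mul, ha,
        ← IsScalarTower.algebraMap_apply C O F]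
      linear_combination (algebraMap C F d * z) * h1
    refine ⟨fun c => ?_, fun c => ?_, hmul, h.pos, ?_, fun c hc => ?_⟩
    · rw [IsScalarTower.algebraMap_apply C O F]; exact h.le_one _
    · rw [IsScalarTower.algebraMap_apply C O F, h.lt_one_iff, hmem]
    · obtain ⟨t, ht, hvt⟩ := h.exists_uniformizer
      obtain ⟨⟨c, d⟩, hc⟩ := IsLocalization.surj P.primeCompl t
      refine ⟨c, (hmem c).1 (hc ▸ Ideal.mul_mem_right _ _ ht), ?_⟩
      rw [IsScalarTower.algebraMap_apply C O F, ← hc, map_mul, map_mul, hvt,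
        h.eq_one (fun h => d.2 ((hmem _).1 h)), mul_one]
    · rw [IsScalarTower.algebraMap_apply C O F]; exact h.le_exp _ ((hmem c).2 hc)
  · intro h
    have key : ∀ a : O, ∃ c, v (algebraMap O F a) = v (algebraMap C F c) ∧
        (a ∈ maximalIdeal O ↔ c ∈ P) := by
      intro a
      obtain ⟨⟨c, d⟩, hc⟩ := IsLocalization.surj P.primeCompl a
      have hd : v (algebraMap C F d) = 1 := h.eq_one d.2
      refine ⟨c, ?_, ?_⟩
      · rw [IsScalarTower.algebraMap_apply C O F c, ← hc, map_mul, map_mul,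
          ← IsScalarTower.algebraMap_apply C O F, hd, mul_one]
      · rw [← hmem, ← hc]
        refine ⟨fun h => Ideal.mul_mem_right _ _ h, fun h => ?_⟩
        exact ((maximalIdeal.isMaximal O).isPrime.mem_or_mem h).resolve_right
          fun h => d.2 ((hmem _).1 h)
    refine ⟨fun a => ?_, fun a => ?_, fun z hz => ?_, h.pos, ?_, fun a ha => ?_⟩
    · obtain ⟨c, hc, -⟩ := key a
      rw [hc]; exact h.le_one c
    · obtain ⟨c, hc, hc'⟩ := key a
      rw [hc, hc']; exact h.lt_one_iff c
    · obtain ⟨s, hs, c, hc⟩ := h.exists_mul z hz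
      refine ⟨algebraMap C O s, fun h => hs ((hmem s).1 h), algebraMap C O c, ?_⟩
      rw [← IsScalarTower.algebraMap_apply, ← IsScalarTower.algebraMap_apply, hc]
    · obtain ⟨t, ht, hvt⟩ := h.exists_uniformizer
      exact ⟨algebraMap C O t, (hmem t).2 ht, by rw [← IsScalarTower.algebraMap_apply, hvt]⟩
    · obtain ⟨c, hc, hc'⟩ := key a
      rw [hc]; exact h.le_exp c (hc'.1 ha)

theorem of_isDiscreteValuationRing (O : Type*) [CommRing O] [IsDomain O]
    [IsDiscreteValuationRing O] [Algebra O F] [IsFractionRing O F] :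
    ∃ v : Valuation F ℤᵐ⁰, IsPrimeVal (maximalIdeal O) v 1 := by
  set w := IsDiscreteValuationRing.maximalIdeal O
  have hw : w.asIdeal = maximalIdeal O := rfl
  refine ⟨w.valuation F, fun c => w.valuation_le_one c, fun c => w.valuation_lt_one_iff_mem c,
    fun z hz => ?_, one_pos, ?_, fun c hc => ?_⟩
  · obtain ⟨a, ha⟩ := IsDiscreteValuationRing.exists_lift_of_le_one hz
    refine ⟨1, ?_, a, by rw [ha, map_one, one_mul]⟩
    exact (Ideal.ne_top_iff_one _).1 (maximalIdeal.isMaximal O).ne_top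
  · obtain ⟨t, ht⟩ := w.intValuation_exists_uniformizer
    have h2 : w.valuation F (algebraMap O F t) = exp (-((1 : ℕ) : ℤ)) := by
      rw [w.valuation_of_algebraMap, ht]; rfl
    refine ⟨t, ?_, h2⟩
    rw [← hw, ← w.valuation_lt_one_iff_mem (K := F), h2, ← exp_zero, exp_lt_exp]
    norm_num
  · rw [w.valuation_of_algebraMap]
    have := (w.intValuation_le_pow_iff_mem c 1).2 (by rwa [pow_one])
    exact this

/-- The local ring of a discrete valuation has dimension one. -/
theorem ringKrullDim_eq_one {O : Type*} [CommRing O] [IsDomain O] [IsLocalRing O]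
    [Algebra O F] [IsFractionRing O F] (h : IsPrimeVal (maximalIdeal O) v e) :
    ringKrullDim O = 1 := by
  have hinj := IsFractionRing.injective O F
  obtain ⟨t, ht, hvt⟩ := h.exists_uniformizer
  have he : (0 : ℤ) < e := by exact_mod_cast h.pos
  have ht0 : algebraMap O F t ≠ 0 := (Valuation.ne_zero_iff v).1 (by rw [hvt]; exact exp_ne_zero)
  have ht0' : t ≠ 0 := fun h => ht0 (by rw [h, map_zero])
  have hint : ∀ z, v z ≤ 1 → ∃ a, algebraMap O F a = z := fun z hz => by
    obtain ⟨s, hs, a, ha⟩ := h.exists_mul z hz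
    refine ⟨((notMem_maximalIdeal.1 hs).unit⁻¹ : Oˣ) * a, ?_⟩
    rw [map_mul, ha, ← mul_assoc, ← map_mul, IsUnit.val_inv_mul, map_one, one_mul]
  have hdvr : IsDiscreteValuationRing O := by
    refine IsDiscreteValuationRing.ofHasUnitMulPowIrreducibleFactorization ⟨t, ⟨?_, ?_⟩, ?_⟩
    · exact (mem_maximalIdeal t).1 ht
    · intro a b hab
      by_contra hcon
      push Not at hcon
      have h1 := mul_le_mul' (h.le_exp a hcon.1) (h.le_exp b hcon.2)
      rw [← map_mul, ← map_mul, ← hab, hvt, ← exp_add, exp_le_exp] at h1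
      omega
    · intro x hx
      obtain ⟨k, hk⟩ := h.exists_eq_exp (z := algebraMap O F x)
        (fun h0 => hx (hinj (by rw [h0, map_zero])))
      have hk0 : k ≤ 0 := by
        have := h.le_one x
        rw [hk, ← exp_zero, exp_le_exp] at this
        nlinarith
      refine ⟨k.natAbs, ?_⟩
      have hv : v (algebraMap O F (t ^ k.natAbs)) = v (algebraMap O F x) := by
        rw [map_pow, map_pow, hvt, hk, ← exp_nsmul]
        congr 1
        rw [nsmul_eq_mul, Int.natCast_natAbs, abs_of_nonpos hk0]
        ring
      have hx0 : algebraMap O F x ≠ 0 := fun h0 => hx (hinj (by rw [h0, map_zero]))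
      have hp0 : algebraMap O F (t ^ k.natAbs) ≠ 0 := by
        rw [map_pow]; exact pow_ne_zero _ ht0
      obtain ⟨a, ha⟩ := hint (algebraMap O F x / algebraMap O F (t ^ k.natAbs)) (by
        rw [map_div₀, hv, div_self ((Valuation.ne_zero_iff v).2 hx0)])
      obtain ⟨b, hb⟩ := hint (algebraMap O F (t ^ k.natAbs) / algebraMap O F x) (by
        rw [map_div₀, hv, div_self ((Valuation.ne_zero_iff v).2 hx0)])
      refine associated_of_dvd_dvd ⟨a, hinj ?_⟩ ⟨b, hinj ?_⟩
      · rw [map_mul, ha]; field_simp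
      · rw [map_mul, hb]; field_simp
  exact IsDiscreteValuationRing.ringKrullDim_eq_one O

end IsPrimeVal

section Regular

variable {B L : Type*} [CommRing B] [IsDomain B] [Field L] [Algebra B L] [IsFractionRing B L]

/-- A prime of height one with a regular local ring has a normalized valuation. -/
theorem exists_isPrimeVal [IsNoetherianRing B] {P : Ideal B} [P.IsPrime] (hP : P.height = 1)
    (hreg : IsRegularLocalRing (Localization.AtPrime P)) :
    ∃ v : Valuation L ℤᵐ⁰, IsPrimeVal P v 1 := by
  have hle : P.primeCompl ≤ nonZeroDivisors B := P.primeCompl_le_nonZeroDivisors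
  let _ : Algebra (Localization.AtPrime P) L :=
    IsLocalization.localizationAlgebraOfSubmonoidLe (Localization.AtPrime P) L P.primeCompl
      (nonZeroDivisors B) hle
  have : IsScalarTower B (Localization.AtPrime P) L :=
    IsLocalization.localization_isScalarTower_of_submonoid_le (Localization.AtPrime P) L
      P.primeCompl (nonZeroDivisors B) hle
  have : IsFractionRing (Localization.AtPrime P) L :=
    IsFractionRing.isFractionRing_of_isDomain_of_isLocalization P.primeCompl _ _
  have hd : IsDiscreteValuationRing (Localization.AtPrime P) := by
    refine isDiscreteValuationRing_of_regular ?_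
    rw [IsLocalization.AtPrime.ringKrullDim_eq_height P, hP]
    rfl
  obtain ⟨v, hv⟩ := IsPrimeVal.of_isDiscreteValuationRing (F := L) (Localization.AtPrime P)
  exact ⟨v, IsPrimeVal.localization.1 hv⟩

/-- A fraction that is integral in codimension one is integral, on a ring all of whose local rings
are regular: an associated prime of a principal ideal has height one. -/
theorem exists_algebraMap_eq_of_codimOne [IsNoetherianRing B]
    (hreg : ∀ (P : Ideal B) [P.IsPrime], IsRegularLocalRing (Localization.AtPrime P)) {z : L}
    (hz : ∀ (P : Ideal B) [P.IsPrime], P.height = 1 →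
      ∃ s ∉ P, ∃ c, algebraMap B L c = algebraMap B L s * z) :
    ∃ b, algebraMap B L b = z := by
  have hinj := IsFractionRing.injective B L
  obtain ⟨a, b, hb, rfl⟩ := IsFractionRing.div_surjective (A := B) z
  have hb0 : b ≠ 0 := nonZeroDivisors.ne_zero hb
  have hbL : algebraMap B L b ≠ 0 := fun h => hb0 (hinj (by rw [h, map_zero]))
  set q := Ideal.Quotient.mk (Ideal.span {b}) with hq
  have hq0 : ∀ x, q x = 0 ↔ b ∣ x := fun x => by
    rw [hq, Ideal.Quotient.eq_zero_iff_mem, Ideal.mem_span_singleton]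
  by_cases ha : q a = 0
  · obtain ⟨c, rfl⟩ := (hq0 a).1 ha
    exact ⟨c, by rw [map_mul]; field_simp⟩
  exfalso
  obtain ⟨P, hP, hle⟩ := exists_le_isAssociatedPrime_of_isNoetherianRing B (q a) ha
  have hle' : ∀ x, b ∣ x * a → x ∈ P := fun x hx => hle (by
    rw [Submodule.mem_colon_singleton, Submodule.mem_bot]
    change q (x * a) = 0
    exact (hq0 _).2 hx)
  have hPp : P.IsPrime := hP.isPrime
  obtain ⟨-, y, hy⟩ := isAssociatedPrime_iff.1 hP
  obtain ⟨c, rfl⟩ := Ideal.Quotient.mk_surjective y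
  have hc : ∀ x, x ∈ P ↔ b ∣ x * c := fun x => by
    rw [hy, Submodule.mem_colon_singleton, Submodule.mem_bot, ← hq0]; rfl
  have hbP : b ∈ P := (hc b).2 (Dvd.intro _ rfl)
  have hR := hreg P
  have hRinj : Function.Injective (algebraMap B (Localization.AtPrime P)) :=
    IsLocalization.injective _ P.primeCompl_le_nonZeroDivisors
  have hdim : ringKrullDim (Localization.AtPrime P) ≤ 1 := by
    refine ringKrullDim_le_one_of_maximalIdeal_mul (b := algebraMap _ _ b)
      (c := algebraMap _ _ c) (fun h => hb0 (hRinj (by rw [h, map_zero]))) ?_ ?_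
    · intro x hx
      obtain ⟨⟨d, s⟩, hd⟩ := IsLocalization.surj P.primeCompl x
      have hdP : d ∈ P := (IsLocalization.AtPrime.to_map_mem_maximal_iff
        (Localization.AtPrime P) P d).1 (hd ▸ Ideal.mul_mem_right _ _ hx)
      have h1 : algebraMap B (Localization.AtPrime P) b ∣ (x * algebraMap _ _ c) *
          algebraMap B (Localization.AtPrime P) s := by
        have := map_dvd (algebraMap B (Localization.AtPrime P)) ((hc d).1 hdP)
        rw [map_mul, ← hd] at this
        convert this using 1
        ring
      exact ((IsLocalization.map_units (Localization.AtPrime P) s).dvd_mul_right).1 h1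
    · rintro ⟨x, hx⟩
      obtain ⟨⟨d, s⟩, hd⟩ := IsLocalization.surj P.primeCompl x
      refine s.2 ((hc s).2 ⟨d, hRinj ?_⟩)
      rw [map_mul, map_mul, ← hd, hx]
      ring
  have hht : P.height = 1 := by
    rw [IsLocalization.AtPrime.ringKrullDim_eq_height P] at hdim
    refine le_antisymm (by exact_mod_cast hdim) (Order.one_le_iff_pos.2 (pos_iff_ne_zero.2 ?_))
    intro h0
    have := Ideal.height_eq_zero_iff.1 h0
    rw [IsDomain.minimalPrimes_eq_singleton_bot] at this
    rw [Set.mem_singleton_iff.1 this] at hbP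
    exact hb0 hbP
  obtain ⟨s, hs, x, hx⟩ := hz P hht
  refine hs (hle' s ⟨x, hinj ?_⟩)
  rw [map_mul, map_mul, hx]
  field_simp

end Regular

end PrimeVal

/-! ### Traces and inertia -/

section Inertia

open WithZero
open scoped Pointwise

variable {G : Type*} [Group G] {B : Type*} [CommRing B] [MulSemiringAction G B]

/-- A weighted trace does not vanish modulo a tame prime `P`: the maps `b ↦ g b mod P` are
characters, two of them agree exactly when they differ by an element of the inertia group, and
distinct characters are linearly independent. -/
theorem exists_sum_mul_smul_notMem [Fintype G] {P : Ideal B} [P.IsPrime]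
    (htame : (Nat.card (P.inertia G) : B) ∉ P) (w : G → B)
    (hw : ∀ h ∈ P.inertia G, ∀ g, w (h * g) - w g ∈ P) {g₀ : G} (hg₀ : w g₀ ∉ P) :
    ∃ b : B, ∑ g, w g * g • b ∉ P := by
  classical
  by_contra hcon
  push Not at hcon
  let q := Ideal.Quotient.mk P
  have hq : ∀ x, q x = 0 ↔ x ∈ P := fun x => Ideal.Quotient.eq_zero_iff_mem
  let χ : G → (B →* B ⧸ P) := fun g =>
    (q : B →* B ⧸ P).comp (MulSemiringAction.toRingHom G B g : B →* B)
  have hχ : ∀ g b, χ g b = q (g • b) := fun _ _ => rfl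
  have hχeq : ∀ g, χ g = χ g₀ ↔ g * g₀⁻¹ ∈ P.inertia G := by
    intro g
    constructor
    · intro h b
      have h1 := DFunLike.congr_fun h (g₀⁻¹ • b)
      rw [hχ, hχ, smul_inv_smul, smul_smul] at h1
      exact (hq _).1 (by rw [map_sub, h1, sub_self])
    · intro h
      ext b
      have h1 := (hq _).2 (h (g₀ • b))
      rw [smul_smul, inv_mul_cancel_right, map_sub, sub_eq_zero] at h1
      exact h1
  have hli := linearIndependent_iff'.1 (linearIndependent_monoidHom B (B ⧸ P))
    (Finset.univ.image χ) (fun ψ => ∑ g with χ g = ψ, q (w g)) (by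
      ext b
      rw [Finset.sum_apply, Pi.zero_apply, ← (hq _).2 (hcon b), map_sum,
        ← Finset.sum_fiberwise_of_maps_to
          (fun g _ => Finset.mem_image_of_mem χ (Finset.mem_univ g))]
      refine Finset.sum_congr rfl fun ψ _ => ?_
      rw [Pi.smul_apply, smul_eq_mul, Finset.sum_mul]
      refine Finset.sum_congr rfl fun g hg => ?_
      rw [map_mul, ← (Finset.mem_filter.1 hg).2, hχ])
    (χ g₀) (Finset.mem_image_of_mem _ (Finset.mem_univ _))
  have h2 : ∀ g ∈ Finset.univ.filter (fun g => χ g = χ g₀), q (w g) = q (w g₀) := by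
    intro g hg
    have h1 := hw _ ((hχeq g).1 (Finset.mem_filter.1 hg).2) g₀
    rwa [inv_mul_cancel_right, ← hq, map_sub, sub_eq_zero] at h1
  rw [Finset.sum_congr rfl h2, Finset.sum_const] at hli
  have h3 : (Finset.univ.filter (fun g => χ g = χ g₀)).card = Nat.card (P.inertia G) := by
    rw [← Fintype.card_subtype, ← Nat.card_eq_fintype_card]
    refine Nat.card_congr ((Equiv.mulRight g₀⁻¹).subtypeEquiv fun g => ?_)
    exact hχeq g
  rw [h3, nsmul_eq_mul, ← map_natCast q, ← map_mul, hq] at hli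
  exact (Ideal.IsPrime.mem_or_mem inferInstance hli).elim htame hg₀

/-- At a tame prime `P`, every `s ∉ P` has a multiple whose trace is not in `P`. -/
theorem exists_sum_smul_mul_notMem [Fintype G] {P : Ideal B} [P.IsPrime]
    (htame : (Nat.card (P.inertia G) : B) ∉ P) {s : B} (hs : s ∉ P) :
    ∃ b : B, ∑ g : G, g • (s * b) ∉ P := by
  obtain ⟨b, hb⟩ := exists_sum_mul_smul_notMem htame (fun g => g • s)
    (fun h hh g => by rw [mul_smul]; exact hh _) (g₀ := 1) (by rwa [one_smul])
  exact ⟨b, by simpa only [smul_mul'] using hb⟩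

section Invariant

variable [Fintype G] (A : Type*) [CommRing A] [Algebra A B]

variable (G) in
theorem exists_algebraMap_eq_sum [Algebra.IsInvariant A B G] (b : B) :
    ∃ a : A, algebraMap A B a = ∑ g : G, g • b := by
  refine Algebra.IsInvariant.isInvariant (G := G) _ fun h => ?_
  rw [Finset.smul_sum]
  simp_rw [smul_smul]
  exact Fintype.sum_equiv (Equiv.mulLeft h) _ _ fun g => rfl

theorem sum_smul_algebraMap_mul [SMulCommClass G A B] (a : A) (b : B) :
    ∑ g : G, g • (algebraMap A B a * b) = algebraMap A B a * ∑ g : G, g • b := by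
  rw [Finset.mul_sum]
  simp_rw [← Algebra.smul_def, smul_comm]

/-- The trace of a tame action is surjective: its image is an ideal of `A` that is contained in no
maximal ideal. -/
theorem exists_sum_smul_eq_one [Algebra.IsInvariant A B G] [SMulCommClass G A B]
    (htame : ∀ (P : Ideal B) [P.IsPrime], (Nat.card (P.inertia G) : B) ∉ P) :
    ∃ b : B, ∑ g : G, g • b = 1 := by
  let I : Ideal A :=
    { carrier := {a | ∃ b : B, algebraMap A B a = ∑ g : G, g • b}
      zero_mem' := ⟨0, by simp⟩
      add_mem' := by
        rintro a a' ⟨b, hb⟩ ⟨b', hb'⟩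
        exact ⟨b + b', by simp only [map_add, hb, hb', smul_add, Finset.sum_add_distrib]⟩
      smul_mem' := by
        rintro c a ⟨b, hb⟩
        exact ⟨algebraMap A B c * b, by rw [smul_eq_mul, map_mul, hb, sum_smul_algebraMap_mul]⟩ }
  by_cases hI : I = ⊤
  · obtain ⟨b, hb⟩ : (1 : A) ∈ I := hI ▸ trivial
    exact ⟨b, by rw [← hb, map_one]⟩
  exfalso
  obtain ⟨m, hm, hIm⟩ := I.exists_le_maximal hI
  have : Algebra.IsIntegral A B := Algebra.IsInvariant.isIntegral A B G
  have hker : RingHom.ker (algebraMap A B) ≤ m := fun a ha => hIm ⟨0, by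
    rw [RingHom.mem_ker.1 ha]; simp⟩
  obtain ⟨P, hP, hPm⟩ := Ideal.exists_ideal_over_prime_of_isIntegral m (⊥ : Ideal B) hker
  obtain ⟨hPp, hPc⟩ := hPm
  obtain ⟨b, hb⟩ := exists_sum_smul_mul_notMem (htame P)
    ((Ideal.ne_top_iff_one P).1 hPp.ne_top)
  obtain ⟨a, ha⟩ := exists_algebraMap_eq_sum G A (1 * b)
  refine hb (ha ▸ ?_)
  have h1 : a ∈ m := hIm ⟨_, ha⟩
  rw [← hPc] at h1
  exact h1

end Invariant

section Valuation

variable {L : Type*} [Field L] [Algebra B L] [MulSemiringAction G L] [SMulDistribClass G B L]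
  {P : Ideal B} {v : Valuation L ℤᵐ⁰} {e : ℕ}

/-- Conjugate valuations belong to conjugate primes. -/
theorem IsPrimeVal.comap_smul (h : IsPrimeVal P v e) (g : G) :
    IsPrimeVal (P.comap (MulSemiringAction.toRingHom G B g))
      (v.comap (MulSemiringAction.toRingHom G L g)) e := by
  have hv : ∀ z, v.comap (MulSemiringAction.toRingHom G L g) z = v (g • z) := fun _ => rfl
  have hP : ∀ b, b ∈ P.comap (MulSemiringAction.toRingHom G B g) ↔ g • b ∈ P := fun _ => Iff.rfl
  have hm : ∀ b : B, g • algebraMap B L b = algebraMap B L (g • b) := fun b =>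
    (algebraMap.smul' g b L).symm
  refine ⟨fun c => ?_, fun c => ?_, fun z hz => ?_, h.pos, ?_, fun c hc => ?_⟩
  · rw [hv, hm]; exact h.le_one _
  · rw [hv, hm, hP]; exact h.lt_one_iff _
  · obtain ⟨s, hs, c, hc⟩ := h.exists_mul _ hz
    refine ⟨g⁻¹ • s, by rwa [hP, smul_inv_smul], g⁻¹ • c, ?_⟩
    apply (MulAction.injective g : Function.Injective (fun z : L => g • z))
    change g • _ = g • _
    rw [hm, smul_inv_smul, smul_mul', hm, smul_inv_smul]
    exact hc
  · obtain ⟨t, ht, hvt⟩ := h.exists_uniformizer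
    exact ⟨g⁻¹ • t, by rwa [hP, smul_inv_smul], by rw [hv, hm, smul_inv_smul, hvt]⟩
  · rw [hv, hm]; exact h.le_exp _ hc

theorem IsPrimeVal.smul_eq (h : IsPrimeVal P v e) {g : G} (hg : ∀ b : B, g • b ∈ P ↔ b ∈ P)
    (z : L) : v (g • z) = v z := by
  have h1 := h.comap_smul g
  have h2 : P.comap (MulSemiringAction.toRingHom G B g) = P := by
    ext b; exact hg b
  rw [h2] at h1
  exact DFunLike.congr_fun (h1.unique h) z

theorem smul_mem_iff_of_mem_inertia {h : G} (hh : h ∈ P.inertia G) (b : B) :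
    h • b ∈ P ↔ b ∈ P := by
  constructor
  · intro hb
    have := sub_mem hb (hh b)
    rwa [sub_sub_cancel] at this
  · intro hb
    have := add_mem (hh b) hb
    rwa [sub_add_cancel] at this

theorem IsPrimeVal.smul_sub_lt_one (hv : IsPrimeVal P v e) {h : G} (hh : h ∈ P.inertia G)
    {z : L} (hz : v z ≤ 1) : v (h • z - z) < 1 := by
  obtain ⟨s, hs, c, hc⟩ := hv.exists_mul z hz
  have hhs : h • s ∉ P := fun hmem => hs ((smul_mem_iff_of_mem_inertia hh s).1 hmem)
  have hm : ∀ b : B, h • algebraMap B L b = algebraMap B L (h • b) := fun b =>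
    (algebraMap.smul' h b L).symm
  have h1 : v (algebraMap B L ((h • c - c) * s - c * (h • s - s))) < 1 :=
    (hv.lt_one_iff _).2 (sub_mem (Ideal.mul_mem_right _ _ (hh c)) (Ideal.mul_mem_left _ _ (hh s)))
  have h2 : algebraMap B L (h • c) = algebraMap B L (h • s) * h • z := by
    rw [← hm, hc, smul_mul', hm]
  have h3 : algebraMap B L ((h • c - c) * s - c * (h • s - s)) =
      algebraMap B L s * algebraMap B L (h • s) * (h • z - z) := by
    simp only [map_sub, map_mul, h2, hc]
    ring
  rwa [h3, map_mul, map_mul, hv.eq_one hs, hv.eq_one hhs, one_mul, one_mul] at h1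

theorem IsPrimeVal.exists_common_denominator (hv : IsPrimeVal P v e) {ι : Type*} [Fintype ι]
    (z : ι → L) (hz : ∀ i, v (z i) ≤ 1) :
    ∃ r ∉ P, ∃ c : ι → B, ∀ i, algebraMap B L (c i) = algebraMap B L r * z i := by
  classical
  have := hv.isPrime
  choose s hs c hc using fun i => hv.exists_mul (z i) (hz i)
  refine ⟨∏ i, s i, fun h => ?_, fun i => (∏ j ∈ Finset.univ.erase i, s j) * c i, fun i => ?_⟩
  · obtain ⟨i, -, hi⟩ := (Ideal.IsPrime.prod_mem_iff (p := P)).1 h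
    exact hs i hi
  · rw [map_mul, hc, ← Finset.prod_erase_mul _ _ (Finset.mem_univ i), map_mul, mul_assoc]

variable [Fintype G] {A K : Type*} [CommRing A] [Algebra A B] [Algebra.IsInvariant A B G]
  [Field K] [Algebra A K] [Algebra K L] [Algebra A L] [IsScalarTower A K L]
  [IsScalarTower A B L]

variable (A K) in
/-- A normalized valuation at a tame prime of `B` restricts to a valuation at the prime below of the
ring of invariants. -/
theorem IsPrimeVal.exists_comap [FaithfulSMul B L] (hv : IsPrimeVal P v e)
    [SMulCommClass G K L] (htame : (Nat.card (P.inertia G) : B) ∉ P) :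
    ∃ e', IsPrimeVal (P.comap (algebraMap A B)) (v.comap (algebraMap K L)) e' := by
  classical
  have hP := hv.isPrime
  have hinj : Function.Injective (algebraMap B L) := FaithfulSMul.algebraMap_injective B L
  have hm : ∀ (g : G) (b : B), g • algebraMap B L b = algebraMap B L (g • b) := fun g b =>
    (algebraMap.smul' g b L).symm
  have hAL : ∀ a, algebraMap K L (algebraMap A K a) = algebraMap B L (algebraMap A B a) :=
    fun a => by rw [← IsScalarTower.algebraMap_apply, ← IsScalarTower.algebraMap_apply]
  have hlt : ∀ a, v.comap (algebraMap K L) (algebraMap A K a) < 1 ↔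
      a ∈ P.comap (algebraMap A B) := fun a => by
    rw [Valuation.comap_apply, hAL, hv.lt_one_iff]; rfl
  have hle : ∀ a, v.comap (algebraMap K L) (algebraMap A K a) ≤ 1 := fun a => by
    rw [Valuation.comap_apply, hAL]; exact hv.le_one _
  have hex : ∃ n : ℕ, ∃ a ∈ P.comap (algebraMap A B),
      v.comap (algebraMap K L) (algebraMap A K a) = exp (-(n : ℤ)) := by
    obtain ⟨t, ht, hvt⟩ := hv.exists_uniformizer
    obtain ⟨a, ha⟩ := Algebra.IsInvariant.isInvariant (A := A) (G := G) (∏ g : G, g • t)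
      (Finset.smul_prod_perm t)
    have haP : a ∈ P.comap (algebraMap A B) := by
      rw [Ideal.mem_comap, ha]
      refine Ideal.mem_of_dvd P (Finset.dvd_prod_of_mem _ (Finset.mem_univ 1)) ?_
      rwa [one_smul]
    have h0 : v.comap (algebraMap K L) (algebraMap A K a) ≠ 0 := by
      rw [Valuation.comap_apply, hAL, ha, map_prod, Valuation.ne_zero_iff, Finset.prod_ne_zero_iff]
      intro g _ h0
      rw [← hm, smul_eq_zero_iff_eq] at h0
      rw [h0, map_zero] at hvt
      exact exp_ne_zero hvt.symm
    refine ⟨(-log (v.comap (algebraMap K L) (algebraMap A K a))).toNat, a, haP, ?_⟩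
    have h1 : log (v.comap (algebraMap K L) (algebraMap A K a)) ≤ 0 := by
      have := hle a
      rw [← exp_log h0, ← exp_zero, exp_le_exp] at this
      exact this
    rw [Int.toNat_of_nonneg (by omega), neg_neg, exp_log h0]
  obtain ⟨t, ht, hvt⟩ := Nat.find_spec hex
  refine ⟨Nat.find hex, hle, hlt, fun z hz => ?_, ?_, ⟨t, ht, hvt⟩, fun c hc => ?_⟩
  · obtain ⟨s, hs, c, hc⟩ := hv.exists_mul _ hz
    obtain ⟨b, hb⟩ := exists_sum_smul_mul_notMem htame hs
    obtain ⟨a, ha⟩ := exists_algebraMap_eq_sum G A (s * b)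
    obtain ⟨a', ha'⟩ := exists_algebraMap_eq_sum G A (c * b)
    refine ⟨a, by rwa [Ideal.mem_comap, ha], a', (algebraMap K L).injective ?_⟩
    rw [map_mul, hAL, hAL, ha, ha', map_sum, map_sum, Finset.sum_mul]
    refine Finset.sum_congr rfl fun g _ => ?_
    have hz : g • algebraMap K L z = algebraMap K L z := smul_algebraMap g z
    rw [← hm, ← hm, map_mul, map_mul, hc, smul_mul', smul_mul', smul_mul', hz]
    ring
  · refine Nat.pos_of_ne_zero fun h0 => ?_
    rw [h0] at hvt
    have := (hlt t).2 ht
    rw [hvt] at this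
    simp at this
  · by_contra hcon
    rw [not_le] at hcon
    have h0 : v.comap (algebraMap K L) (algebraMap A K c) ≠ 0 := fun h => by
      rw [h] at hcon; exact absurd hcon (not_lt.2 zero_le)
    have h1 : log (v.comap (algebraMap K L) (algebraMap A K c)) ≤ 0 := by
      have := hle c
      rw [← exp_log h0, ← exp_zero, exp_le_exp] at this
      exact this
    refine Nat.find_min hex
      (m := (-log (v.comap (algebraMap K L) (algebraMap A K c))).toNat) ?_ ⟨c, hc, ?_⟩
    · rw [← exp_log h0, exp_lt_exp] at hcon
      omega
    · rw [Int.toNat_of_nonneg (by omega), neg_neg, exp_log h0]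

/-- At a tame prime the ramification index divides the order of the inertia group. The trace of an
element that is divisible by the norm `s` of a uniformizer for the inertia group, and highly
divisible at the other conjugates of `P`, has the order of `s` when its remaining factor is chosen
by independence of characters. -/
theorem IsPrimeVal.dvd_card_inertia (hv : IsPrimeVal P v 1)
    (he : IsPrimeVal (P.comap (algebraMap A B)) (v.comap (algebraMap K L)) e)
    (htame : (Nat.card (P.inertia G) : B) ∉ P) : e ∣ Nat.card (P.inertia G) := by
  classical
  have hP := hv.isPrime
  have hm : ∀ (g : G) (b : B), g • algebraMap B L b = algebraMap B L (g • b) := fun g b =>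
    (algebraMap.smul' g b L).symm
  have hAL : ∀ a, algebraMap K L (algebraMap A K a) = algebraMap B L (algebraMap A B a) :=
    fun a => by rw [← IsScalarTower.algebraMap_apply, ← IsScalarTower.algebraMap_apply]
  set n := Nat.card (P.inertia G) with hn
  obtain ⟨t, ht, hvt⟩ := hv.exists_uniformizer
  set s : B := ∏ h : P.inertia G, (h : G) • t with hs
  have hvs : v (algebraMap B L s) = exp (-(n : ℤ)) := by
    have h1 : ∀ h : P.inertia G, v (algebraMap B L ((h : G) • t)) = exp (-1) := fun h => by
      rw [← hm, hv.smul_eq (smul_mem_iff_of_mem_inertia h.2), hvt]; rfl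
    rw [hs, map_prod, map_prod, Finset.prod_congr rfl fun h _ => h1 h, Finset.prod_const,
      Finset.card_univ, ← Nat.card_eq_fintype_card, ← hn, ← exp_nsmul]
    simp
  have hs0 : algebraMap B L s ≠ 0 :=
    (Valuation.ne_zero_iff v).1 (by rw [hvs]; exact exp_ne_zero)
  have hsI : ∀ h ∈ P.inertia G, h • s = s := fun h hh => by
    rw [hs]
    exact Finset.smul_prod_perm (G := P.inertia G) t ⟨h, hh⟩
  set D : Subgroup G := MulAction.stabilizer G P with hD
  have hDmem : ∀ g, g ∈ D → ∀ b : B, g • b ∈ P ↔ b ∈ P := fun g hg b => by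
    have h1 : g • P = P := hg
    conv_lhs => rw [← h1]
    exact Ideal.smul_mem_pointwise_smul_iff
  have hID : P.inertia G ≤ D := Ideal.inertia_le_stabilizer P
  -- an element outside `P` that lies in all the other conjugates of `P`, to a high power
  have hc1 : ∀ g : G, ∃ c ∉ P, g ∉ D → g • c ∈ P := by
    intro g
    by_cases hg : g ∈ D
    · exact ⟨1, (Ideal.ne_top_iff_one P).1 hP.ne_top, fun h => absurd hg h⟩
    by_contra hcon
    push Not at hcon
    refine hg ?_
    have hle : P ≤ g • P := by
      rw [Ideal.subset_pointwise_smul_iff]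
      intro b hb
      by_contra hbP
      refine (hcon b hbP).2 ?_
      exact Ideal.mem_inv_pointwise_smul_iff.1 hb
    exact smul_eq_of_le_smul hle
  choose c₁ hc₁ hc₁g using hc1
  set c := ∏ g, c₁ g ^ (n + 1) with hc
  have hcP : c ∉ P := fun h => by
    obtain ⟨g, -, hg⟩ := (Ideal.IsPrime.prod_mem_iff (p := P)).1 h
    exact hc₁ g (hP.mem_of_pow_mem _ hg)
  have hcg : ∀ g ∉ D, v (algebraMap B L (g • c)) ≤ exp (-(n + 1 : ℤ)) := by
    intro g hg
    have hmem : g • c ∈ P ^ (n + 1) := by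
      refine Ideal.mem_of_dvd _ ?_ (Ideal.pow_mem_pow (hc₁g g hg) (n + 1))
      rw [hc, Finset.smul_prod', ← smul_pow']
      exact Finset.dvd_prod_of_mem (fun i => g • c₁ i ^ (n + 1)) (Finset.mem_univ g)
    simpa using hv.le_exp_of_mem_pow hmem
  have hvu : ∀ g : D, v (((g : G) • algebraMap B L s) / algebraMap B L s) ≤ 1 := fun g => by
    rw [map_div₀, hv.smul_eq (hDmem g g.2),
      div_self ((Valuation.ne_zero_iff v).2 hs0)]
  obtain ⟨r, hr, β, hβ⟩ := hv.exists_common_denominator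
    (fun g : D => ((g : G) • algebraMap B L s) / algebraMap B L s) hvu
  -- `w g ≡ (r g s / s) g c` on the decomposition group `D`; the inertia group fixes `s`, so that
  -- the weights agree modulo `P` on its cosets
  set w : G → B := fun g => if hg : g ∈ D then β ⟨g, hg⟩ * g • c else 0 with hw
  obtain ⟨b, hb⟩ := exists_sum_mul_smul_notMem htame w (g₀ := 1) (fun h hh g => by
      by_cases hg : g ∈ D
      · have hhg : h * g ∈ D := mul_mem (hID hh) hg
        simp only [hw, dif_pos hg, dif_pos hhg]
        have h1 : β ⟨h * g, hhg⟩ - β ⟨g, hg⟩ ∈ P := by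
          rw [← hv.lt_one_iff, map_sub, hβ, hβ, ← mul_sub, map_mul, hv.eq_one hr, one_mul]
          have h2 : ((h * g) • algebraMap B L s) / algebraMap B L s =
              h • ((g • algebraMap B L s) / algebraMap B L s) := by
            rw [smul_div₀', smul_smul, hm h s, hsI h hh]
          rw [h2]
          exact hv.smul_sub_lt_one hh (hvu ⟨g, hg⟩)
        have h3 : β ⟨h * g, hhg⟩ * (h * g) • c - β ⟨g, hg⟩ * g • c =
            (β ⟨h * g, hhg⟩ - β ⟨g, hg⟩) * (h * g) • c + β ⟨g, hg⟩ * (h • g • c - g • c) := by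
          rw [mul_smul]; ring
        rw [h3]
        exact add_mem (Ideal.mul_mem_right _ _ h1) (Ideal.mul_mem_left _ _ (hh _))
      · have hhg : h * g ∉ D := fun h' => hg ((mul_mem_cancel_left (hID hh)).1 h')
        simp [hw, dif_neg hg, dif_neg hhg])
    (by
      simp only [hw, dif_pos (one_mem D), one_smul]
      intro hmem
      refine (hP.mem_or_mem hmem).elim (fun h => hr ?_) hcP
      have h1 := hβ ⟨1, one_mem D⟩
      simp only [one_smul] at h1
      rw [div_self hs0, mul_one] at h1
      rw [← hv.lt_one_iff] at h ⊢
      rwa [← h1])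
  obtain ⟨a, ha⟩ := exists_algebraMap_eq_sum G A (s * b * c)
  -- the terms of the trace outside `D` have order larger than `n`, those in `D` sum up to order `n`
  have hva : v.comap (algebraMap K L) (algebraMap A K a) = exp (-(n : ℤ)) := by
    rw [Valuation.comap_apply, hAL, ha, map_sum,
      ← Finset.sum_filter_add_sum_filter_not Finset.univ (fun g => g ∈ D)]
    have h1 : algebraMap B L r * (∑ g with g ∈ D, algebraMap B L (g • (s * b * c))) =
        algebraMap B L s * algebraMap B L (∑ g, w g * g • b) := by
      rw [map_sum, ← Finset.sum_filter_add_sum_filter_not Finset.univ (fun g => g ∈ D) (fun g =>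
        algebraMap B L (w g * g • b)), Finset.sum_eq_zero (s := Finset.univ.filter (· ∉ D))
        (fun g hg => by simp [hw, dif_neg (Finset.mem_filter.1 hg).2]), add_zero,
        Finset.mul_sum, Finset.mul_sum]
      refine Finset.sum_congr rfl fun g hg => ?_
      have hgD := (Finset.mem_filter.1 hg).2
      simp only [hw, dif_pos hgD, map_mul, hβ, smul_mul', ← hm]
      field_simp
    have h2 : v (∑ g with g ∈ D, algebraMap B L (g • (s * b * c))) = exp (-(n : ℤ)) := by
      have := congrArg v h1
      rwa [map_mul, map_mul, hv.eq_one hr, hv.eq_one hb, one_mul, mul_one, hvs] at this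
    have h3 : v (∑ g with g ∉ D, algebraMap B L (g • (s * b * c))) ≤ exp (-(n + 1 : ℤ)) := by
      refine v.map_sum_le fun g hg => ?_
      rw [smul_mul', map_mul, map_mul]
      refine (mul_le_mul' (hv.le_one _) (hcg g (Finset.mem_filter.1 hg).2)).trans_eq (one_mul _)
    rw [Valuation.map_add_eq_of_lt_left _ (h3.trans_lt (by rw [h2, exp_lt_exp]; omega)), h2]
  obtain ⟨k, hk⟩ := he.exists_eq_exp (z := algebraMap A K a) (fun h0 => by
    rw [h0, map_zero] at hva; exact exp_ne_zero hva.symm)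
  rw [hva, exp_inj] at hk
  exact Int.natCast_dvd_natCast.1 ⟨-k, by linear_combination -hk⟩

end Valuation

end Inertia

/-! ### Ramified primes are invertible -/

section Symbolic

open IsLocalRing

variable {B : Type*} [CommRing B]

/-- The symbolic power `Q ^ (n)`. -/
def symbolicPower (Q : Ideal B) [Q.IsPrime] (n : ℕ) : Ideal B :=
  (maximalIdeal (Localization.AtPrime Q) ^ n).comap (algebraMap B (Localization.AtPrime Q))

variable {Q : Ideal B} [Q.IsPrime]

theorem mem_symbolicPower_iff {n : ℕ} {b : B} :
    b ∈ symbolicPower Q n ↔ ∃ s ∉ Q, s * b ∈ Q ^ n := by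
  rw [symbolicPower, Ideal.mem_comap, ← Localization.AtPrime.map_eq_maximalIdeal,
    ← Ideal.map_pow, IsLocalization.algebraMap_mem_map_algebraMap_iff Q.primeCompl]
  rfl

theorem mem_symbolicPower_of_mul {n : ℕ} {s b : B} (hs : s ∉ Q)
    (h : s * b ∈ symbolicPower Q n) : b ∈ symbolicPower Q n := by
  rw [symbolicPower, Ideal.mem_comap, map_mul] at h
  exact (Ideal.unit_mul_mem_iff_mem _
    (IsLocalization.map_units (Localization.AtPrime Q) (⟨s, hs⟩ : Q.primeCompl))).1 h

theorem mul_mem_symbolicPower {m n : ℕ} {a b : B} (ha : a ∈ symbolicPower Q m)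
    (hb : b ∈ symbolicPower Q n) : a * b ∈ symbolicPower Q (m + n) := by
  rw [symbolicPower, Ideal.mem_comap, map_mul, pow_add]
  exact Ideal.mul_mem_mul ha hb

theorem symbolicPower_anti {m n : ℕ} (h : m ≤ n) : symbolicPower Q n ≤ symbolicPower Q m :=
  Ideal.comap_mono (Ideal.pow_le_pow_right h)

theorem mem_symbolicPower_one {b : B} : b ∈ symbolicPower Q 1 ↔ b ∈ Q := by
  rw [symbolicPower, Ideal.mem_comap, pow_one,
    IsLocalization.AtPrime.to_map_mem_maximal_iff (Localization.AtPrime Q) Q]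

theorem eq_zero_of_mem_symbolicPower [IsDomain B] [IsNoetherianRing B] {b : B}
    (h : ∀ n, b ∈ symbolicPower Q n) : b = 0 := by
  have hinj : Function.Injective (algebraMap B (Localization.AtPrime Q)) :=
    IsLocalization.injective _ Q.primeCompl_le_nonZeroDivisors
  have h1 : algebraMap B (Localization.AtPrime Q) b ∈ (⨅ n : ℕ, maximalIdeal _ ^ n) :=
    (Ideal.mem_iInf).2 fun n => h n
  rw [Ideal.iInf_pow_eq_bot_of_isLocalRing _ (maximalIdeal.isMaximal _).ne_top,
    Ideal.mem_bot] at h1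
  exact hinj (by rw [h1, map_zero])

variable {G : Type*} [Group G] [MulSemiringAction G B]

/-- An element of order prime to the residue characteristic that acts trivially modulo the second
symbolic power of `Q` acts trivially modulo all of them, hence trivially. -/
theorem exists_smul_sub_notMem_symbolicPower_two [IsDomain B] [IsNoetherianRing B] {g : G}
    (hgQ : g ∈ Q.inertia G) (hord : (orderOf g : B) ∉ Q) (hg : ∃ b : B, g • b ≠ b) :
    ∃ b : B, g • b - b ∉ symbolicPower Q 2 := by
  by_contra hcon
  push Not at hcon
  have hgmem : ∀ b : B, b ∉ Q → g • b ∉ Q := fun b hb h =>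
    hb ((smul_mem_iff_of_mem_inertia hgQ b).1 h)
  have hg1 : ∀ b ∈ Q, g • b ∈ symbolicPower Q 1 := fun b hb =>
    mem_symbolicPower_one.2 ((smul_mem_iff_of_mem_inertia hgQ b).2 hb)
  have hpow : ∀ k : ℕ, ∀ b ∈ Q ^ k, g • b - b ∈ symbolicPower Q (k + 1) := by
    intro k
    induction k with
    | zero => exact fun b _ => symbolicPower_anti (by norm_num) (hcon b)
    | succ k ih =>
      intro b hb
      rw [pow_succ'] at hb
      induction hb using Submodule.mul_induction_on' with
      | mem_mul_mem x hx y hy =>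
        have h1 : g • (x * y) - x * y = (g • x - x) * y + g • x * (g • y - y) := by
          rw [smul_mul']; ring
        rw [h1]
        refine add_mem ?_ ?_
        · have h2 : y ∈ symbolicPower Q k :=
            mem_symbolicPower_iff.2 ⟨1,
              (Ideal.ne_top_iff_one Q).1 (Ideal.IsPrime.ne_top inferInstance), by rwa [one_mul]⟩
          exact symbolicPower_anti (by omega) (mul_mem_symbolicPower (hcon x) h2)
        · exact symbolicPower_anti (by omega) (mul_mem_symbolicPower (hg1 x hx) (ih y hy))
      | add x _ y _ hx hy =>
        rw [smul_add, add_sub_add_comm]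
        exact add_mem hx hy
  have hsym : ∀ k : ℕ, ∀ b ∈ symbolicPower Q k, g • b - b ∈ symbolicPower Q (k + 1) := by
    intro k b hb
    obtain ⟨s, hs, hsb⟩ := mem_symbolicPower_iff.1 hb
    refine mem_symbolicPower_of_mul (hgmem s hs) ?_
    have h1 : g • s * (g • b - b) = (g • (s * b) - s * b) - (g • s - s) * b := by
      rw [smul_mul']; ring
    rw [h1]
    exact sub_mem (hpow k _ hsb)
      (symbolicPower_anti (by omega) (mul_mem_symbolicPower (hcon s) hb))
  have hall : ∀ n : ℕ, ∀ b : B, g • b - b ∈ symbolicPower Q n := by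
    intro n
    induction n with
    | zero => exact fun b => symbolicPower_anti (by norm_num) (hcon b)
    | succ n ih =>
      intro b
      -- modulo the next symbolic power, `g ^ j` moves `b` by `j` times what `g` moves it
      have hj : ∀ j : ℕ, (g ^ j • b - b) - j * (g • b - b) ∈ symbolicPower Q (n + 1) := by
        intro j
        induction j with
        | zero => simp
        | succ j ihj =>
          have hmem : ∀ i : ℕ, g ^ i • b - b ∈ symbolicPower Q n := by
            intro i
            induction i with
            | zero => simp
            | succ i ihi =>
              have : g ^ (i + 1) • b - b = (g • (g ^ i • b) - g ^ i • b) + (g ^ i • b - b) := by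
                rw [pow_succ', mul_smul]; ring
              rw [this]
              exact add_mem (ih _) ihi
          have h1 : (g ^ (j + 1) • b - b) - (j + 1 : ℕ) * (g • b - b) =
              ((g ^ j • b - b) - j * (g • b - b)) +
                (g • (g ^ j • b - b) - (g ^ j • b - b)) := by
            rw [pow_succ', mul_smul, smul_sub]; push_cast; ring
          rw [h1]
          exact add_mem ihj (hsym n _ (hmem j))
      have h1 := hj (orderOf g)
      rw [pow_orderOf_eq_one, one_smul, sub_self, zero_sub, neg_mem_iff] at h1
      exact mem_symbolicPower_of_mul hord h1
  obtain ⟨b, hb⟩ := hg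
  exact hb (sub_eq_zero.1 (eq_zero_of_mem_symbolicPower (Q := Q) fun n => hall n b))

theorem eq_of_le_of_height_eq_one [IsDomain B] {p P : Ideal B} [p.IsPrime] [P.IsPrime]
    (hp : p ≠ ⊥) (hle : p ≤ P) (hP : P.height = 1) : p = P := by
  by_contra hne
  have hfin : P.FiniteHeight := P.finiteHeight_iff.2 (Or.inr (by rw [hP]; simp))
  have h1 : p.height < 1 :=
    hP ▸ Ideal.height_strict_mono_of_isPrime_of_isPrime (lt_of_le_of_ne hle hne)
  have h2 := Ideal.height_eq_zero_iff.1 (Order.lt_one_iff.1 h1)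
  rw [IsDomain.minimalPrimes_eq_singleton_bot] at h2
  exact hp h2

/-- A ramified prime `P` of height one is principal locally at `Q`, generated by an element
`g b - b` with `g` in the inertia group of `P`: some `g b - b` is a parameter outside the square of
the maximal ideal at `Q`, hence a prime element there, and it lies in `P`. -/
theorem exists_locally_principal [IsDomain B] [IsNoetherianRing B]
    (hreg : IsRegularLocalRing (Localization.AtPrime Q)) {P : Ideal B} [P.IsPrime]
    (hP : P.height = 1) (hPQ : P ≤ Q) {g : G} (hgP : g ∈ P.inertia G)
    (hord : (orderOf g : B) ∉ Q) (hg : ∃ b : B, g • b ≠ b) :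
    ∃ x ∈ P, ∃ s ∉ Q, ∀ p ∈ P, x ∣ s * p := by
  classical
  obtain ⟨b, hb⟩ := exists_smul_sub_notMem_symbolicPower_two
    (fun c => hPQ (hgP c)) hord hg
  set x := g • b - b
  have hxP : x ∈ P := hgP b
  have hx0 : x ≠ 0 := fun h => hb (h ▸ zero_mem _)
  have hinj : Function.Injective (algebraMap B (Localization.AtPrime Q)) :=
    IsLocalization.injective _ Q.primeCompl_le_nonZeroDivisors
  have hpr : (Ideal.span {algebraMap B (Localization.AtPrime Q) x}).IsPrime := by
    refine prime_span_singleton_of_notMem_sq ?_ hb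
    rw [IsLocalization.AtPrime.to_map_mem_maximal_iff (Localization.AtPrime Q) Q]
    exact hPQ hxP
  have hdvd : ∀ y, y ∈ (Ideal.span {algebraMap B (Localization.AtPrime Q) x}).comap
      (algebraMap B _) → ∃ s ∉ Q, x ∣ s * y := by
    intro y hy
    obtain ⟨r, hr⟩ := Ideal.mem_span_singleton'.1 (Ideal.mem_comap.1 hy)
    obtain ⟨⟨d, s⟩, hd⟩ := IsLocalization.surj Q.primeCompl r
    refine ⟨s, s.2, d, hinj ?_⟩
    rw [map_mul, map_mul, ← hd, ← hr]
    ring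
  have heq : (Ideal.span {algebraMap B (Localization.AtPrime Q) x}).comap (algebraMap B _) = P := by
    refine eq_of_le_of_height_eq_one (fun h => ?_) (fun y hy => ?_) hP
    · exact hx0 ((Ideal.mem_bot).1 (h ▸ Ideal.mem_comap.2 (Ideal.mem_span_singleton_self _)))
    · obtain ⟨s, hs, hsy⟩ := hdvd y hy
      exact ((inferInstance : P.IsPrime).mem_or_mem
        (Ideal.mem_of_dvd _ hsy hxP)).resolve_left fun h => hs (hPQ h)
  obtain ⟨T, hT⟩ := IsNoetherian.noetherian P
  choose! s hs hsT using hdvd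
  refine ⟨x, hxP, ∏ t ∈ T, s t, fun h => ?_, fun p hp => ?_⟩
  · obtain ⟨t, ht, hst⟩ := (Ideal.IsPrime.prod_mem_iff (p := Q)).1 h
    exact hs t (heq ▸ hT ▸ Submodule.subset_span ht) hst
  · rw [← hT] at hp
    induction hp using Submodule.span_induction with
    | mem t ht =>
      rw [← Finset.prod_erase_mul _ _ ht, mul_assoc]
      exact Dvd.dvd.mul_left (hsT t (heq ▸ hT ▸ Submodule.subset_span ht)) _
    | zero => simp
    | add p q _ _ hp hq => rw [mul_add]; exact dvd_add hp hq
    | smul a p _ hp => rw [smul_eq_mul, mul_left_comm]; exact Dvd.dvd.mul_left hp _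

/-- Only finitely many primes of height one are ramified: each is a minimal prime over a nonzero
element `g b - b` with `b` depending on `g` only. -/
theorem finite_ramified [Finite G] [FaithfulSMul G B] [IsDomain B] [IsNoetherianRing B] :
    {P : Ideal B | P.IsPrime ∧ P.height = 1 ∧ P.inertia G ≠ ⊥}.Finite := by
  have hb : ∀ g : G, ∃ b : B, g ≠ 1 → g • b ≠ b := by
    intro g
    by_contra hcon
    push Not at hcon
    exact (hcon 0).1 (eq_of_smul_eq_smul (α := B) fun b => by rw [(hcon b).2, one_smul])
  choose b hb using hb
  refine (Set.finite_iUnion fun g : G =>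
    (Ideal.finite_minimalPrimes_of_isNoetherianRing B (Ideal.span {g • b g - b g}))).subset ?_
  rintro P ⟨hP, hht, hI⟩
  obtain ⟨⟨g, hgP⟩, hg⟩ := Subgroup.ne_bot_iff_exists_ne_one.1 hI
  have hg1 : g ≠ 1 := fun h => hg (Subtype.ext h)
  refine Set.mem_iUnion.2 ⟨g, ⟨hP, (Ideal.span_singleton_le_iff_mem _).2 (hgP (b g))⟩, ?_⟩
  rintro p ⟨hp, hxp⟩ hle
  refine (eq_of_le_of_height_eq_one (fun h => ?_) hle hht).ge
  rw [h, Ideal.span_singleton_le_iff_mem, Ideal.mem_bot, sub_eq_zero] at hxp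
  exact hb g hg1 hxp

end Symbolic

section Invertible

open IsLocalization

variable {B : Type*} [CommRing B] (L : Type*) [Field L] [Algebra B L]

/-- A nonzero ideal that is locally principal is invertible as a fractional ideal. -/
theorem isUnit_coeSubmodule [IsDomain B] [IsFractionRing B L] {P : Ideal B} (hP : P ≠ ⊥)
    (h : ∀ (Q : Ideal B) [Q.IsMaximal], ∃ x ∈ P, ∃ s ∉ Q, ∀ p ∈ P, x ∣ s * p) :
    IsUnit (coeSubmodule L P) := by
  have hinj := IsFractionRing.injective B L
  refine IsUnit.of_mul_eq_one (1 / coeSubmodule L P) (le_antisymm ?_ ?_)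
  · rw [Submodule.mul_le]
    rintro m hm n hn
    rw [mul_comm]
    exact Submodule.mem_div_iff_forall_mul_mem.1 hn m hm
  set c : Ideal B := (coeSubmodule L P * (1 / coeSubmodule L P)).comap (Algebra.linearMap B L)
    with hc
  suffices hct : c = ⊤ by
    rw [Submodule.one_le]
    have : (1 : B) ∈ c := hct ▸ trivial
    simpa [hc] using this
  by_contra hct
  obtain ⟨Q, hQ, hcQ⟩ := c.exists_le_maximal hct
  obtain ⟨x, hx, s, hs, hdvd⟩ := h Q
  have hx0 : x ≠ 0 := by
    rintro rfl
    refine hP (eq_bot_iff.2 fun p hp => ?_)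
    have := zero_dvd_iff.1 (hdvd p hp)
    exact (mul_eq_zero.1 this).resolve_left fun h0 => hs (h0 ▸ zero_mem _)
  have hxL : algebraMap B L x ≠ 0 := fun h => hx0 (hinj (by rw [h, map_zero]))
  refine hs (hcQ ?_)
  change algebraMap B L s ∈ (coeSubmodule L P * (1 / coeSubmodule L P))
  have h1 : algebraMap B L s = algebraMap B L x * (algebraMap B L s / algebraMap B L x) := by
    field_simp
  rw [h1]
  refine Submodule.mul_mem_mul ((mem_coeSubmodule L P).2 ⟨x, hx, rfl⟩) ?_
  rw [Submodule.mem_div_iff_forall_mul_mem]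
  intro y hy
  obtain ⟨p, hp, rfl⟩ := (mem_coeSubmodule L P).1 hy
  obtain ⟨d, hd⟩ := hdvd p hp
  refine Submodule.mem_one.2 ⟨d, ?_⟩
  have := congrArg (algebraMap B L) hd
  rw [map_mul, map_mul] at this
  field_simp
  linear_combination -this

theorem isUnit_coeSubmodule_prod_pow {S : Finset (Ideal B)} (k : Ideal B → ℕ)
    (h : ∀ P ∈ S, IsUnit (coeSubmodule L P)) :
    IsUnit (coeSubmodule L (∏ P ∈ S, P ^ k P)) := by
  classical
  have h1 : coeSubmodule L (1 : Ideal B) = 1 := by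
    rw [Ideal.one_eq_top, coeSubmodule_top]
  have hpow : ∀ P ∈ S, ∀ n : ℕ, IsUnit (coeSubmodule L (P ^ n)) := by
    intro P hP n
    induction n with
    | zero => rw [pow_zero, h1]; exact isUnit_one
    | succ n ih => rw [pow_succ, coeSubmodule_mul]; exact ih.mul (h P hP)
  refine Finset.prod_induction _ (fun J : Ideal B => IsUnit (coeSubmodule L J))
    (fun I J hI hJ => ?_) (by rw [h1]; exact isUnit_one) fun P hP => hpow P hP _
  rw [coeSubmodule_mul]
  exact hI.mul hJ

end Invertible

/-! ### The square root of the codifferent of a ring with a tame action -/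

section SqrtCodiff

open WithZero IsLocalization

theorem IsPrimeVal.height_eq_one {C F : Type*} [CommRing C] [IsDomain C] [Field F] [Algebra C F]
    [IsFractionRing C F] {P : Ideal C} {v : Valuation F ℤᵐ⁰} {e : ℕ} (h : IsPrimeVal P v e) :
    P.height = 1 := by
  have := h.isPrime
  have hle : P.primeCompl ≤ nonZeroDivisors C := P.primeCompl_le_nonZeroDivisors
  let _ : Algebra (Localization.AtPrime P) F :=
    localizationAlgebraOfSubmonoidLe (Localization.AtPrime P) F P.primeCompl
      (nonZeroDivisors C) hle
  have : IsScalarTower C (Localization.AtPrime P) F :=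
    localization_isScalarTower_of_submonoid_le (Localization.AtPrime P) F
      P.primeCompl (nonZeroDivisors C) hle
  have : IsFractionRing (Localization.AtPrime P) F :=
    IsFractionRing.isFractionRing_of_isDomain_of_isLocalization P.primeCompl _ _
  have h1 := ringKrullDim_eq_one (IsPrimeVal.localization (O := Localization.AtPrime P).2 h)
  rw [IsLocalization.AtPrime.ringKrullDim_eq_height P] at h1
  exact_mod_cast h1

theorem algebraMap_trace_eq_sum_smul (G K : Type*) {L : Type*} [Group G] [Fintype G] [Field K]
    [Field L] [Algebra K L] [MulSemiringAction G L] [IsGaloisGroup G K L] (z : L) :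
    algebraMap K L (Algebra.trace K L z) = ∑ g : G, g • z := by
  have := IsGaloisGroup.isGalois G K L
  have := IsGaloisGroup.finiteDimensional G K L
  rw [trace_eq_sum_automorphisms]
  exact (Fintype.sum_equiv (IsGaloisGroup.mulEquivAlgEquiv G K L).toEquiv _ _ fun g => rfl).symm

/-- `B` has regular local rings, and the inertia groups of its primes are of odd order, prime to the
residue characteristic. -/
structure IsRegularTame (G B : Type*) [Group G] [CommRing B] [MulSemiringAction G B] : Prop where
  regular : ∀ (P : Ideal B) [P.IsPrime], IsRegularLocalRing (Localization.AtPrime P)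
  card_inertia_notMem : ∀ (P : Ideal B) [P.IsPrime], (Nat.card (P.inertia G) : B) ∉ P
  odd_card_inertia : ∀ (P : Ideal B) [P.IsPrime], Odd (Nat.card (P.inertia G))

variable (A : Type*) {B : Type*} (K : Type*) {L : Type*} [CommRing A] [CommRing B] [Algebra A B]
  [Field K] [Field L] [Algebra A K] [Algebra B L] [Algebra K L]

/-- `v` is the normalized valuation of `L` at the prime `P` of `B`, and `e` is its ramification
index over `A`. -/
structure IsRamVal (P : Ideal B) (v : Valuation L ℤᵐ⁰) (e : ℕ) : Prop where
  left : IsPrimeVal P v 1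
  right : IsPrimeVal (P.comap (algebraMap A B)) (v.comap (algebraMap K L)) e

variable (B L) in
/-- The elements of `L` of order at least `-(e - 1) / 2` at every prime of `B` of height one with
ramification index `e` over `A`. -/
def ringSqrtCodiff : Submodule B L where
  carrier := {z | ∀ (P : Ideal B) (v : Valuation L ℤᵐ⁰) (e : ℕ), IsRamVal A K P v e →
    v z ≤ exp (((e - 1) / 2 : ℕ) : ℤ)}
  zero_mem' P v e _ := by rw [map_zero]; exact zero_le
  add_mem' {y z} hy hz P v e h := v.map_add_le (hy P v e h) (hz P v e h)
  smul_mem' b z hz P v e h := by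
    rw [Algebra.smul_def, map_mul]
    exact (mul_le_mul' (h.left.le_one b) (hz P v e h)).trans_eq (one_mul _)

theorem one_mem_ringSqrtCodiff : (1 : L) ∈ ringSqrtCodiff A B K L := fun _ _ _ _ => by
  rw [map_one, ← exp_zero, exp_le_exp]
  omega

variable {G : Type*} [Group G] [MulSemiringAction G B] [MulSemiringAction G L]
  [SMulDistribClass G B L]

section Smul

variable [SMulCommClass G A B] [SMulCommClass G K L]

variable {A K} in
theorem IsRamVal.comap_smul {P : Ideal B} {v : Valuation L ℤᵐ⁰} {e : ℕ} (h : IsRamVal A K P v e)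
    (g : G) : IsRamVal A K (P.comap (MulSemiringAction.toRingHom G B g))
      (v.comap (MulSemiringAction.toRingHom G L g)) e := by
  refine ⟨h.left.comap_smul g, ?_⟩
  have h1 : (P.comap (MulSemiringAction.toRingHom G B g)).comap (algebraMap A B) =
      P.comap (algebraMap A B) := by
    ext a
    change g • algebraMap A B a ∈ P ↔ algebraMap A B a ∈ P
    rw [smul_algebraMap]
  have h2 : (v.comap (MulSemiringAction.toRingHom G L g)).comap (algebraMap K L) =
      v.comap (algebraMap K L) := by
    ext a
    change v (g • algebraMap K L a) = v (algebraMap K L a)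
    rw [smul_algebraMap]
  rw [h1, h2]
  exact h.right

theorem smul_mem_ringSqrtCodiff (g : G) {z : L} (hz : z ∈ ringSqrtCodiff A B K L) :
    g • z ∈ ringSqrtCodiff A B K L := fun _ _ e h =>
  hz _ _ e (h.comap_smul g)

end Smul

variable [Fintype G] [IsDomain B] [IsFractionRing B L] [IsNoetherianRing B]
  [Algebra.IsInvariant A B G] [Algebra A L] [IsScalarTower A K L] [IsScalarTower A B L]

/-- The ideal `∏ P ^ ((e_P - 1) / 2)` over the ramified primes `P` is invertible, and it has the
expected order at all primes of height one. -/
theorem exists_invertible_ideal [FaithfulSMul G B]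
    (hG : IsRegularTame G B) :
    ∃ J : Ideal B, IsUnit (coeSubmodule L J) ∧
      ∀ (P : Ideal B) (v : Valuation L ℤᵐ⁰) (e : ℕ), IsRamVal A K P v e →
        (∀ a ∈ J, v (algebraMap B L a) ≤ exp (-((e - 1) / 2 : ℕ) : ℤ)) ∧
        ∃ a ∈ J, v (algebraMap B L a) = exp (-((e - 1) / 2 : ℕ) : ℤ) := by
  classical
  set S : Finset (Ideal B) := (finite_ramified (G := G) (B := B)).toFinset with hS
  have hSmem : ∀ P, P ∈ S ↔ P.IsPrime ∧ P.height = 1 ∧ P.inertia G ≠ ⊥ := fun P => by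
    rw [hS, Set.Finite.mem_toFinset]; rfl
  set k : Ideal B → ℕ := fun P =>
    if h : ∃ e, ∃ v : Valuation L ℤᵐ⁰, IsRamVal A K P v e then (h.choose - 1) / 2 else 0 with hk
  have hkval : ∀ (P : Ideal B) (v : Valuation L ℤᵐ⁰) (e : ℕ), IsRamVal A K P v e →
      k P = (e - 1) / 2 := by
    intro P v e h
    have hex : ∃ e, ∃ v : Valuation L ℤᵐ⁰, IsRamVal A K P v e := ⟨e, v, h⟩
    obtain ⟨v', h'⟩ := hex.choose_spec
    have hvv := h.left.unique h'.left
    subst hvv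
    rw [hk]
    simp only [dif_pos hex]
    rw [h.right.index_unique h'.right]
  have hk0 : ∀ (P : Ideal B) (v : Valuation L ℤᵐ⁰) (e : ℕ), IsRamVal A K P v e → P ∉ S →
      (e - 1) / 2 = 0 := by
    intro P v e h hPS
    have hP := h.left.isPrime
    rw [hSmem] at hPS
    push Not at hPS
    have hI := hPS hP h.left.height_eq_one
    have hdvd := h.left.dvd_card_inertia h.right (hG.card_inertia_notMem P)
    rw [hI, Subgroup.card_bot, Nat.dvd_one] at hdvd
    rw [hdvd]
  refine ⟨∏ P ∈ S, P ^ k P, isUnit_coeSubmodule_prod_pow L k fun P hP => ?_, fun P v e h => ?_⟩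
  · obtain ⟨hPp, hht, hI⟩ := (hSmem P).1 hP
    refine isUnit_coeSubmodule L (fun h => ?_) fun Q hQ => ?_
    · rw [h, Ideal.height_bot] at hht
      exact zero_ne_one hht
    by_cases hPQ : P ≤ Q
    · obtain ⟨⟨g, hgP⟩, hg⟩ := Subgroup.ne_bot_iff_exists_ne_one.1 hI
      have hg1 : g ≠ 1 := fun h => hg (Subtype.ext h)
      refine exists_locally_principal (hG.regular Q) hht hPQ hgP
        (fun hmem => hG.card_inertia_notMem Q ?_) ?_
      · have hgQ : g ∈ Q.inertia G := fun b => hPQ (hgP b)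
        obtain ⟨m, hm⟩ := orderOf_dvd_natCard (⟨g, hgQ⟩ : Q.inertia G)
        rw [hm, Subgroup.orderOf_mk, Nat.cast_mul]
        exact Ideal.mul_mem_right _ _ hmem
      · by_contra hcon
        push Not at hcon
        exact hg1 (eq_of_smul_eq_smul (α := B) fun b => by rw [hcon b, one_smul])
    · obtain ⟨x, hx, hxQ⟩ := SetLike.not_le_iff_exists.1 hPQ
      exact ⟨x, hx, x, hxQ, fun p _ => Dvd.intro _ rfl⟩
  · have hP := h.left.isPrime
    have hht := h.left.height_eq_one
    constructor
    · intro a ha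
      by_cases hPS : P ∈ S
      · have h1 : a ∈ P ^ k P :=
          Ideal.le_of_dvd (Finset.dvd_prod_of_mem (fun P => P ^ k P) hPS) ha
        simpa [hkval P v e h] using h.left.le_exp_of_mem_pow h1
      · rw [hk0 P v e h hPS]
        simpa using h.left.le_one a
    · obtain ⟨t, ht, hvt⟩ := h.left.exists_uniformizer
      have hex : ∀ P' ∈ S.erase P, ∃ s ∈ P', s ∉ P := by
        intro P' hP'
        obtain ⟨hne, hP'⟩ := Finset.mem_erase.1 hP'
        obtain ⟨hPp, hht', -⟩ := (hSmem P').1 hP'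
        refine SetLike.not_le_iff_exists.1 fun hle => hne (eq_of_le_of_height_eq_one ?_ hle hht)
        intro h0
        rw [h0, Ideal.height_bot] at hht'
        exact zero_ne_one hht'
      choose! s hsP' hsP using hex
      have hs1 : v (algebraMap B L (∏ P' ∈ S.erase P, s P' ^ k P')) = 1 := by
        refine h.left.eq_one fun hmem => ?_
        obtain ⟨P', hP', h1⟩ := (Ideal.IsPrime.prod_mem_iff (p := P)).1 hmem
        exact hsP P' hP' (hP.mem_of_pow_mem _ h1)
      have hsmem : ∏ P' ∈ S.erase P, s P' ^ k P' ∈ ∏ P' ∈ S.erase P, P' ^ k P' :=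
        Ideal.prod_mem_prod fun P' hP' => Ideal.pow_mem_pow (hsP' P' hP') _
      by_cases hPS : P ∈ S
      · refine ⟨t ^ k P * ∏ P' ∈ S.erase P, s P' ^ k P', ?_, ?_⟩
        · rw [← Finset.mul_prod_erase _ _ hPS]
          exact Ideal.mul_mem_mul (Ideal.pow_mem_pow ht _) hsmem
        · rw [map_mul, map_mul, hs1, mul_one, map_pow, map_pow, hvt, ← exp_nsmul, hkval P v e h]
          simp
      · refine ⟨∏ P' ∈ S.erase P, s P' ^ k P', ?_, ?_⟩
        · rw [Finset.erase_eq_of_notMem hPS] at hsmem ⊢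
          exact hsmem
        · rw [hs1, hk0 P v e h hPS]; simp

theorem exists_isRamVal [SMulCommClass G K L]
    (hG : IsRegularTame G B)
    (P : Ideal B) [P.IsPrime] (hP : P.height = 1) :
    ∃ (v : Valuation L ℤᵐ⁰) (e : ℕ), IsRamVal A K P v e := by
  obtain ⟨v, hv⟩ := exists_isPrimeVal (L := L) hP (hG.regular P)
  obtain ⟨e, he⟩ := hv.exists_comap A K (hG.card_inertia_notMem P)
  exact ⟨v, e, hv, he⟩

/-- The square root of the codifferent is the inverse of `∏ P ^ ((e_P - 1) / 2)`, because a fraction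
that is integral in codimension one is integral. -/
theorem exists_ideal_mem_iff [FaithfulSMul G B] [SMulCommClass G K L]
    (hG : IsRegularTame G B) :
    ∃ J : Ideal B, IsUnit (coeSubmodule L J) ∧
      (∀ (P : Ideal B) (v : Valuation L ℤᵐ⁰) (e : ℕ), IsRamVal A K P v e →
        ∀ a ∈ J, v (algebraMap B L a) ≤ exp (-((e - 1) / 2 : ℕ) : ℤ)) ∧
      ∀ z : L, z ∈ ringSqrtCodiff A B K L ↔
        ∀ a ∈ J, ∃ b : B, algebraMap B L b = algebraMap B L a * z := by
  obtain ⟨J, hJ, hval⟩ := exists_invertible_ideal (L := L) A K hG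
  refine ⟨J, hJ, fun P v e h => (hval P v e h).1, fun z =>
    ⟨fun hz a ha => ?_, fun hz P v e h => ?_⟩⟩
  · refine exists_algebraMap_eq_of_codimOne hG.regular fun P hP hht => ?_
    obtain ⟨v, e, h⟩ := exists_isRamVal (L := L) A K hG P hht
    refine h.left.exists_mul _ ?_
    rw [map_mul]
    refine (mul_le_mul' ((hval P v e h).1 a ha) (hz P v e h)).trans_eq ?_
    rw [← exp_add, neg_add_cancel, exp_zero]
  · obtain ⟨a, ha, hva⟩ := (hval P v e h).2
    obtain ⟨b, hb⟩ := hz a ha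
    have h1 := h.left.le_one b
    rw [hb, map_mul, hva, exp_neg, inv_mul_le_one₀ exp_pos] at h1
    exact h1

theorem isUnit_ringSqrtCodiff [FaithfulSMul G B] [SMulCommClass G K L]
    (hG : IsRegularTame G B) :
    IsUnit (ringSqrtCodiff A B K L) := by
  obtain ⟨J, ⟨J', hJ⟩, -, hmem⟩ := exists_ideal_mem_iff (L := L) A K hG
  have h1 : ringSqrtCodiff A B K L = (↑J'⁻¹ : Submodule B L) := by
    apply le_antisymm
    · rw [← mul_one (ringSqrtCodiff A B K L), ← J'.mul_inv, ← mul_assoc, hJ]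
      refine (mul_le_mul_left ?_ _).trans_eq (one_mul _)
      rw [Submodule.mul_le]
      intro m hm n hn
      obtain ⟨a, ha, rfl⟩ := (mem_coeSubmodule L J).1 hn
      obtain ⟨b, hb⟩ := (hmem m).1 hm a ha
      exact Submodule.mem_one.2 ⟨b, by rw [hb, mul_comm]⟩
    · intro z hz
      rw [hmem]
      intro a ha
      have h2 : algebraMap B L a * z ∈ (J' : Submodule B L) * (↑J'⁻¹ : Submodule B L) := by
        refine Submodule.mul_mem_mul ?_ hz
        rw [hJ]
        exact (mem_coeSubmodule L J).2 ⟨a, ha, rfl⟩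
      rw [J'.mul_inv] at h2
      exact Submodule.mem_one.1 h2
  rw [h1]
  exact J'⁻¹.isUnit

end SqrtCodiff

/-! ### Duality for the trace form -/

section Duality

open WithZero IsLocalization

theorem exists_algebraMap_eq_of_algebraMap_eq (A : Type*) {B : Type*} (K : Type*) {L : Type*}
    [CommRing A] [CommRing B] [Algebra A B] [Field K] [Field L] [Algebra A K] [Algebra B L]
    [Algebra K L] [Algebra A L] [IsScalarTower A K L] [IsScalarTower A B L] [IsFractionRing B L]
    {z : K} {b : B} (h : algebraMap B L b = algebraMap K L z) (G : Type*) [Group G]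
    [MulSemiringAction G B] [MulSemiringAction G L] [SMulDistribClass G B L] [SMulCommClass G K L]
    [Algebra.IsInvariant A B G] : ∃ a : A, algebraMap A K a = z := by
  obtain ⟨a, ha⟩ := Algebra.IsInvariant.isInvariant (A := A) (G := G) b fun g =>
    IsFractionRing.injective B L (by rw [algebraMap.smul', h, smul_algebraMap])
  refine ⟨a, (algebraMap K L).injective ?_⟩
  rw [← h, ← ha, ← IsScalarTower.algebraMap_apply, ← IsScalarTower.algebraMap_apply]

variable (A : Type*) {B : Type*} (K : Type*) {L : Type*} [CommRing A] [CommRing B] [Algebra A B]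
  [Field K] [Field L] [Algebra A K] [Algebra B L] [Algebra K L]
  {G : Type*} [Group G] [Fintype G] [MulSemiringAction G B] [MulSemiringAction G L]
  [SMulDistribClass G B L] [IsGaloisGroup G K L]
  [IsDomain B] [IsFractionRing B L] [IsNoetherianRing B] [Algebra.IsInvariant A B G]
  [Algebra A L] [IsScalarTower A K L] [IsScalarTower A B L]

/-- The trace form takes values in `A`: the trace has order larger than `-e` at a prime with
ramification index `e`, and this order is a multiple of `e`. -/
theorem exists_algebraMap_eq_trace_mul [SMulCommClass G A B] (hG : IsRegularTame G B) {y z : L}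
    (hy : y ∈ ringSqrtCodiff A B K L) (hz : z ∈ ringSqrtCodiff A B K L) :
    ∃ a : A, algebraMap A K a = Algebra.trace K L (y * z) := by
  obtain ⟨b, hb⟩ := exists_algebraMap_eq_of_codimOne (B := B) (L := L) hG.regular
    (z := algebraMap K L (Algebra.trace K L (y * z))) fun P hP hht => by
      obtain ⟨v, e, h⟩ := exists_isRamVal (L := L) A K hG P hht
      refine h.left.exists_mul _ ?_
      have he : (0 : ℤ) < e := by exact_mod_cast h.right.pos
      have hle : v (algebraMap K L (Algebra.trace K L (y * z))) ≤ exp ((e : ℤ) - 1) := by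
        rw [algebraMap_trace_eq_sum_smul G]
        refine v.map_sum_le fun g _ => ?_
        rw [smul_mul', map_mul]
        refine (mul_le_mul' (smul_mem_ringSqrtCodiff A K g hy P v e h)
          (smul_mem_ringSqrtCodiff A K g hz P v e h)).trans ?_
        rw [← exp_add, exp_le_exp]
        omega
      by_cases h0 : Algebra.trace K L (y * z) = 0
      · rw [h0, map_zero, map_zero]; exact zero_le
      obtain ⟨k, hk⟩ := h.right.exists_eq_exp h0
      rw [Valuation.comap_apply] at hk
      rw [hk, exp_le_exp] at hle
      rw [hk, ← exp_zero, exp_le_exp]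
      have hk1 : k < 1 := lt_of_mul_lt_mul_right (by linarith) he.le
      exact mul_nonpos_of_nonpos_of_nonneg (by omega) he.le
  exact exists_algebraMap_eq_of_algebraMap_eq A K hb G

/-- The square root of the codifferent contains its dual. If the order of `x` at `P` is too small,
some `m` in the square root of the codifferent makes `x m` equal to `r / ϖ` with `ϖ ∈ A` a
uniformizer and `r` a unit at `P` whose trace is a unit at `P`. -/
theorem mem_ringSqrtCodiff_of_trace [IsFractionRing A K] [FaithfulSMul G B]
    (hG : IsRegularTame G B) {x : L}
    (hx : ∀ m ∈ ringSqrtCodiff A B K L, ∃ a : A, algebraMap A K a = Algebra.trace K L (x * m)) :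
    x ∈ ringSqrtCodiff A B K L := by
  intro P v e h
  by_contra hcon
  rw [not_le] at hcon
  have hP := h.left.isPrime
  have hAL : ∀ a, algebraMap K L (algebraMap A K a) = algebraMap B L (algebraMap A B a) :=
    fun a => by rw [← IsScalarTower.algebraMap_apply, ← IsScalarTower.algebraMap_apply]
  obtain ⟨J, -, hJval, hJmem⟩ := exists_ideal_mem_iff (G := G) (L := L) A K hG
  obtain ⟨ϖ, hϖ, hvϖ⟩ := h.right.exists_uniformizer
  rw [Valuation.comap_apply] at hvϖ
  have hx0 : x ≠ 0 := by
    rintro rfl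
    rw [map_zero] at hcon
    exact not_lt_zero hcon
  have hϖ0 : algebraMap K L (algebraMap A K ϖ) ≠ 0 :=
    (Valuation.ne_zero_iff v).1 (by rw [hvϖ]; exact exp_ne_zero)
  have hodd : Odd e := (hG.odd_card_inertia P).of_dvd_nat
    (h.left.dvd_card_inertia h.right (hG.card_inertia_notMem P))
  obtain ⟨k, hk⟩ := hodd
  set z : L := (algebraMap K L (algebraMap A K ϖ) * x)⁻¹ with hz
  have hvz : v z ≤ exp (k : ℤ) := by
    have hk2 : (e - 1) / 2 = k := by omega
    rw [hk2] at hcon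
    obtain ⟨j, hj⟩ : ∃ j : ℤ, v x = exp j :=
      ⟨log (v x), (exp_log ((Valuation.ne_zero_iff v).2 hx0)).symm⟩
    rw [hj, exp_lt_exp] at hcon
    rw [hz, map_inv₀, map_mul, hvϖ, hj, ← exp_add, ← exp_neg, exp_le_exp]
    omega
  -- `z` has the order allowed at `P`; a multiple `r z` with `r ∉ P` has it at every prime, because
  -- the ideal inverse to the square root of the codifferent is finitely generated
  obtain ⟨T, hT⟩ := IsNoetherian.noetherian J
  obtain ⟨r, hr, c, hc⟩ := h.left.exists_common_denominator
    (fun a : T => algebraMap B L a * z) (fun a => by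
      have h1 := hJval P v e h a (hT ▸ Submodule.subset_span a.2)
      rw [map_mul]
      refine (mul_le_mul' h1 hvz).trans ?_
      rw [← exp_add, ← exp_zero, exp_le_exp]
      omega)
  have hrz : algebraMap B L r * z ∈ ringSqrtCodiff A B K L := by
    rw [hJmem]
    intro a ha
    rw [← hT] at ha
    induction ha using Submodule.span_induction with
    | mem a ha => exact ⟨c ⟨a, ha⟩, by rw [hc]; ring⟩
    | zero => exact ⟨0, by simp⟩
    | add a a' _ _ ha ha' =>
      obtain ⟨b, hb⟩ := ha
      obtain ⟨b', hb'⟩ := ha'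
      exact ⟨b + b', by rw [map_add, map_add, hb, hb']; ring⟩
    | smul d a _ ha =>
      obtain ⟨b, hb⟩ := ha
      exact ⟨d * b, by rw [map_mul, hb, smul_eq_mul, map_mul]; ring⟩
  obtain ⟨b, hb⟩ := exists_sum_smul_mul_notMem (hG.card_inertia_notMem P) hr
  obtain ⟨a, ha⟩ := exists_algebraMap_eq_sum G A (r * b)
  obtain ⟨a', ha'⟩ := hx (algebraMap B L b * (algebraMap B L r * z)) (by
    rw [← Algebra.smul_def]; exact Submodule.smul_mem _ b hrz)
  refine hb ?_
  rw [← ha]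
  -- `a` is the trace of `r b`, and `a'` that of `x b (r z) = r b / ϖ`
  have h1 : algebraMap A K a = algebraMap A K (a' * ϖ) := by
    apply (algebraMap K L).injective
    have h2 : x * (algebraMap B L b * (algebraMap B L r * z)) =
        algebraMap B L (r * b) * (algebraMap K L (algebraMap A K ϖ))⁻¹ := by
      rw [hz, map_mul]; field_simp
    rw [map_mul, map_mul, ha', algebraMap_trace_eq_sum_smul G, h2, hAL, ha, map_sum,
      Finset.sum_mul]
    refine Finset.sum_congr rfl fun g _ => ?_
    have h3 : g • (algebraMap B L (r * b) * (algebraMap K L (algebraMap A K ϖ))⁻¹) =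
        algebraMap B L (g • (r * b)) * (algebraMap K L (algebraMap A K ϖ))⁻¹ := by
      rw [smul_mul', smul_inv'', smul_algebraMap g (algebraMap A K ϖ),
        algebraMap.smul' g (r * b)]
    rw [h3, inv_mul_cancel_right₀ hϖ0]
  rw [IsFractionRing.injective A K h1, map_mul]
  exact Ideal.mul_mem_left _ _ hϖ

end Duality

/-! ### Finiteness over the ring of invariants -/

section Finite

/-- A noetherian domain with regular local rings is integrally closed. -/
theorem isIntegrallyClosed_of_regular {B : Type*} [CommRing B] [IsDomain B] [IsNoetherianRing B]
    (hreg : ∀ (P : Ideal B) [P.IsPrime], IsRegularLocalRing (Localization.AtPrime P)) :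
    IsIntegrallyClosed B := by
  rw [isIntegrallyClosed_iff (FractionRing B)]
  intro z hz
  refine exists_algebraMap_eq_of_codimOne hreg fun P hP hht => ?_
  obtain ⟨v, hv⟩ := exists_isPrimeVal (L := FractionRing B) hht (hreg P)
  refine hv.exists_mul z ?_
  obtain ⟨p, hp, hz⟩ := hz
  by_contra hcon
  rw [not_le] at hcon
  have h1 : z ^ p.natDegree =
      -∑ i ∈ Finset.range p.natDegree, algebraMap B _ (p.coeff i) * z ^ i := by
    rw [Polynomial.eval₂_eq_sum_range, Finset.sum_range_succ, hp.coeff_natDegree,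
      map_one, one_mul] at hz
    linear_combination hz
  have hn : p.natDegree ≠ 0 := by
    intro h0
    rw [h0] at h1
    simp at h1
  have h2 : v (z ^ p.natDegree) ≤ v (z ^ (p.natDegree - 1)) := by
    rw [h1, Valuation.map_neg]
    refine v.map_sum_le fun i hi => ?_
    rw [map_mul, map_pow, map_pow]
    refine (mul_le_of_le_one_left zero_le (hv.le_one _)).trans ?_
    refine pow_le_pow_right₀ hcon.le ?_
    have := Finset.mem_range.1 hi
    omega
  rw [map_pow, map_pow] at h2
  exact absurd h2 (not_le.2 (pow_lt_pow_right₀ hcon (by omega)))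

/-- If `B` is flat over the ring of invariants `A`, it is faithfully flat, so that `A` is
noetherian. As `B` is the integral closure of `A` in a separable extension, it is then finite over
`A`. -/
theorem finite_of_flat (A B K L : Type*) [CommRing A] [CommRing B] [Algebra A B]
    [Field K] [Field L] [Algebra A K] [IsFractionRing A K] [Algebra B L] [Algebra K L]
    [Algebra A L] [IsScalarTower A K L] [IsScalarTower A B L] [IsDomain B] [IsFractionRing B L]
    [IsNoetherianRing B] (G : Type*) [Group G] [Finite G] [MulSemiringAction G B]
    [MulSemiringAction G L] [SMulDistribClass G B L] [SMulCommClass G A B] [IsGaloisGroup G K L]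
    [Algebra.IsInvariant A B G]
    (hreg : ∀ (P : Ideal B) [P.IsPrime], IsRegularLocalRing (Localization.AtPrime P))
    [Module.Flat A B] : IsNoetherianRing A ∧ Module.Finite A B := by
  have : Algebra.IsIntegral A B := Algebra.IsInvariant.isIntegral A B G
  have hinj : Function.Injective (algebraMap A B) := by
    have h1 : Function.Injective (algebraMap A L) := by
      rw [IsScalarTower.algebraMap_eq A K L]
      exact (algebraMap K L).injective.comp (IsFractionRing.injective A K)
    rw [IsScalarTower.algebraMap_eq A B L] at h1
    exact Function.Injective.of_comp h1
  have : FaithfulSMul A B := (faithfulSMul_iff_algebraMap_injective A B).2 hinj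
  have : IsDomain A := hinj.isDomain _
  have hff : Module.FaithfullyFlat A B := inferInstance
  have hA : IsNoetherianRing A := by
    rw [isNoetherianRing_iff_ideal_fg]
    exact fun I => Ideal.FG.of_FG_map_of_faithfullyFlat (S := B) (IsNoetherian.noetherian _)
  refine ⟨hA, ?_⟩
  have hB := isIntegrallyClosed_of_regular hreg
  have hA' : IsIntegrallyClosed A := by
    rw [isIntegrallyClosed_iff K]
    intro z hz
    have h1 : IsIntegral B (algebraMap K L z) := (hz.map (IsScalarTower.toAlgHom A K L)).tower_top
    obtain ⟨b, hb⟩ := (isIntegrallyClosed_iff L).1 hB h1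
    exact exists_algebraMap_eq_of_algebraMap_eq A K hb G
  have hcl : IsIntegralClosure B A L := by
    refine ⟨IsFractionRing.injective B L, fun {z} => ⟨fun hz => ?_, ?_⟩⟩
    · exact (isIntegrallyClosed_iff L).1 hB hz.tower_top
    · rintro ⟨b, rfl⟩
      exact (Algebra.IsIntegral.isIntegral (R := A) b).map (IsScalarTower.toAlgHom A B L)
  have := IsGaloisGroup.isGalois G K L
  have := IsGaloisGroup.finiteDimensional G K L
  exact IsIntegralClosure.finite A K L B

end Finite

/-! ### Projectivity and unimodularity -/

/-- If `1` is a trace for `G`, it is a trace for each subgroup: `c` is replaced by its sum over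
coset representatives. -/
theorem exists_sum_subgroup_smul_eq_one {G : Type*} [Group G] [Fintype G] (H : Subgroup G)
    [Fintype H] {B : Type*} [Semiring B] [MulSemiringAction G B] {c : B}
    (hc : ∑ g : G, g • c = 1) : ∃ b : B, ∑ h : H, h • b = 1 := by
  classical
  refine ⟨∑ q : G ⧸ H, (Quotient.out q : G)⁻¹ • c, ?_⟩
  have hbij : Function.Bijective fun p : H × (G ⧸ H) => ((p.1 : G) * (Quotient.out p.2)⁻¹) := by
    refine ⟨fun p p' h => ?_, fun g => ?_⟩
    · have h1 : Quotient.out p.2 * (p.1 : G)⁻¹ = Quotient.out p'.2 * (p'.1 : G)⁻¹ := by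
        simpa using congrArg (fun g : G => g⁻¹) h
      have h2 : p.2 = p'.2 := by
        have h3 := congrArg (QuotientGroup.mk : G → G ⧸ H) h1
        rw [← Subgroup.coe_inv, ← Subgroup.coe_inv, QuotientGroup.mk_mul_of_mem _ (p.1⁻¹).2,
          QuotientGroup.mk_mul_of_mem _ (p'.1⁻¹).2, QuotientGroup.out_eq',
          QuotientGroup.out_eq'] at h3
        exact h3
      refine Prod.ext (Subtype.ext ?_) h2
      simpa [h2] using h
    · obtain ⟨h, hh⟩ := QuotientGroup.mk_out_eq_mul H g⁻¹
      refine ⟨⟨h, QuotientGroup.mk g⁻¹⟩, ?_⟩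
      change (h : G) * (Quotient.out (QuotientGroup.mk g⁻¹ : G ⧸ H))⁻¹ = g
      rw [hh]
      simp
  rw [← hc, ← Fintype.sum_bijective _ hbij _ _ fun _ => rfl, Fintype.sum_prod_type]
  refine Finset.sum_congr rfl fun h _ => ?_
  rw [Finset.smul_sum]
  exact Finset.sum_congr rfl fun q _ => (mul_smul _ _ _).symm

/-- Every element of `L` has a denominator in `A` with respect to the square root of the
codifferent. -/
theorem exists_algebraMap_mul_mem_ringSqrtCodiff (A : Type*) {B : Type*} (K : Type*) {L : Type*}
    [CommRing A] [CommRing B] [Algebra A B] [Field K] [Field L] [Algebra A K] [IsFractionRing A K]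
    [Algebra B L] [Algebra K L] [Algebra A L] [IsScalarTower A K L] [IsScalarTower A B L]
    [IsDomain B] [IsFractionRing B L] [IsNoetherianRing B] {G : Type*} [Group G] [Finite G]
    [MulSemiringAction G B] [MulSemiringAction G L] [IsGaloisGroup G K L]
    (hG : IsRegularTame G B) (z : L) :
    ∃ a : A, a ≠ 0 ∧ algebraMap A L a * z ∈ ringSqrtCodiff A B K L := by
  have := IsGaloisGroup.finiteDimensional G K L
  have hB := isIntegrallyClosed_of_regular hG.regular
  have : IsDomain A := (IsFractionRing.injective A K).isDomain _
  have halg : IsAlgebraic A z :=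
    (IsFractionRing.isAlgebraic_iff A K L).2 (Algebra.IsAlgebraic.isAlgebraic z)
  obtain ⟨a, ha, h⟩ := halg.exists_integral_multiple
  obtain ⟨b, hb⟩ := (isIntegrallyClosed_iff L).1 hB h.tower_top
  refine ⟨a, ha, ?_⟩
  rw [← Algebra.smul_def, ← hb, Algebra.algebraMap_eq_smul_one]
  exact Submodule.smul_mem _ _ (one_mem_ringSqrtCodiff A K)

theorem exists_sum_smul_eq_one_subgroup (A : Type*) {B G : Type*} [CommRing A] [CommRing B]
    [Algebra A B] [Group G] [Fintype G] [MulSemiringAction G B] [SMulCommClass G A B]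
    [Algebra.IsInvariant A B G] (H : Subgroup G) [Fintype H] (hG : IsRegularTame G B) :
    ∃ b : B, ∑ h : H, h • b = 1 := by
  obtain ⟨c, hc⟩ := exists_sum_smul_eq_one (G := G) A hG.card_inertia_notMem
  exact exists_sum_subgroup_smul_eq_one H hc

section Projective

variable (A : Type*) {B : Type*} (K : Type*) {L : Type*} [CommRing A] [CommRing B] [Algebra A B]
  [Field K] [Field L] [Algebra A K] [IsFractionRing A K] [Algebra B L] [Algebra K L]
  {G : Type*} [Group G] [Fintype G] [MulSemiringAction G B] [MulSemiringAction G L]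
  [SMulDistribClass G B L] [SMulCommClass G A B] [IsGaloisGroup G K L]
  [IsDomain B] [IsFractionRing B L] [IsNoetherianRing B] [Algebra.IsInvariant A B G]
  [Algebra A L] [IsScalarTower A K L] [IsScalarTower A B L] [FaithfulSMul G B]

theorem finite_ringSqrtCodiff [Module.Flat A B] (hG : IsRegularTame G B) :
    Module.Finite A (ringSqrtCodiff A B K L) := by
  have ⟨_, _⟩ := finite_of_flat A B K L G hG.regular
  have : Module.Finite B (ringSqrtCodiff A B K L) :=
    Module.Finite.iff_fg.2 (Submodule.fg_of_isUnit (isUnit_ringSqrtCodiff (L := L) A K hG))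
  exact Module.Finite.trans B _

/-- The square root of the codifferent is invertible over `B`, hence flat over `A`. -/
theorem projective_ringSqrtCodiff [Module.Flat A B] (hG : IsRegularTame G B) :
    Module.Projective A (ringSqrtCodiff A B K L) := by
  have ⟨_, _⟩ := finite_of_flat A B K L G hG.regular
  have := finite_ringSqrtCodiff (L := L) A K hG
  have := Submodule.projective_of_isUnit (isUnit_ringSqrtCodiff (L := L) A K hG)
  have : Module.Flat A (ringSqrtCodiff A B K L) := Module.Flat.trans A B _
  have : Module.FinitePresentation A (ringSqrtCodiff A B K L) :=
    Module.finitePresentation_of_finite A _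
  exact Module.Flat.projective_of_finitePresentation

/-- The trace form on the square root of the codifferent is unimodular: a linear form extends to
`L`, where it is represented by some `x`, and `x` lies in the square root of the codifferent as its
traces against that module are in `A`. -/
theorem existsUnique_trace_mul_eq (hG : IsRegularTame G B)
    (l : ringSqrtCodiff A B K L →ₗ[A] A) :
    ∃! x : ringSqrtCodiff A B K L, ∀ m : ringSqrtCodiff A B K L,
      Algebra.trace K L (x * m) = algebraMap A K (l m) := by
  have := IsGaloisGroup.isGalois G K L
  have := IsGaloisGroup.finiteDimensional G K L
  have : IsDomain A := (IsFractionRing.injective A K).isDomain _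
  let M := (ringSqrtCodiff A B K L).restrictScalars A
  have hsmul (a : A) (z : L) : a • z = algebraMap A K a • z := by
    rw [algebraMap_smul]
  have hloc : IsLocalizedModule (nonZeroDivisors A) M.subtype := by
    refine ⟨fun s => ?_, fun z => ?_, fun h => ⟨1, by rw [Subtype.ext h]⟩⟩
    · rw [Module.End.isUnit_iff]
      have hs := nonZeroDivisors.coe_ne_zero s
      have hs' : algebraMap A K s ≠ 0 := fun h =>
        hs (IsFractionRing.injective A K (h.trans (map_zero _).symm))
      refine ⟨fun y z h => ?_, fun z => ⟨(algebraMap A K s)⁻¹ • z, ?_⟩⟩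
      · simp only [Module.algebraMap_end_apply, hsmul] at h
        exact smul_right_injective L hs' h
      · rw [Module.algebraMap_end_apply, hsmul, smul_inv_smul₀ hs']
    · obtain ⟨a, ha, h⟩ := exists_algebraMap_mul_mem_ringSqrtCodiff A K hG z
      exact ⟨⟨⟨_, h⟩, ⟨a, mem_nonZeroDivisors_of_ne_zero ha⟩⟩, Algebra.smul_def a z⟩
  let l' : L →ₗ[A] K := IsLocalizedModule.lift (nonZeroDivisors A) M.subtype
    (Algebra.linearMap A K ∘ₗ l) (IsLocalizedModule.map_units (Algebra.linearMap A K))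
  have hl' (m : ringSqrtCodiff A B K L) : l' m = algebraMap A K (l m) :=
    IsLocalizedModule.lift_apply (nonZeroDivisors A) M.subtype _ _ m
  have hnd := traceForm_nondegenerate K L
  set x := ((Algebra.traceForm K L).toDual hnd).symm
    (l'.extendScalarsOfIsLocalization (nonZeroDivisors A) K) with hx
  have hxl (z : L) : Algebra.trace K L (x * z) = l' z :=
    LinearMap.BilinForm.apply_toDual_symm_apply (hB := hnd) _ z
  refine ⟨⟨x, mem_ringSqrtCodiff_of_trace (G := G) A K hG fun m hm => ⟨l ⟨m, hm⟩, ?_⟩⟩,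
    fun m => by rw [hxl, hl'], fun y hy => Subtype.ext ?_⟩
  · rw [hxl, ← hl' ⟨m, hm⟩]
  · apply ((Algebra.traceForm K L).toDual hnd).injective
    refine Eq.trans ?_ (LinearEquiv.apply_symm_apply _ _).symm
    ext z
    change Algebra.trace K L (y * z) = l' z
    obtain ⟨a, ha, h⟩ := exists_algebraMap_mul_mem_ringSqrtCodiff A K hG z
    have ha' : algebraMap A K a ≠ 0 := fun h =>
      ha (IsFractionRing.injective A K (h.trans (map_zero _).symm))
    have h1 : Algebra.trace K L (y * (algebraMap A L a * z)) = l' (algebraMap A L a * z) := by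
      rw [hy ⟨_, h⟩, ← hl']
    rw [← Algebra.smul_def, map_smul, mul_smul_comm, hsmul, map_smul, ← algebraMap_smul K a,
      smul_eq_mul, smul_eq_mul] at h1
    exact mul_left_cancel₀ ha' h1

end Projective

section Fixed

variable (A : Type*) (B : Type*) (K : Type*) (L : Type*) [CommRing A] [CommRing B] [Algebra A B]
  [Field K] [Field L] [Algebra A K] [Algebra B L] [Algebra K L]
  {G : Type*} [Group G] [MulSemiringAction G L] [SMulCommClass G K L]
  [Algebra A L] [IsScalarTower A K L] [IsScalarTower A B L] (H : Subgroup G)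

/-- The elements of the square root of the codifferent that are fixed by `H`. -/
def ringFixed : Submodule A L where
  carrier := {z | z ∈ ringSqrtCodiff A B K L ∧ ∀ h : H, h • z = z}
  zero_mem' := ⟨zero_mem _, fun h => smul_zero h⟩
  add_mem' hy hz := ⟨add_mem hy.1 hz.1, fun h => by rw [smul_add, hy.2, hz.2]⟩
  smul_mem' a z hz := ⟨Submodule.smul_of_tower_mem _ a hz.1, fun h => by
    rw [← algebraMap_smul K a z]
    exact (smul_comm (h : G) (algebraMap A K a) z).trans (congrArg _ (hz.2 h))⟩

variable {A B K L H}

variable [MulSemiringAction G B] [SMulDistribClass G B L] [SMulCommClass G A B] [Fintype H]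

variable (A B K L H) in
/-- The sum over `H`, as a map from the square root of the codifferent to its `H`-invariants. -/
def sumFixed : ringSqrtCodiff A B K L →ₗ[A] ringFixed A B K L H where
  toFun m := ⟨∑ h : H, (h : G) • (m : L), sum_mem fun h _ =>
    smul_mem_ringSqrtCodiff A K (h : G) m.2, fun k => by
      rw [Finset.smul_sum]
      refine Fintype.sum_equiv (Equiv.mulLeft k) _ _ fun h => ?_
      change (k : G) • (h : G) • (m : L) = ((k * h : H) : G) • (m : L)
      rw [smul_smul, Subgroup.coe_mul]⟩
  map_add' m n := Subtype.ext (by simp [Finset.sum_add_distrib])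
  map_smul' a m := Subtype.ext (by
    have h1 (h : H) : (h : G) • (a • (m : L)) = a • (h : G) • (m : L) := by
      rw [← algebraMap_smul K a, ← algebraMap_smul K a, smul_comm]
    change ∑ h : H, (h : G) • (a • (m : L)) = a • ∑ h : H, (h : G) • (m : L)
    rw [Finset.smul_sum]
    exact Finset.sum_congr rfl fun h _ => h1 h)

/-- If `∑ h, h b = 1`, then `m ↦ ∑ h, h (b m)` is the identity on `H`-invariants. -/
theorem sum_smul_mul_of_fixed {b : B} (hb : ∑ h : H, h • b = 1) {z : L}
    (hz : ∀ h : H, h • z = z) : ∑ h : H, (h : G) • (b • z) = z := by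
  have h1 (h : H) : (h : G) • (b • z) = algebraMap B L (h • b) * z := by
    rw [Algebra.smul_def, smul_mul', ← algebraMap.smul']
    exact congrArg₂ _ rfl (hz h)
  rw [Finset.sum_congr rfl fun h _ => h1 h, ← Finset.sum_mul, ← map_sum, hb, map_one, one_mul]

theorem sum_smul_mul_fixed {x : L} (hx : ∀ h : H, h • x = x) (m : L) :
    ∑ h : H, (h : G) • (x * m) = x * ∑ h : H, (h : G) • m := by
  rw [Finset.mul_sum]
  refine Finset.sum_congr rfl fun h _ => ?_
  rw [smul_mul']
  exact congrArg (· * _) (hx h)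

theorem sumFixed_smul {b : B} (hb : ∑ h : H, h • b = 1) (x : ringFixed A B K L H) :
    sumFixed A B K L H ⟨b • (x : L), Submodule.smul_mem _ b x.2.1⟩ = x :=
  Subtype.ext (sum_smul_mul_of_fixed hb x.2.2)

/-- Here `τ` stands for the trace to `K` from the subfield fixed by `H`, characterized by
transitivity of traces. -/
theorem eq_trace_of_fixed {τ : L → K}
    (hτ : ∀ m : L, τ (∑ h : H, (h : G) • m) = Algebra.trace K L m)
    {b : B} (hb : ∑ h : H, h • b = 1) {z : L} (hz : ∀ h : H, h • z = z) :
    τ z = Algebra.trace K L (b • z) := by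
  rw [← hτ, sum_smul_mul_of_fixed hb hz]

variable [Fintype G] [IsFractionRing A K] [IsGaloisGroup G K L]
  [IsDomain B] [IsFractionRing B L] [IsNoetherianRing B] [Algebra.IsInvariant A B G]
  [FaithfulSMul G B]

theorem sumFixed_surjective (hG : IsRegularTame G B) :
    Function.Surjective (sumFixed A B K L H) := fun x =>
  have ⟨_, hb⟩ := exists_sum_smul_eq_one_subgroup A H hG
  ⟨_, sumFixed_smul hb x⟩

theorem finite_ringFixed [Module.Flat A B] (hG : IsRegularTame G B) :
    Module.Finite A (ringFixed A B K L H) :=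
  have := finite_ringSqrtCodiff (L := L) A K hG
  Module.Finite.of_surjective _ (sumFixed_surjective hG)

/-- The `H`-invariants are a direct summand of the square root of the codifferent. -/
theorem projective_ringFixed [Module.Flat A B] (hG : IsRegularTame G B) :
    Module.Projective A (ringFixed A B K L H) := by
  have := projective_ringSqrtCodiff (L := L) A K hG
  obtain ⟨b, hb⟩ := exists_sum_smul_eq_one_subgroup A H hG
  let i : ringFixed A B K L H →ₗ[A] ringSqrtCodiff A B K L :=
    { toFun x := ⟨b • (x : L), Submodule.smul_mem _ b x.2.1⟩
      map_add' _ _ := Subtype.ext (smul_add _ _ _)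
      map_smul' a x := Subtype.ext (smul_comm b a (x : L)) }
  exact Module.Projective.of_split i (sumFixed A B K L H) (LinearMap.ext (sumFixed_smul hb))

theorem exists_algebraMap_eq_of_fixed (hG : IsRegularTame G B) {τ : L → K}
    (hτ : ∀ m : L, τ (∑ h : H, (h : G) • m) = Algebra.trace K L m)
    (x y : ringFixed A B K L H) : ∃ a : A, algebraMap A K a = τ (x * y) := by
  obtain ⟨b, hb⟩ := exists_sum_smul_eq_one_subgroup A H hG
  rw [eq_trace_of_fixed hτ hb fun h => by rw [smul_mul', x.2.2, y.2.2], ← smul_mul_assoc]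
  exact exists_algebraMap_eq_trace_mul A K hG (Submodule.smul_mem _ b x.2.1) y.2.1

/-- The dual of a linear form `l` on the `H`-invariants is the dual of `m ↦ l (∑ h, h m)`, which is
`H`-invariant because it is unique. -/
theorem existsUnique_form_eq_of_fixed (hG : IsRegularTame G B) {τ : L → K}
    (hτ : ∀ m : L, τ (∑ h : H, (h : G) • m) = Algebra.trace K L m)
    (l : ringFixed A B K L H →ₗ[A] A) :
    ∃! x : ringFixed A B K L H, ∀ y : ringFixed A B K L H,
      τ (x * y) = algebraMap A K (l y) := by
  obtain ⟨b, hb⟩ := exists_sum_smul_eq_one_subgroup A H hG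
  obtain ⟨x, hx, huniq⟩ := existsUnique_trace_mul_eq A K hG (l ∘ₗ sumFixed A B K L H)
  have hsmul (m : ringSqrtCodiff A B K L) (h : H) : sumFixed A B K L H
      ⟨(h : G)⁻¹ • (m : L), smul_mem_ringSqrtCodiff A K _ m.2⟩ = sumFixed A B K L H m := by
    refine Subtype.ext (Fintype.sum_equiv (Equiv.mulRight h⁻¹) _ _ fun k => ?_)
    change (k : G) • (h : G)⁻¹ • (m : L) = ((k * h⁻¹ : H) : G) • (m : L)
    rw [smul_smul, Subgroup.coe_mul, Subgroup.coe_inv]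
  have hfix (h : H) : h • (x : L) = x := by
    have h1 := huniq ⟨(h : G) • (x : L), smul_mem_ringSqrtCodiff A K _ x.2⟩ fun m => by
      have h2 := hx ⟨(h : G)⁻¹ • (m : L), smul_mem_ringSqrtCodiff A K _ m.2⟩
      have h3 : Algebra.trace K L ((h : G) • (x : L) * m) =
          Algebra.trace K L ((x : L) * (h : G)⁻¹ • (m : L)) := by
        apply (algebraMap K L).injective
        rw [algebraMap_trace_eq_sum_smul G, algebraMap_trace_eq_sum_smul G]
        refine Fintype.sum_equiv (Equiv.mulRight (h : G)) _ _ fun g => ?_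
        rw [Equiv.coe_mulRight, mul_smul, smul_mul', smul_mul' (h : G), smul_inv_smul, smul_mul']
      rw [h3, h2, LinearMap.comp_apply, LinearMap.comp_apply, hsmul]
    exact Subtype.ext_iff.1 h1
  refine ⟨⟨x, x.2, hfix⟩, fun y => ?_, fun y hy => Subtype.ext ?_⟩
  · have h1 := hx ⟨b • (y : L), Submodule.smul_mem _ b y.2.1⟩
    rw [LinearMap.comp_apply, sumFixed_smul hb] at h1
    rw [← h1, mul_smul_comm]
    exact eq_trace_of_fixed hτ hb fun h => by rw [smul_mul', hfix, y.2.2]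
  · have h1 := huniq ⟨y, y.2.1⟩ fun m => by
      rw [← hτ, sum_smul_mul_fixed y.2.2]
      exact hy (sumFixed A B K L H m)
    have h2 : (y : L) = x := by rw [← h1]
    exact h2

end Fixed

/-! ### Points of affine open subschemes -/

noncomputable section

section Points

open WithZero

variable {X Y : Scheme.{u}}

theorem germ_appLE (f : X ⟶ Y) (U : Y.Opens) (W : X.Opens) (e : W ≤ f ⁻¹ᵁ U) (x : X) (hx : x ∈ W)
    (a : Γ(Y, U)) : (X.presheaf.germ W x hx).hom ((f.appLE U W e).hom a) =
      (f.stalkMap x).hom ((Y.presheaf.germ U (f x) (e hx)).hom a) := by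
  have h1 : f.appLE U W e ≫ X.presheaf.germ W x hx =
      Y.presheaf.germ U (f x) (e hx) ≫ f.stalkMap x := by
    refine Eq.trans ?_ (Scheme.Hom.germ_stalkMap f U x (e hx)).symm
    rw [Scheme.Hom.appLE, Category.assoc, TopCat.Presheaf.germ_res]
  exact congrArg (fun k : Γ(Y, U) ⟶ X.presheaf.stalk x => k.hom a) h1

/-- The ideal of the sections over `W` that vanish at the point `x` of `W`. -/
def pointIdeal (W : X.Opens) (x : X) (hx : x ∈ W) : Ideal Γ(X, W) :=
  (IsLocalRing.maximalIdeal (X.presheaf.stalk x)).comap (X.presheaf.germ W x hx).hom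

instance (W : X.Opens) (x : X) (hx : x ∈ W) : (pointIdeal W x hx).IsPrime := by
  unfold pointIdeal; infer_instance

theorem pointIdeal_comap_appLE (f : X ⟶ Y) (U : Y.Opens) (W : X.Opens) (e : W ≤ f ⁻¹ᵁ U) (x : X)
    (hx : x ∈ W) :
    (pointIdeal W x hx).comap (f.appLE U W e).hom = pointIdeal U (f x) (e hx) := by
  ext a
  change (X.presheaf.germ W x hx).hom ((f.appLE U W e).hom a) ∈ IsLocalRing.maximalIdeal _ ↔
    (Y.presheaf.germ U (f x) (e hx)).hom a ∈ IsLocalRing.maximalIdeal _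
  rw [germ_appLE, IsLocalRing.mem_maximalIdeal, IsLocalRing.mem_maximalIdeal, mem_nonunits_iff,
    mem_nonunits_iff, isUnit_map_iff]

theorem pointIdeal_eq {W : X.Opens} (hW : IsAffineOpen W) (x : X) (hx : x ∈ W) :
    pointIdeal W x hx = (hW.primeIdealOf ⟨x, hx⟩).asIdeal := by
  let _ := (X.presheaf.germ W x hx).hom.toAlgebra
  have h : IsLocalization.AtPrime (X.presheaf.stalk x) (hW.primeIdealOf ⟨x, hx⟩).asIdeal :=
    hW.isLocalization_stalk ⟨x, hx⟩
  exact IsLocalization.AtPrime.under_maximalIdeal (X.presheaf.stalk x)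
    (hW.primeIdealOf ⟨x, hx⟩).asIdeal

theorem isLocalization_pointIdeal {W : X.Opens} (hW : IsAffineOpen W) (x : X) (hx : x ∈ W) :
    let _ := (X.presheaf.germ W x hx).hom.toAlgebra
    IsLocalization.AtPrime (X.presheaf.stalk x) (pointIdeal W x hx) := by
  let _ := (X.presheaf.germ W x hx).hom.toAlgebra
  have h : IsLocalization.AtPrime (X.presheaf.stalk x) (hW.primeIdealOf ⟨x, hx⟩).asIdeal :=
    hW.isLocalization_stalk ⟨x, hx⟩
  intro _
  simp_rw [pointIdeal_eq hW]
  exact h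

theorem exists_pointIdeal_eq {W : X.Opens} (hW : IsAffineOpen W) (P : Ideal Γ(X, W))
    [hP : P.IsPrime] : ∃ x, ∃ hx : x ∈ W, pointIdeal W x hx = P := by
  let p : Spec Γ(X, W) := (⟨P, hP⟩ : PrimeSpectrum Γ(X, W))
  let x : W := hW.isoSpec.inv p
  have h : hW.primeIdealOf x = p :=
    congrArg (fun k : Spec Γ(X, W) ⟶ Spec Γ(X, W) => k p) hW.isoSpec.inv_hom_id
  exact ⟨x.1, x.2, (pointIdeal_eq hW x.1 x.2).trans (congrArg PrimeSpectrum.asIdeal h)⟩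

theorem mem_pointIdeal_iff {W : X.Opens} {x : X} {hx : x ∈ W} {a : Γ(X, W)} :
    a ∈ pointIdeal W x hx ↔ x ∉ X.basicOpen a := by
  rw [Scheme.mem_basicOpen X a x hx]
  rfl

theorem isRegularLocalRing_pointIdeal {W : X.Opens} (hW : IsAffineOpen W) (x : X) (hx : x ∈ W)
    (h : IsRegularLocalRing (X.presheaf.stalk x)) :
    IsRegularLocalRing (Localization.AtPrime (pointIdeal W x hx)) := by
  let _ := (X.presheaf.germ W x hx).hom.toAlgebra
  have := isLocalization_pointIdeal hW x hx
  exact IsRegularLocalRing.of_ringEquiv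
    (IsLocalization.algEquiv (pointIdeal W x hx).primeCompl (X.presheaf.stalk x)
      (Localization.AtPrime (pointIdeal W x hx))).toRingEquiv

theorem height_pointIdeal {W : X.Opens} (hW : IsAffineOpen W) (x : X) (hx : x ∈ W) :
    ((pointIdeal W x hx).height : WithBot ℕ∞) = ringKrullDim (X.presheaf.stalk x) := by
  let _ := (X.presheaf.germ W x hx).hom.toAlgebra
  have := isLocalization_pointIdeal hW x hx
  exact (IsLocalization.AtPrime.ringKrullDim_eq_height (pointIdeal W x hx) _).symm

variable [IsIntegral X]

theorem algebraMap_germ (W : X.Opens) [Nonempty W] (x : X) (hx : x ∈ W) (a : Γ(X, W)) :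
    algebraMap (X.presheaf.stalk x) X.functionField ((X.presheaf.germ W x hx).hom a) =
      algebraMap Γ(X, W) X.functionField a :=
  Scheme.algebraMap_germ_eq_germToFunctionField (X := X) hx a

theorem isPrimeVal_stalk_iff {W : X.Opens} (hW : IsAffineOpen W) [Nonempty W] {x : X} (hx : x ∈ W)
    {v : Valuation X.functionField ℤᵐ⁰} {e : ℕ} :
    IsPrimeVal (IsLocalRing.maximalIdeal (X.presheaf.stalk x)) v e ↔
      IsPrimeVal (pointIdeal W x hx) v e := by
  let _ := (X.presheaf.germ W x hx).hom.toAlgebra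
  have := isLocalization_pointIdeal hW x hx
  have : IsScalarTower Γ(X, W) (X.presheaf.stalk x) X.functionField :=
    IsScalarTower.of_algebraMap_eq fun a => (algebraMap_germ W x hx a).symm
  exact IsPrimeVal.localization

variable [IsIntegral Y] (f : X ⟶ Y) [IsDominant f]

theorem ffMap_appLE (U : Y.Opens) [Nonempty U] (W : X.Opens) [Nonempty W] (e : W ≤ f ⁻¹ᵁ U)
    (a : Γ(Y, U)) : ffMap f (algebraMap Γ(Y, U) Y.functionField a) =
      algebraMap Γ(X, W) X.functionField ((f.appLE U W e).hom a) := by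
  have hx : genericPoint X ∈ W :=
    ((genericPoint_spec X).mem_open_set_iff W.isOpen).mpr (by simpa using ‹Nonempty W›)
  rw [ffMap_germ f U (genericPoint X) (e hx) a, ← algebraMap_germ W _ hx, germ_appLE]

section LocalCondition

variable {f} {x : X} {v : Valuation X.functionField ℤᵐ⁰} {m n : ℕ}
  (hm : IsPrimeVal (IsLocalRing.maximalIdeal (X.presheaf.stalk x)) v m)
  (hn : IsPrimeVal (IsLocalRing.maximalIdeal (Y.presheaf.stalk (f x))) (v.comap (ffMap f)) n)

theorem mem_maximalIdeal_pow_iff_le_exp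
    (hm : IsPrimeVal (IsLocalRing.maximalIdeal (X.presheaf.stalk x)) v m) {k : ℕ}
    {c : X.presheaf.stalk x} : c ∈ IsLocalRing.maximalIdeal (X.presheaf.stalk x) ^ k ↔
      v (algebraMap _ X.functionField c) ≤ exp (-(k * m : ℤ)) := by
  refine ⟨hm.le_exp_of_mem_pow, fun h => ?_⟩
  obtain ⟨s, hs, h1⟩ := hm.exists_mul_mem_pow (IsFractionRing.injective _ _) h
  rw [IsLocalRing.notMem_maximalIdeal] at hs
  obtain ⟨u, rfl⟩ := hs
  rw [← Units.inv_mul_cancel_left u c]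
  exact Ideal.mul_mem_left _ _ h1

theorem dvd_of_isPrimeVal (hm : IsPrimeVal (IsLocalRing.maximalIdeal (X.presheaf.stalk x)) v m)
    (hn : IsPrimeVal (IsLocalRing.maximalIdeal (Y.presheaf.stalk (f x))) (v.comap (ffMap f)) n) :
    m ∣ n := by
  obtain ⟨t, ht, hvt⟩ := hn.exists_uniformizer
  rw [Valuation.comap_apply] at hvt
  have h0 : ffMap f (algebraMap _ Y.functionField t) ≠ 0 :=
    (Valuation.ne_zero_iff v).1 (by rw [hvt]; exact exp_ne_zero)
  obtain ⟨k, hk⟩ := hm.exists_eq_exp h0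
  rw [hvt, exp_inj] at hk
  exact Int.natCast_dvd_natCast.1 ⟨-k, by linarith⟩

theorem ramIdx_eq_div (hm : IsPrimeVal (IsLocalRing.maximalIdeal (X.presheaf.stalk x)) v m)
    (hn : IsPrimeVal (IsLocalRing.maximalIdeal (Y.presheaf.stalk (f x))) (v.comap (ffMap f)) n) :
    ramIdx f x = n / m := by
  have h1 : {k | (IsLocalRing.maximalIdeal (Y.presheaf.stalk (f x))).map (f.stalkMap x).hom ≤
      IsLocalRing.maximalIdeal (X.presheaf.stalk x) ^ k} = Set.Iic (n / m) := by
    ext k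
    rw [Set.mem_ofPred_eq, Ideal.map_le_iff_le_comap, Set.mem_Iic, Nat.le_div_iff_mul_le hm.pos]
    have h2 (a : Y.presheaf.stalk (f x)) :
        a ∈ (IsLocalRing.maximalIdeal (X.presheaf.stalk x) ^ k).comap (f.stalkMap x).hom ↔
          (v.comap (ffMap f)) (algebraMap _ Y.functionField a) ≤ exp (-(k * m : ℤ)) := by
      rw [Ideal.mem_comap, mem_maximalIdeal_pow_iff_le_exp hm, Valuation.comap_apply,
        ffMap_algebraMap]
    constructor
    · intro h
      obtain ⟨t, ht, hvt⟩ := hn.exists_uniformizer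
      have h3 := (h2 t).1 (h ht)
      rw [hvt, exp_le_exp] at h3
      have h4 : (k * m : ℤ) ≤ n := by linarith
      exact_mod_cast h4
    · intro h a ha
      refine (h2 a).2 ((hn.le_exp a ha).trans ?_)
      rw [exp_le_exp]
      have h4 : (k * m : ℤ) ≤ n := by exact_mod_cast h
      linarith
  rw [ramIdx, h1, csSup_Iic]

/-- The condition that defines the square root of the codifferent at `x`, in terms of a valuation
`v` of the function field whose values on `K(X)` and on `K(Y)` are generated by `exp m` and
`exp n`. -/
theorem forall_mem_pow_iff (hm : IsPrimeVal (IsLocalRing.maximalIdeal (X.presheaf.stalk x)) v m)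
    (hn : IsPrimeVal (IsLocalRing.maximalIdeal (Y.presheaf.stalk (f x))) (v.comap (ffMap f)) n)
    (z : X.functionField) :
    (∀ a ∈ IsLocalRing.maximalIdeal (X.presheaf.stalk x) ^ ((ramIdx f x - 1) / 2),
      ∃ b : X.presheaf.stalk x, algebraMap _ X.functionField b = algebraMap _ _ a * z) ↔
    v z ≤ exp (((n / m - 1) / 2 * m : ℕ) : ℤ) := by
  rw [ramIdx_eq_div hm hn]
  set k := (n / m - 1) / 2
  constructor
  · intro h
    obtain ⟨t, ht, hvt⟩ := hm.exists_uniformizer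
    obtain ⟨b, hb⟩ := h (t ^ k) (Ideal.pow_mem_pow ht k)
    have h1 := hm.le_one b
    have h2 : (exp (-(m : ℤ)) : ℤᵐ⁰) ^ k = (exp ((k * m : ℕ) : ℤ))⁻¹ := by
      rw [← exp_nsmul, ← exp_neg]
      congr 1
      push_cast
      simp
    rwa [hb, map_mul, map_pow, map_pow, hvt, h2, inv_mul_le_one₀ exp_pos] at h1
  · intro h a ha
    have h1 : v (algebraMap _ X.functionField a * z) ≤ 1 := by
      rw [map_mul]
      refine (mul_le_mul' (hm.le_exp_of_mem_pow ha) h).trans ?_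
      rw [← exp_add, ← exp_zero, exp_le_exp]
      push_cast
      linarith
    obtain ⟨s, hs, c, hc⟩ := hm.exists_mul _ h1
    rw [IsLocalRing.notMem_maximalIdeal] at hs
    obtain ⟨u, rfl⟩ := hs
    refine ⟨↑u⁻¹ * c, ?_⟩
    rw [map_mul, hc, ← mul_assoc, ← map_mul, Units.inv_mul, map_one, one_mul]

end LocalCondition

end Points

end

/-! ### The rings of a quotient of an integral scheme -/

noncomputable section

theorem IsQuotient.isAffineOpen_preimage {G : Type v} [Group G] {X Y : Scheme.{u}} {φ : G →* Aut X}
    {π : X ⟶ Y} (hπ : IsQuotient φ π) (U : NAffine Y) : IsAffineOpen (π ⁻¹ᵁ U.opens) :=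
  have := hπ.isAffineHom
  U.isAffine.preimage π

theorem IsQuotient.preimage_le {G : Type v} [Group G] {X Y : Scheme.{u}} {φ : G →* Aut X}
    {π : X ⟶ Y} (hπ : IsQuotient φ π) (g : G) (U : Y.Opens) :
    π ⁻¹ᵁ U ≤ (act φ g).hom ⁻¹ᵁ π ⁻¹ᵁ U := by
  rw [← Scheme.Hom.comp_preimage, hπ.invariant g]

/-- A group element that acts trivially modulo the prime ideal of `x` lies in the inertia group
of `x`. -/
theorem IsQuotient.mem_inertia {G : Type v} [Group G] {X Y : Scheme.{u}} {φ : G →* Aut X}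
    {π : X ⟶ Y} (hπ : IsQuotient φ π) (U : NAffine Y) {x : X} (hx : x ∈ π ⁻¹ᵁ U.opens) {g : G}
    (h : ∀ b : Γ(X, π ⁻¹ᵁ U.opens), ((act φ g).hom.appLE _ _ (hπ.preimage_le g U.opens)).hom b - b ∈
      pointIdeal (π ⁻¹ᵁ U.opens) x hx) : g ∈ inertia φ x := by
  change X.fromSpecResidueField x ≫ (act φ g).hom = X.fromSpecResidueField x
  set a := X.fromSpecResidueField x with ha
  set k := (act φ g).hom
  set W := π ⁻¹ᵁ U.opens
  have hW : IsAffineOpen W := hπ.isAffineOpen_preimage U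
  have hax (p : Spec (X.residueField x)) : a p = x := Scheme.fromSpecResidueField_apply x p
  have ia : ⊤ ≤ a ⁻¹ᵁ W := fun p _ => by
    change a p ∈ W
    rwa [hax]
  have ik : W ≤ k ⁻¹ᵁ W := hπ.preimage_le g U.opens
  have hzero (d : Γ(X, W)) (hd : d ∈ pointIdeal W x hx) : (a.appLE W ⊤ ia).hom d = 0 := by
    apply eq_zero_of_basicOpen_eq_bot
    refine (Scheme.basicOpen_appLE a ⊤ W ia d).trans (eq_bot_iff.2 fun p hp => ?_)
    have hp' : a p ∈ X.basicOpen d := hp.2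
    rw [hax] at hp'
    exact (mem_pointIdeal_iff.1 hd hp').elim
  have happ : (a ≫ k).appLE W ⊤ (ia.trans fun p hp => ik hp) = a.appLE W ⊤ ia := by
    rw [← Scheme.Hom.appLE_comp_appLE a k W W ⊤ ik ia]
    ext b
    have := hzero _ (h b)
    rwa [map_sub, sub_eq_zero] at this
  have h1 := IsAffineOpen.SpecMap_appLE_fromSpec a hW (isAffineOpen_top _) ia
  have h2 := IsAffineOpen.SpecMap_appLE_fromSpec (a ≫ k) hW (isAffineOpen_top _)
    (ia.trans fun p hp => ik hp)
  rw [happ, h1] at h2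
  exact ((cancel_epi _).1 h2).symm

section Quotient

variable {G : Type v} [Group G] {X Y : Scheme.{u}} [IsIntegral X] [IsIntegral Y] {φ : G →* Aut X}
  {π : X ⟶ Y} [IsDominant π]

instance (U : NAffine Y) : IsFractionRing Γ(Y, U.opens) Y.functionField :=
  functionField_isFractionRing_of_isAffineOpen Y U.opens U.isAffine

/-- The function field of `X`, with the action of `G` and the structure of an algebra over the
function field of the quotient. -/
def GalField (_hπ : IsQuotient φ π) : Type u := X.functionField

/-- The ring of sections of `π_* O_X` over `U`, with the action of `G` and the structure of an
algebra over the ring of sections of `O_Y`. -/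
def SecRing (_hπ : IsQuotient φ π) (U : NAffine Y) : Type u := Γ(X, π ⁻¹ᵁ U.opens)

variable (hπ : IsQuotient φ π) (U : NAffine Y)

instance : Field (GalField hπ) := inferInstanceAs (Field X.functionField)

instance : Algebra Y.functionField (GalField hπ) :=
  inferInstanceAs (Algebra Y.functionField (ExtField π))

instance : Algebra Γ(Y, U.opens) (GalField hπ) :=
  inferInstanceAs (Algebra Γ(Y, U.opens) (ExtField π))

instance : IsScalarTower Γ(Y, U.opens) Y.functionField (GalField hπ) :=
  inferInstanceAs (IsScalarTower Γ(Y, U.opens) Y.functionField (ExtField π))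

instance : MulSemiringAction G (GalField hπ) where
  smul g z := galMap φ g z
  one_smul := galMap_one φ
  mul_smul := galMap_mul φ
  smul_zero g := map_zero (galMap φ g)
  smul_add g := map_add (galMap φ g)
  smul_one g := map_one (galMap φ g)
  smul_mul g := map_mul (galMap φ g)

instance : SMulCommClass G Y.functionField (GalField hπ) where
  smul_comm g c z := by
    have h : galMap φ g (ffMap π c) = ffMap π c :=
      (ffMap_comp _ _ c).symm.trans (ffMap_congr (hπ.invariant g⁻¹) c)
    exact (map_mul (galMap φ g) _ _).trans (congrArg (· * galMap φ g z) h)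

instance : CommRing (SecRing hπ U) := inferInstanceAs (CommRing Γ(X, π ⁻¹ᵁ U.opens))

instance : Algebra Γ(Y, U.opens) (SecRing hπ U) := (π.app U.opens).hom.toAlgebra

instance : Algebra (SecRing hπ U) (GalField hπ) :=
  have := hπ.nonempty_preimage U.opens
  inferInstanceAs (Algebra Γ(X, π ⁻¹ᵁ U.opens) X.functionField)

instance : IsScalarTower Γ(Y, U.opens) (SecRing hπ U) (GalField hπ) :=
  IsScalarTower.of_algebraMap_eq fun a => by
    have := hπ.nonempty_preimage U.opens
    have h := ffMap_appLE π U.opens (π ⁻¹ᵁ U.opens) le_rfl a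
    rw [Scheme.Hom.appLE_eq_app] at h
    exact h

instance : IsFractionRing (SecRing hπ U) (GalField hπ) :=
  have := hπ.nonempty_preimage U.opens
  functionField_isFractionRing_of_isAffineOpen X _ (hπ.isAffineOpen_preimage U)

instance : IsDomain (SecRing hπ U) :=
  (IsFractionRing.injective (SecRing hπ U) (GalField hπ)).isDomain _

instance : SMul G (SecRing hπ U) where
  smul g b := ((act φ g⁻¹).hom.appLE _ _ (hπ.preimage_le g⁻¹ U.opens)).hom b

theorem secRing_algebraMap_smul (g : G) (b : SecRing hπ U) :
    algebraMap (SecRing hπ U) (GalField hπ) (g • b) = g • algebraMap _ (GalField hπ) b := by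
  have := hπ.nonempty_preimage U.opens
  exact (ffMap_appLE (act φ g⁻¹).hom (π ⁻¹ᵁ U.opens) (π ⁻¹ᵁ U.opens)
    (hπ.preimage_le g⁻¹ U.opens) b).symm

instance : MulSemiringAction G (SecRing hπ U) where
  one_smul b := IsFractionRing.injective _ (GalField hπ) <| by
    rw [secRing_algebraMap_smul, one_smul]
  mul_smul g h b := IsFractionRing.injective _ (GalField hπ) <| by
    simp only [secRing_algebraMap_smul, mul_smul]
  smul_zero g := map_zero ((act φ g⁻¹).hom.appLE _ _ (hπ.preimage_le g⁻¹ U.opens)).hom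
  smul_add g := map_add ((act φ g⁻¹).hom.appLE _ _ (hπ.preimage_le g⁻¹ U.opens)).hom
  smul_one g := map_one ((act φ g⁻¹).hom.appLE _ _ (hπ.preimage_le g⁻¹ U.opens)).hom
  smul_mul g := map_mul ((act φ g⁻¹).hom.appLE _ _ (hπ.preimage_le g⁻¹ U.opens)).hom

instance : SMulDistribClass G (SecRing hπ U) (GalField hπ) where
  smul_distrib_smul g b z := by
    rw [Algebra.smul_def, Algebra.smul_def, smul_mul', secRing_algebraMap_smul]

instance : SMulCommClass G Γ(Y, U.opens) (SecRing hπ U) where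
  smul_comm g a b := IsFractionRing.injective _ (GalField hπ) <| by
    rw [secRing_algebraMap_smul, Algebra.smul_def, Algebra.smul_def, map_mul, map_mul,
      ← IsScalarTower.algebraMap_apply, secRing_algebraMap_smul, smul_mul',
      IsScalarTower.algebraMap_apply Γ(Y, U.opens) Y.functionField (GalField hπ), smul_algebraMap]

instance : Algebra.IsInvariant Γ(Y, U.opens) (SecRing hπ U) G where
  isInvariant b hb := hπ.surjective U.opens b fun g _ => by
    have h := hb g⁻¹
    change ((act φ g⁻¹⁻¹).hom.appLE _ _ _).hom b = b at h
    simpa only [inv_inv] using h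

instance [IsLocallyNoetherian X] : IsNoetherianRing (SecRing hπ U) :=
  IsLocallyNoetherian.component_noetherian ⟨_, hπ.isAffineOpen_preimage U⟩

instance [Flat π] : Module.Flat Γ(Y, U.opens) (SecRing hπ U) := by
  have h := π.flat_appLE U.isAffine (hπ.isAffineOpen_preimage U) le_rfl
  rw [Scheme.Hom.appLE_eq_app] at h
  exact h

/-- The prime ideal of the ring of sections of `π_* O_X` over `U` given by a point `x` over `U`. -/
def secIdeal {x : X} (hx : x ∈ π ⁻¹ᵁ U.opens) : Ideal (SecRing hπ U) :=
  pointIdeal (π ⁻¹ᵁ U.opens) x hx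

theorem inertia_secIdeal_le {x : X} (hx : x ∈ π ⁻¹ᵁ U.opens) :
    (secIdeal hπ U hx).inertia G ≤ inertia φ x := fun g hg => by
  rw [← inv_mem_iff]
  exact hπ.mem_inertia U hx hg

/-- `G` acts faithfully on the function field of `X`, the local rings of `X` are regular, and the
inertia groups are of odd order, prime to the residue characteristic. -/
structure IsRegularTameAction (φ : G →* Aut X) : Prop where
  faithful : ∀ g : G, (∀ z, galMap φ g z = z) → g = 1
  regular : ∀ x : X, IsRegularLocalRing (X.presheaf.stalk x)
  card_inertia_ne_zero : ∀ x : X, ((Nat.card (inertia φ x) : ℕ) : X.residueField x) ≠ 0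
  odd_card_inertia : ∀ x : X, Odd (Nat.card (inertia φ x))

theorem IsRegularTameAction.isRegularTame [Finite G] (h : IsRegularTameAction φ) :
    IsRegularTame G (SecRing hπ U) where
  regular P hP := by
    obtain ⟨x, hx, rfl⟩ := exists_pointIdeal_eq (hπ.isAffineOpen_preimage U) P (hP := hP)
    exact isRegularLocalRing_pointIdeal (hπ.isAffineOpen_preimage U) x hx (h.regular x)
  card_inertia_notMem P hP hmem := by
    obtain ⟨x, hx, rfl⟩ := exists_pointIdeal_eq (hπ.isAffineOpen_preimage U) P (hP := hP)
    obtain ⟨n, hn⟩ := Subgroup.card_dvd_of_le (inertia_secIdeal_le hπ U hx)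
    refine h.card_inertia_ne_zero x ?_
    have h1 : (X.presheaf.germ (π ⁻¹ᵁ U.opens) x hx).hom
        (Nat.card ((secIdeal hπ U hx).inertia G) : SecRing hπ U) ∈
          IsLocalRing.maximalIdeal (X.presheaf.stalk x) := hmem
    have h2 : (X.presheaf.germ (π ⁻¹ᵁ U.opens) x hx).hom
        (Nat.card ((secIdeal hπ U hx).inertia G) : SecRing hπ U) =
          (Nat.card ((secIdeal hπ U hx).inertia G) : X.presheaf.stalk x) := map_natCast _ _
    rw [h2, ← IsLocalRing.residue_eq_zero_iff, map_natCast] at h1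
    rw [hn, Nat.cast_mul]
    exact mul_eq_zero_of_left h1 _
  odd_card_inertia P hP := by
    obtain ⟨x, hx, rfl⟩ := exists_pointIdeal_eq (hπ.isAffineOpen_preimage U) P (hP := hP)
    exact (h.odd_card_inertia x).of_dvd_nat (Subgroup.card_dvd_of_le (inertia_secIdeal_le hπ U hx))

theorem exists_nAffine {Y : Scheme.{u}} {W : Y.Opens} {y : Y} (hy : y ∈ W) :
    ∃ U : NAffine Y, y ∈ U.opens ∧ U.opens ≤ W := by
  obtain ⟨_, ⟨U, hU, rfl⟩, hyU, hUW⟩ := Y.isBasis_affineOpens.exists_subset_of_mem_open hy W.isOpen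
  exact ⟨⟨U, hU, ⟨⟨y, hyU⟩⟩⟩, hyU, hUW⟩

/-- If the inertia group of the generic point is trivial, `G` acts faithfully on the function
field. -/
theorem eq_one_of_galMap_eq (hπ : IsQuotient φ π) (hfree : inertia φ (genericPoint X) = ⊥) {g : G}
    (hg : ∀ z, galMap φ g z = z) : g = 1 := by
  obtain ⟨U, hU, -⟩ := exists_nAffine (W := ⊤) (y := π (genericPoint X)) trivial
  rw [← Subgroup.mem_bot, ← hfree]
  refine inertia_secIdeal_le hπ U hU fun b => ?_
  have h : g • b = b := IsFractionRing.injective _ (GalField hπ) <| by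
    rw [secRing_algebraMap_smul]
    exact hg _
  rw [h, sub_self]
  exact zero_mem _

theorem IsRegularTameAction.faithfulSMul (hφ : IsRegularTameAction φ) :
    FaithfulSMul G (SecRing hπ U) := by
  refine ⟨fun {g h} hgh => ?_⟩
  rw [eq_comm, ← inv_mul_eq_one]
  refine hφ.faithful _ fun (z : GalField hπ) => ?_
  change (h⁻¹ * g) • z = z
  obtain ⟨a, b, -, hz⟩ := IsFractionRing.div_surjective (A := SecRing hπ U) z
  have h1 (c : SecRing hπ U) : (h⁻¹ * g) • algebraMap _ (GalField hπ) c = algebraMap _ _ c := by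
    rw [← secRing_algebraMap_smul, mul_smul, hgh, inv_smul_smul]
  rw [← hz, div_eq_mul_inv, smul_mul', smul_inv'', h1, h1]

theorem isGaloisGroup_galField [Finite G] (hfaith : ∀ g : G, (∀ z, galMap φ g z = z) → g = 1) :
    IsGaloisGroup G Y.functionField (GalField hπ) where
  faithful := ⟨fun {g h} hgh => by
    rw [eq_comm, ← inv_mul_eq_one]
    refine hfaith _ fun (z : GalField hπ) => ?_
    change (h⁻¹ * g) • z = z
    rw [mul_smul, hgh, inv_smul_smul]⟩
  commutes := inferInstance
  isInvariant := by
    obtain ⟨U, -, -⟩ := exists_nAffine (W := ⊤) (y := genericPoint Y) trivial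
    exact IsFractionRing.isInvariant G Γ(Y, U.opens) (SecRing hπ U) _ _

end Quotient

end

/-! ### Comparison of the square roots of the codifferent -/

section Denominators

open WithZero

variable (A : Type*) {B : Type*} (K : Type*) {L : Type*} [CommRing A] [CommRing B] [Algebra A B]
  [Field K] [Field L] [Algebra A K] [Algebra B L] [Algebra K L] [IsDomain B] [IsFractionRing B L]
  [IsNoetherianRing B]

/-- An element that satisfies the condition at the primes not containing `b` lies in the square root
of the codifferent after multiplication by a power of `b`: only finitely many primes of height one
contain `b`. -/
theorem exists_pow_mul_mem_ringSqrtCodiff {b : B} (hb : b ≠ 0) {z : L}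
    (hz : ∀ (P : Ideal B) (v : Valuation L ℤᵐ⁰) (e : ℕ), IsRamVal A K P v e → b ∉ P →
      v z ≤ exp (((e - 1) / 2 : ℕ) : ℤ)) :
    ∃ n : ℕ, algebraMap B L b ^ n * z ∈ ringSqrtCodiff A B K L := by
  classical
  have hfin := Ideal.finite_minimalPrimes_of_isNoetherianRing B (Ideal.span {b})
  have hex (P : Ideal B) : ∃ n : ℕ, ∀ (v : Valuation L ℤᵐ⁰) (e : ℕ), IsRamVal A K P v e →
      v z ≤ exp (n : ℤ) := by
    by_cases h : ∃ v : Valuation L ℤᵐ⁰, IsPrimeVal P v 1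
    · obtain ⟨v, hv⟩ := h
      by_cases hz0 : z = 0
      · exact ⟨0, fun w e _ => by rw [hz0, map_zero]; exact zero_le⟩
      refine ⟨(log (v z)).toNat, fun w e hw => ?_⟩
      rw [hw.left.unique hv, ← exp_log ((Valuation.ne_zero_iff v).2 hz0), exp_le_exp]
      exact Int.self_le_toNat _
    · exact ⟨0, fun v e hv => (h ⟨v, hv.left⟩).elim⟩
  choose n hn using hex
  refine ⟨∑ P ∈ hfin.toFinset, n P, fun P v e h => ?_⟩
  have hP := h.left.isPrime
  have hpow (k : ℕ) : v (algebraMap B L b ^ k) ≤ 1 := by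
    rw [map_pow]
    exact pow_le_one' (h.left.le_one b) k
  rw [map_mul]
  by_cases hbP : b ∈ P
  · have hmin : P ∈ (Ideal.span {b}).minimalPrimes := by
      refine ⟨⟨hP, (Ideal.span_singleton_le_iff_mem _).2 hbP⟩, fun Q ⟨hQ, hbQ⟩ hQP => ?_⟩
      refine (eq_of_le_of_height_eq_one (fun h0 => hb ?_) hQP h.left.height_eq_one).ge
      rwa [h0, Ideal.span_singleton_le_iff_mem, Ideal.mem_bot] at hbQ
    rw [← Finset.add_sum_erase _ _ (hfin.mem_toFinset.2 hmin), pow_add, map_mul, mul_right_comm]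
    refine (mul_le_of_le_one_right' (hpow _)).trans ?_
    have h1 := h.left.le_exp_of_mem_pow (Ideal.pow_mem_pow hbP (n P))
    rw [map_pow] at h1
    refine (mul_le_mul' h1 (hn P v e h)).trans ?_
    rw [← exp_add, exp_le_exp]
    simp only [Nat.cast_one, mul_one, neg_add_cancel]
    exact Int.natCast_nonneg _
  · exact (mul_le_of_le_one_left' (hpow _)).trans (hz P v e h hbP)

end Denominators

noncomputable section

section Push

open WithZero

variable {G : Type v} [Group G] {X Y : Scheme.{u}} [IsIntegral X] [IsIntegral Y] {φ : G →* Aut X}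
  {π : X ⟶ Y} [IsDominant π] (hπ : IsQuotient φ π) (U : NAffine Y)

theorem isRamVal_secIdeal_iff {x : X} (hx : x ∈ π ⁻¹ᵁ U.opens)
    {v : Valuation X.functionField ℤᵐ⁰} {e : ℕ} :
    IsRamVal (L := GalField hπ) Γ(Y, U.opens) Y.functionField (secIdeal hπ U hx) v e ↔
      IsPrimeVal (IsLocalRing.maximalIdeal (X.presheaf.stalk x)) v 1 ∧
      IsPrimeVal (IsLocalRing.maximalIdeal (Y.presheaf.stalk (π x))) (v.comap (ffMap π)) e := by
  have := hπ.nonempty_preimage U.opens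
  have h := pointIdeal_comap_appLE π U.opens (π ⁻¹ᵁ U.opens) le_rfl x hx
  rw [Scheme.Hom.appLE_eq_app] at h
  rw [isPrimeVal_stalk_iff (hπ.isAffineOpen_preimage U) hx, isPrimeVal_stalk_iff U.isAffine hx, ← h]
  exact ⟨fun h => ⟨h.left, h.right⟩, fun h => ⟨h.1, h.2⟩⟩

variable [Fintype G] [IsLocallyNoetherian X]

/-- The condition that defines the square root of the codifferent at a point `x`, in terms of the
valuation at the prime ideal of `x`. -/
theorem IsRegularTameAction.forall_mem_pow_iff (hφ : IsRegularTameAction φ) {x : X}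
    (hx : x ∈ π ⁻¹ᵁ U.opens) (z : X.functionField) :
    (ringKrullDim (X.presheaf.stalk x) = 1 →
      ∀ a ∈ IsLocalRing.maximalIdeal (X.presheaf.stalk x) ^ ((ramIdx π x - 1) / 2),
        ∃ b : X.presheaf.stalk x, algebraMap _ X.functionField b = algebraMap _ _ a * z) ↔
    ∀ (v : Valuation X.functionField ℤᵐ⁰) (e : ℕ),
      IsRamVal (L := GalField hπ) Γ(Y, U.opens) Y.functionField (secIdeal hπ U hx) v e →
        v z ≤ exp (((e - 1) / 2 : ℕ) : ℤ) := by
  constructor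
  · intro h v e hv
    rw [isRamVal_secIdeal_iff] at hv
    have h1 := (FrohlichTwist.forall_mem_pow_iff hv.1 hv.2 z).1 (h hv.1.ringKrullDim_eq_one)
    simpa using h1
  · intro h hd
    have hht : (secIdeal hπ U hx).height = 1 := by
      have h1 := height_pointIdeal (hπ.isAffineOpen_preimage U) x hx
      rw [hd] at h1
      exact_mod_cast h1
    have : (secIdeal hπ U hx).IsPrime := inferInstanceAs (pointIdeal _ x hx).IsPrime
    have := hφ.faithfulSMul hπ U
    obtain ⟨v, e, hv⟩ := exists_isRamVal (L := GalField hπ) Γ(Y, U.opens) Y.functionField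
      (hφ.isRegularTame hπ U) (secIdeal hπ U hx) hht
    have h1 : v z ≤ exp (((e - 1) / 2 : ℕ) : ℤ) := h v e hv
    obtain ⟨hv1, hv2⟩ := (isRamVal_secIdeal_iff hπ U hx (v := v)).1 hv
    refine (FrohlichTwist.forall_mem_pow_iff hv1 hv2 z).2 ?_
    rw [Nat.div_one, mul_one]
    exact h1

/-- The sections of `π_* D_{X/Y}^{-1/2}` over `U`, described in terms of rings. -/
theorem mem_pushSqrtCodiff_iff (hφ : IsRegularTameAction φ) (z : X.functionField) :
    z ∈ pushSqrtCodiff π U ↔ (show GalField hπ from z) ∈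
      ringSqrtCodiff Γ(Y, U.opens) (SecRing hπ U) Y.functionField (GalField hπ) := by
  constructor
  · intro h P v e hv
    have hP := hv.left.isPrime
    obtain ⟨x, hx, rfl⟩ := exists_pointIdeal_eq (hπ.isAffineOpen_preimage U) P (hP := hP)
    exact (hφ.forall_mem_pow_iff hπ U hx z).1 (h x hx) v e hv
  · intro h x hx
    exact (hφ.forall_mem_pow_iff hπ U hx z).2 fun v e => h _ v e

/-- The sheaf `π_* D_{X/Y}^{-1/2}` is quasi-coherent. -/
theorem exists_pow_mul_mem_pushSqrtCodiff (hπ : IsQuotient φ π) (hφ : IsRegularTameAction φ)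
    {U W : NAffine Y}
    (f : Γ(Y, U.opens)) (hW : W.opens = Y.basicOpen f) {z : ExtField π}
    (hz : z ∈ pushSqrtCodiff π W) :
    ∃ n : ℕ, algebraMap Γ(Y, U.opens) (ExtField π) f ^ n * z ∈ pushSqrtCodiff π U := by
  have hf : f ≠ 0 := by
    rintro rfl
    obtain ⟨y, hy⟩ := W.nonempty
    rw [hW, Scheme.basicOpen_zero] at hy
    exact hy
  have hb : algebraMap Γ(Y, U.opens) (SecRing hπ U) f ≠ 0 := fun h =>
    hf (hπ.injective U.opens (h.trans (map_zero _).symm))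
  obtain ⟨n, hn⟩ := exists_pow_mul_mem_ringSqrtCodiff Γ(Y, U.opens) Y.functionField
    (L := GalField hπ) hb (z := z) fun P v e hv hfP => by
      have hP := hv.left.isPrime
      obtain ⟨x, hx, rfl⟩ := exists_pointIdeal_eq (hπ.isAffineOpen_preimage U) P (hP := hP)
      have hxW : x ∈ π ⁻¹ᵁ W.opens := by
        change π x ∈ W.opens
        by_contra hx'
        rw [hW, ← mem_pointIdeal_iff (x := π x) (hx := hx),
          ← pointIdeal_comap_appLE π U.opens _ le_rfl x hx, Scheme.Hom.appLE_eq_app] at hx'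
        exact hfP hx'
      exact (hφ.forall_mem_pow_iff hπ U hx z).1 (hz x hxW) v e hv
  refine ⟨n, (mem_pushSqrtCodiff_iff hπ U hφ _).2 ?_⟩
  rw [← IsScalarTower.algebraMap_apply] at hn
  exact hn

end Push

end

noncomputable section

/-! ### Local freeness -/

section LocallyFree

/-- Freeness of a localized module does not depend on the choice of the localizations. -/
theorem free_of_isLocalizedModule {R : Type*} [CommRing R] (S : Submonoid R) {N : Type*}
    [AddCommGroup N] [Module R N] [Module.Free (Localization S) (LocalizedModule S N)]
    (R' : Type*) {N' : Type*} [CommRing R'] [Algebra R R'] [IsLocalization S R'] [AddCommGroup N']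
    [Module R N'] [Module R' N'] [IsScalarTower R R' N'] (f : N →ₗ[R] N') [IsLocalizedModule S f] :
    Module.Free R' N' := by
  let e : Localization S ≃ₐ[R] R' := IsLocalization.algEquiv S _ _
  let _ : Module (Localization S) N' := Module.compHom N' (e : Localization S →+* R')
  have hsmul (c : Localization S) (x : N') : c • x = e c • x := rfl
  have : IsScalarTower R (Localization S) N' := ⟨fun r c x => by
    rw [hsmul, hsmul, map_smul, smul_assoc]⟩
  have e' : LocalizedModule S N ≃ₗ[Localization S] N' :=
    LinearEquiv.extendScalarsOfIsLocalizationEquiv S (Localization S) (IsLocalizedModule.iso S f)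
  have : Module.Free (Localization S) N' := Module.Free.of_equiv e'
  exact Module.Free.of_basis
    ((Module.Free.chooseBasis (Localization S) N').mapCoeffs e.toRingEquiv fun _ _ => rfl)

variable {Y : Scheme.{u}} [IsIntegral Y]

/-- A quasi-coherent module whose sections over affine open subschemes form finite projective
modules is locally free of finite rank. -/
theorem PairedModule.exists_free (M : PairedModule.{u, w} Y)
    (hinj : ∀ {U W : NAffine Y} (f : Γ(Y, U.opens)) (hW : W.opens = Y.basicOpen f)
      (x : M.sec U), M.res (hW ▸ Y.basicOpen_le f) x = 0 → ∃ n : ℕ, f ^ n • x = 0)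
    (hsurj : ∀ {U W : NAffine Y} (f : Γ(Y, U.opens)) (hW : W.opens = Y.basicOpen f)
      (y : M.sec W), ∃ (n : ℕ) (x : M.sec U),
        M.res (hW ▸ Y.basicOpen_le f) x =
          (Y.presheaf.map (homOfLE (hW ▸ Y.basicOpen_le f : W.opens ≤ U.opens)).op).hom f ^ n • y)
    (hfin : ∀ U, Module.Finite Γ(Y, U.opens) (M.sec U))
    (hproj : ∀ U, Module.Projective Γ(Y, U.opens) (M.sec U)) (y : Y) :
    ∃ U : NAffine Y, y ∈ U.opens ∧
      Module.Free Γ(Y, U.opens) (M.sec U) ∧ Module.Finite Γ(Y, U.opens) (M.sec U) := by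
  obtain ⟨U, hyU, -⟩ := exists_nAffine (W := ⊤) (y := y) trivial
  have := hfin U
  have := hproj U
  have : Module.FinitePresentation Γ(Y, U.opens) (M.sec U) :=
    Module.finitePresentation_of_projective _ _
  set p := pointIdeal U.opens y hyU
  have hfree : Module.Free (Localization.AtPrime p) (LocalizedModule p.primeCompl (M.sec U)) :=
    Module.free_of_flat_of_isLocalRing
  obtain ⟨r, hr, hr', -⟩ := Module.FinitePresentation.exists_free_localizedModule_powers
    p.primeCompl (LocalizedModule.mkLinearMap p.primeCompl (M.sec U)) (Localization.AtPrime p)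
  have hyr : y ∈ Y.basicOpen r := by
    by_contra h
    exact hr (mem_pointIdeal_iff.2 h)
  obtain ⟨W, hW⟩ : ∃ W : NAffine Y, W.opens = Y.basicOpen r :=
    ⟨⟨Y.basicOpen r, U.isAffine.basicOpen r, ⟨⟨y, hyr⟩⟩⟩, rfl⟩
  have hle : W.opens ≤ U.opens := hW ▸ Y.basicOpen_le r
  refine ⟨W, hW ▸ hyr, ?_, hfin W⟩
  let ρ := (Y.presheaf.map (homOfLE hle).op).hom
  let _ : Algebra Γ(Y, U.opens) Γ(Y, W.opens) := ρ.toAlgebra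
  let _ : Module Γ(Y, U.opens) (M.sec W) := Module.compHom _ ρ
  have : IsScalarTower Γ(Y, U.opens) Γ(Y, W.opens) (M.sec W) := ⟨fun a b x => mul_smul (ρ a) b x⟩
  have hloc : IsLocalization (Submonoid.powers r) Γ(Y, W.opens) :=
    U.isAffine.isLocalization_of_eq_basicOpen r (homOfLE hle) hW
  let f : M.sec U →ₗ[Γ(Y, U.opens)] M.sec W :=
    { toFun := M.res hle
      map_add' := map_add _
      map_smul' := fun a x => map_smulₛₗ (M.res hle) a x }
  have : IsLocalizedModule (Submonoid.powers r) f := by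
    refine ⟨fun s => ?_, fun x => ?_, fun {x x'} h => ?_⟩
    · have hu : IsUnit (ρ s) := IsLocalization.map_units Γ(Y, W.opens) s
      rw [Module.End.isUnit_iff]
      exact hu.smul_bijective
    · obtain ⟨n, x', hx'⟩ := hsurj r (W := W) hW x
      refine ⟨⟨x', ⟨r ^ n, n, rfl⟩⟩, ?_⟩
      refine Eq.trans ?_ hx'.symm
      rw [← map_pow]
      rfl
    · obtain ⟨n, hn⟩ := hinj r (W := W) hW (x - x') (by
        rw [map_sub, sub_eq_zero]
        exact h)
      exact ⟨⟨r ^ n, n, rfl⟩, by rwa [smul_sub, sub_eq_zero] at hn⟩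
  exact free_of_isLocalizedModule (Submonoid.powers r) Γ(Y, W.opens) f

end LocallyFree

/-! ### The bundle of `H`-invariants -/

/-- The rational functions on `X` that are invariant under the group are those of the quotient. -/
theorem exists_ffMap_eq {G : Type v} [Group G] [Finite G] {X Y : Scheme.{u}} [IsIntegral X]
    [IsIntegral Y] {φ : G →* Aut X} {π : X ⟶ Y} [IsDominant π] (hπ : IsQuotient φ π)
    {z : X.functionField} (hz : ∀ g, galMap φ g z = z) : ∃ w, ffMap π w = z := by
  obtain ⟨U, -, -⟩ := exists_nAffine (W := ⊤) (y := genericPoint Y) trivial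
  have := IsFractionRing.isInvariant G Γ(Y, U.opens) (SecRing hπ U) Y.functionField (GalField hπ)
  exact Algebra.IsInvariant.isInvariant (A := Y.functionField) (B := GalField hπ) (G := G) z hz

namespace QuotientTower

variable {G : Type v} [Group G] {H : Subgroup G} (T : QuotientTower.{u} H)

theorem exists_ffMap_lam_eq [Finite G] {z : T.X.functionField}
    (hz : ∀ h ∈ H, galMap T.φ h z = z) : ∃ w, ffMap T.lam w = z :=
  exists_ffMap_eq T.quotientH fun h => hz h h.2

variable [Fintype G]

/-- The trace `Tr_{V/Y}` of a trace `Tr_{X/V}`, expressed as a sum over `H`, is `Tr_{X/Y}`. -/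
theorem traceVY_sum [Fintype H] (hfaith : ∀ g : G, (∀ z, galMap T.φ g z = z) → g = 1)
    (m : GalField T.quotientG) :
    T.traceVY (∑ h : H, (h : G) • m) =
      Algebra.trace T.Y.functionField (GalField T.quotientG) m := by
  have := isGaloisGroup_galField T.quotientG hfaith
  have := isGaloisGroup_galField T.quotientH fun h hh => Subtype.ext (hfaith h hh)
  have h1 : ffMap T.lam (Algebra.trace T.V.functionField (GalField T.quotientH) m) =
      ∑ h : H, (h : G) • m :=
    algebraMap_trace_eq_sum_smul H T.V.functionField (L := GalField T.quotientH) m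
  have h2 : Function.invFun (ffMap T.lam) (∑ h : H, (h : G) • m) =
      Algebra.trace T.V.functionField (GalField T.quotientH) m := by
    refine (congrArg _ h1.symm).trans ?_
    exact Function.leftInverse_invFun (ffMap T.lam).injective _
  refine (congrArg (fieldTrace T.gam) h2).trans ?_
  let _ : Algebra (ExtField T.gam) (GalField T.quotientG) := (ffMap T.lam).toAlgebra
  have : IsScalarTower T.Y.functionField (ExtField T.gam) (GalField T.quotientG) :=
    IsScalarTower.of_algebraMap_eq fun c => ffMap_comp T.lam T.gam c
  have := IsGaloisGroup.finiteDimensional G T.Y.functionField (GalField T.quotientG)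
  have : FiniteDimensional T.Y.functionField (ExtField T.gam) :=
    FiniteDimensional.left T.Y.functionField (ExtField T.gam) (GalField T.quotientG)
  have : FiniteDimensional (ExtField T.gam) (GalField T.quotientG) :=
    FiniteDimensional.right T.Y.functionField (ExtField T.gam) (GalField T.quotientG)
  exact Algebra.trace_trace (R := T.Y.functionField) (S := ExtField T.gam) m

variable [IsLocallyNoetherian T.X] (hφ : IsRegularTameAction T.φ) (U : NAffine T.Y)

theorem mem_fixedSections_iff (hφ : IsRegularTameAction T.φ) (z : T.X.functionField) :
    z ∈ T.fixedSections U ↔ (show GalField T.quotientG from z) ∈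
      ringFixed Γ(T.Y, U.opens) (SecRing T.quotientG U) T.Y.functionField
        (GalField T.quotientG) H :=
  and_congr (mem_pushSqrtCodiff_iff T.quotientG U hφ z)
    ⟨fun h k => h k k.2, fun h k hk => h ⟨k, hk⟩⟩

/-- The sections of `(π_* D_{X/Y}^{-1/2})^H` over `U`, described in terms of rings. -/
def fixedEquiv (hφ : IsRegularTameAction T.φ) : T.fixedBundle.sec U ≃ₗ[Γ(T.Y, U.opens)]
    ringFixed Γ(T.Y, U.opens) (SecRing T.quotientG U) T.Y.functionField
      (GalField T.quotientG) H where
  toFun x := ⟨_, (T.mem_fixedSections_iff U hφ (T.fixedVal x)).1 x.2⟩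
  invFun x := ⟨_, (T.mem_fixedSections_iff U hφ x.1).2 x.2⟩
  map_add' _ _ := rfl
  map_smul' _ _ := rfl
  left_inv _ := rfl
  right_inv _ := rfl

/-- `(π_* D_{X/Y}^{-1/2})^H` with the form `Tr_{V/Y}` is a symmetric bundle. -/
theorem isSymmetricBundle_fixedBundle [Fintype H] [Flat T.pi] (hφ : IsRegularTameAction T.φ) :
    T.fixedBundle.IsSymmetricBundle := by
  have hgal := isGaloisGroup_galField T.quotientG hφ.faithful
  have hinj : ∀ {U W : NAffine T.Y} (f : Γ(T.Y, U.opens)) (hW : W.opens = T.Y.basicOpen f)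
      (x : T.fixedBundle.sec U), T.fixedBundle.res (hW ▸ T.Y.basicOpen_le f) x = 0 →
        ∃ n : ℕ, f ^ n • x = 0 := fun f hW x hx => by
    refine ⟨0, ?_⟩
    rw [pow_zero, one_smul]
    have h : T.fixedVal x = 0 := congrArg T.fixedVal hx
    exact Subtype.ext h
  have hsurj : ∀ {U W : NAffine T.Y} (f : Γ(T.Y, U.opens)) (hW : W.opens = T.Y.basicOpen f)
      (y : T.fixedBundle.sec W), ∃ (n : ℕ) (x : T.fixedBundle.sec U),
        T.fixedBundle.res (hW ▸ T.Y.basicOpen_le f) x =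
          (T.Y.presheaf.map (homOfLE (hW ▸ T.Y.basicOpen_le f : W.opens ≤ U.opens)).op).hom f ^ n •
            y := fun {U W} f hW y => by
    obtain ⟨n, hn⟩ := exists_pow_mul_mem_pushSqrtCodiff T.quotientG hφ f hW y.2.1
    have hle : W.opens ≤ U.opens := hW ▸ T.Y.basicOpen_le f
    set y' := (T.Y.presheaf.map (homOfLE hle).op).hom f ^ n • y with hy'
    have h1 : T.fixedVal y' = algebraMap Γ(T.Y, U.opens) (ExtField T.pi) f ^ n * y.1 := by
      rw [← algebraMap_map_extField T.pi hle, ← map_pow]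
      exact Algebra.smul_def (A := ExtField T.pi) _ _
    exact ⟨n, ⟨T.fixedVal y', by rw [h1]; exact hn, y'.2.2⟩, rfl⟩
  refine ⟨hinj, hsurj, T.fixedBundle.exists_free hinj hsurj (fun U => ?_) (fun U => ?_),
    fun U x => ?_, fun U x y => ?_, fun U x y => ?_, fun _ _ _ => rfl, fun U l => ?_⟩
  · have := hφ.faithfulSMul T.quotientG U
    have := finite_ringFixed (A := Γ(T.Y, U.opens)) (K := T.Y.functionField)
      (L := GalField T.quotientG) (H := H) (hφ.isRegularTame T.quotientG U)
    exact Module.Finite.equiv (T.fixedEquiv U hφ).symm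
  · have := hφ.faithfulSMul T.quotientG U
    have := projective_ringFixed (A := Γ(T.Y, U.opens)) (K := T.Y.functionField)
      (L := GalField T.quotientG) (H := H) (hφ.isRegularTame T.quotientG U)
    exact Module.Projective.of_equiv (T.fixedEquiv U hφ).symm
  · obtain ⟨b, hb⟩ := exists_sum_smul_eq_one_subgroup Γ(T.Y, U.opens) H
      (hφ.isRegularTame T.quotientG U)
    have h (y : T.fixedBundle.sec U) : T.fixedBundle.form U x y =
        Algebra.trace T.Y.functionField (GalField T.quotientG)
          (b • ((T.fixedEquiv U hφ x).1 * (T.fixedEquiv U hφ y).1)) :=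
      eq_trace_of_fixed (T.traceVY_sum hφ.faithful) hb fun h =>
        (smul_mul' h _ _).trans
          (congrArg₂ _ ((T.fixedEquiv U hφ x).2.2 h) ((T.fixedEquiv U hφ y).2.2 h))
    refine ⟨fun y z => ?_, fun a y => ?_⟩
    · rw [h, h, h, ← map_add, ← smul_add, ← mul_add, map_add]
      rfl
    · rw [h, h, ← LinearMap.map_smul_of_tower, smul_comm a b, ← mul_smul_comm a]
      rfl
  · exact congrArg T.traceVY (mul_comm _ _)
  · have := hφ.faithfulSMul T.quotientG U
    exact exists_algebraMap_eq_of_fixed (hφ.isRegularTame T.quotientG U) (T.traceVY_sum hφ.faithful)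
      (T.fixedEquiv U hφ x) (T.fixedEquiv U hφ y)
  · have := hφ.faithfulSMul T.quotientG U
    obtain ⟨x, hx, huniq⟩ := existsUnique_form_eq_of_fixed (hφ.isRegularTame T.quotientG U)
      (T.traceVY_sum hφ.faithful) (l ∘ₗ (T.fixedEquiv U hφ).symm.toLinearMap)
    exact ⟨(T.fixedEquiv U hφ).symm x, fun y => hx (T.fixedEquiv U hφ y), fun y hy =>
      ((T.fixedEquiv U hφ).symm_apply_eq.2
        (huniq (T.fixedEquiv U hφ y) fun m => hy ((T.fixedEquiv U hφ).symm m)).symm).symm⟩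

end QuotientTower

end

noncomputable section

/-! ### Invariants of a permutation module tensored with a representation -/

section Invariants

variable {R : Type u} [CommRing R] {G : Type v} [Group G] (H : Subgroup G) {M : Type w}
  [AddCommGroup M] [Module R M] (ρ : Representation R G M)

variable (R M) in
/-- The coefficient of an element of `R[G/H] ⊗ M` at a coset. -/
def cosetCoeff (q : G ⧸ H) : (G ⧸ H →₀ R) ⊗[R] M →ₗ[R] M :=
  TensorProduct.lift (LinearMap.lsmul R M ∘ₗ Finsupp.lapply q)

theorem cosetCoeff_tmul (q : G ⧸ H) (e : G ⧸ H →₀ R) (m : M) :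
    cosetCoeff R H M q (e ⊗ₜ m) = e q • m := rfl

variable {H} in
theorem cosetCoeff_ext {x y : (G ⧸ H →₀ R) ⊗[R] M}
    (h : ∀ q, cosetCoeff R H M q x = cosetCoeff R H M q y) : x = y := by
  classical
  have h1 (x : (G ⧸ H →₀ R) ⊗[R] M) (q : G ⧸ H) :
      TensorProduct.finsuppScalarLeft R M (G ⧸ H) x q = cosetCoeff R H M q x := by
    induction x with
    | zero => simp
    | add x y hx hy => rw [map_add, Finsupp.add_apply, hx, hy, map_add]
    | tmul e m => rw [TensorProduct.finsuppScalarLeft_apply_tmul_apply, cosetCoeff_tmul]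
  apply (TensorProduct.finsuppScalarLeft R M (G ⧸ H)).injective
  ext q
  rw [h1, h1, h]

theorem permRep_apply_smul (g : G) (e : G ⧸ H →₀ R) (q : G ⧸ H) :
    permRep R H g e (g • q) = e q :=
  Finsupp.mapDomain_apply (MulAction.injective g) e q

theorem cosetCoeff_tprod (g : G) (q : G ⧸ H) (x : (G ⧸ H →₀ R) ⊗[R] M) :
    cosetCoeff R H M (g • q) ((permRep R H).tprod ρ g x) = ρ g (cosetCoeff R H M q x) := by
  induction x with
  | zero => simp
  | add x y hx hy => rw [map_add, map_add, hx, hy, map_add, map_add]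
  | tmul e m =>
    rw [Representation.tprod_apply, TensorProduct.map_tmul, cosetCoeff_tmul, cosetCoeff_tmul,
      permRep_apply_smul, map_smul]

variable {H ρ}

/-- The coefficients of an invariant element are the conjugates of the coefficient at the coset
`H`. -/
theorem cosetCoeff_mk {x : (G ⧸ H →₀ R) ⊗[R] M} (hx : x ∈ ((permRep R H).tprod ρ).invariants)
    (g : G) : cosetCoeff R H M (g : G ⧸ H) x = ρ g (cosetCoeff R H M ((1 : G) : G ⧸ H) x) := by
  have h := cosetCoeff_tprod H ρ g ((1 : G) : G ⧸ H) x
  rw [hx g] at h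
  rw [← h, MulAction.Quotient.smul_coe, smul_eq_mul, mul_one]

theorem cosetCoeff_one_fixed {x : (G ⧸ H →₀ R) ⊗[R] M}
    (hx : x ∈ ((permRep R H).tprod ρ).invariants) {h : G} (hh : h ∈ H) :
    ρ h (cosetCoeff R H M ((1 : G) : G ⧸ H) x) = cosetCoeff R H M ((1 : G) : G ⧸ H) x := by
  have h1 : (h : G ⧸ H) = ((1 : G) : G ⧸ H) := QuotientGroup.eq.2 (by simpa using hh)
  rw [← cosetCoeff_mk hx, h1]

/-- An invariant element of `R[G/H] ⊗ M` is determined by its coefficient at the coset `H`. -/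
theorem eq_of_cosetCoeff_one_eq {x y : (G ⧸ H →₀ R) ⊗[R] M}
    (hx : x ∈ ((permRep R H).tprod ρ).invariants) (hy : y ∈ ((permRep R H).tprod ρ).invariants)
    (h : cosetCoeff R H M ((1 : G) : G ⧸ H) x = cosetCoeff R H M ((1 : G) : G ⧸ H) y) : x = y :=
  cosetCoeff_ext fun q => by
    obtain ⟨g, rfl⟩ := QuotientGroup.mk_surjective q
    rw [cosetCoeff_mk hx, cosetCoeff_mk hy, h]

variable {L : Type u} [AddCommGroup L] [Module R L] {b : LinearMap.BilinMap R M L}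

theorem tensorForm_tmul (q : LinearMap.BilinForm R (G ⧸ H →₀ R)) (e e' : G ⧸ H →₀ R) (m m' : M) :
    tensorForm q b (e ⊗ₜ m) (e' ⊗ₜ m') = q e e' • b m m' := by
  simp [tensorForm]

theorem standardForm_permRep (g : G) (e e' : G ⧸ H →₀ R) :
    standardForm R H (permRep R H g e) (permRep R H g e') = standardForm R H e e' := by
  change (Finsupp.mapDomain (g • ·) e').sum (fun a c => permRep R H g e a * c) =
    e'.sum fun a c => e a * c
  rw [Finsupp.sum_mapDomain_index (by simp) (by simp [mul_add])]
  exact Finsupp.sum_congr fun a _ => by rw [permRep_apply_smul]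

theorem tensorForm_tprod (hb : ∀ g m m', b (ρ g m) (ρ g m') = b m m') (g : G)
    (x y : (G ⧸ H →₀ R) ⊗[R] M) :
    tensorForm (standardForm R H) b ((permRep R H).tprod ρ g x) ((permRep R H).tprod ρ g y) =
      tensorForm (standardForm R H) b x y := by
  induction x with
  | zero => simp
  | add x x' hx hx' => simp only [map_add, LinearMap.add_apply, hx, hx']
  | tmul e m =>
    induction y with
    | zero => simp
    | add y y' hy hy' => simp only [map_add, hy, hy']
    | tmul e' m' =>
      simp only [Representation.tprod_apply, TensorProduct.map_tmul, tensorForm_tmul,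
        standardForm_permRep, hb]

theorem tensorForm_single (m : M) (y : (G ⧸ H →₀ R) ⊗[R] M) :
    tensorForm (standardForm R H) b (Finsupp.single ((1 : G) : G ⧸ H) 1 ⊗ₜ m) y =
      b m (cosetCoeff R H M ((1 : G) : G ⧸ H) y) := by
  classical
  induction y with
  | zero => simp
  | add y y' hy hy' => simp only [map_add, hy, hy']
  | tmul e' m' =>
    rw [tensorForm_tmul, cosetCoeff_tmul, map_smul]
    congr 1
    change (e'.sum fun a c => Finsupp.single ((1 : G) : G ⧸ H) (1 : R) a * c) = _
    simpa [Finsupp.sum, Finsupp.single_apply] using Eq.symm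

variable [Fintype G] [Fintype H]

theorem sum_mem_invariants {V : Type*} [AddCommGroup V] [Module R V] (r : Representation R G V)
    (x : V) : ∑ g, r g x ∈ r.invariants := fun k => by
  rw [map_sum]
  refine Fintype.sum_equiv (Equiv.mulLeft k) _ _ fun g => ?_
  rw [Equiv.coe_mulLeft, map_mul]
  rfl

theorem cosetCoeff_one_sum (m : M) : cosetCoeff R H M ((1 : G) : G ⧸ H)
    (∑ g, (permRep R H).tprod ρ g (Finsupp.single ((1 : G) : G ⧸ H) 1 ⊗ₜ m)) =
      ∑ h : H, ρ h m := by
  classical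
  have h1 (g : G) : cosetCoeff R H M ((1 : G) : G ⧸ H)
      ((permRep R H).tprod ρ g (Finsupp.single ((1 : G) : G ⧸ H) 1 ⊗ₜ m)) =
        if g ∈ H then ρ g m else 0 := by
    have h2 : permRep R H g (Finsupp.single ((1 : G) : G ⧸ H) 1) =
        Finsupp.single (g : G ⧸ H) 1 := by
      refine (Finsupp.mapDomain_single ..).trans ?_
      rw [MulAction.Quotient.smul_coe, smul_eq_mul, mul_one]
    rw [Representation.tprod_apply, TensorProduct.map_tmul, cosetCoeff_tmul, h2,
      Finsupp.single_apply]
    have h3 : (g : G ⧸ H) = ((1 : G) : G ⧸ H) ↔ g ∈ H := by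
      rw [QuotientGroup.eq]
      simp
    simp [h3]
  rw [map_sum, Finset.sum_congr rfl fun g _ => h1 g, ← Finset.sum_filter]
  exact (Finset.sum_subtype _ (by simp) _)

/-- If every `H`-invariant element of `M` is a sum over `H`, then every invariant element of
`R[G/H] ⊗ M` is a sum over `G`. -/
theorem exists_sum_tprod_eq
    (hM : ∀ m : M, (∀ h ∈ H, ρ h m = m) → ∃ m', ∑ h : H, ρ h m' = m)
    {x : (G ⧸ H →₀ R) ⊗[R] M} (hx : x ∈ ((permRep R H).tprod ρ).invariants) :
    ∃ m, ∑ g, (permRep R H).tprod ρ g (Finsupp.single ((1 : G) : G ⧸ H) 1 ⊗ₜ m) = x := by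
  obtain ⟨m, hm⟩ := hM _ fun h hh => cosetCoeff_one_fixed hx hh
  exact ⟨m, eq_of_cosetCoeff_one_eq (sum_mem_invariants _ _) hx (by rw [cosetCoeff_one_sum, hm])⟩

/-- The form on invariants is well defined if all invariants are sums over `G`:
`t (m, ∑ g, g n) = t (∑ g, g m, n)`. -/
theorem invariantsFormWellDefined {V : Type*} [AddCommGroup V] [Module R V]
    {r : Representation R G V} {t : LinearMap.BilinMap R V L}
    (ht : ∀ g x y, t (r g x) (r g y) = t x y)
    (hr : ∀ x : r.invariants, ∃ m : V, ∑ g, r g m = x) :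
    InvariantsFormWellDefined r fun x y => t x y := by
  refine ⟨hr, fun m m' h y => ?_⟩
  obtain ⟨n, hn⟩ := hr y
  have h1 (m : V) : t m y = t (∑ g, r g m) n := by
    rw [← hn, map_sum, map_sum, LinearMap.sum_apply]
    refine Fintype.sum_equiv (Equiv.inv G) _ _ fun g => ?_
    rw [Equiv.inv_apply, ← ht g (r g⁻¹ m) n, ← Module.End.mul_apply, ← map_mul, mul_inv_cancel,
      map_one, Module.End.one_apply]
  change t m y = t m' y
  rw [h1, h1, h]

end Invariants

end

noncomputable section

/-! ### The twist as the bundle of `H`-invariants -/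

/-- A module with a pairing that is isometric to a symmetric bundle is a symmetric bundle. -/
theorem PairedModule.Isometry.isSymmetricBundle {Y : Scheme.{u}} [IsIntegral Y]
    {M : PairedModule.{u, w} Y} {N : PairedModule.{u, w'} Y} (e : M.Isometry N)
    (hN : N.IsSymmetricBundle) : M.IsSymmetricBundle := by
  refine ⟨fun {U W} f hW x hx => ?_, fun {U W} f hW y => ?_, fun y => ?_, fun U x => ⟨?_, ?_⟩,
    fun U x y => ?_, fun U x y => ?_, fun {U W} h x y => ?_, fun U l => ?_⟩
  · obtain ⟨n, hn⟩ := hN.res_eq_zero f hW (e.equiv U x) (by rw [← e.equiv_res, hx, map_zero])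
    exact ⟨n, (e.equiv U).injective (by rw [map_smul, hn, map_zero])⟩
  · obtain ⟨n, x, hx⟩ := hN.res_surj f hW (e.equiv W y)
    refine ⟨n, (e.equiv U).symm x, (e.equiv W).injective ?_⟩
    rw [e.equiv_res, LinearEquiv.apply_symm_apply, hx, map_smul]
  · obtain ⟨U, hy, h1, h2⟩ := hN.locally_free y
    exact ⟨U, hy, .of_equiv (e.equiv U).symm, .equiv (e.equiv U).symm⟩
  · intro y z
    rw [← e.form_equiv, ← e.form_equiv, ← e.form_equiv, map_add, (hN.form_linear U _).map_add]
  · intro c y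
    rw [← e.form_equiv, ← e.form_equiv, map_smul, (hN.form_linear U _).map_smul]
  · rw [← e.form_equiv, hN.form_symm, e.form_equiv]
  · rw [← e.form_equiv]
    exact hN.form_integral U _ _
  · rw [← e.form_equiv, e.equiv_res, e.equiv_res, hN.form_res, e.form_equiv]
  · obtain ⟨x, hx, huniq⟩ := hN.unimodular U (l ∘ₗ (e.equiv U).symm.toLinearMap)
    refine ⟨(e.equiv U).symm x, fun y => ?_, fun y hy => ?_⟩
    · rw [← e.form_equiv, LinearEquiv.apply_symm_apply, hx]
      simp
    · rw [LinearEquiv.eq_symm_apply]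
      refine huniq _ fun z => ?_
      obtain ⟨z, rfl⟩ := (e.equiv U).surjective z
      rw [e.form_equiv, hy]
      simp

namespace QuotientTower

variable {G : Type v} [Group G] {H : Subgroup G} (T : QuotientTower.{u} H)

section

variable [Fintype G]

theorem traceBilin_galRep (hfaith : ∀ g : G, (∀ z, galMap T.φ g z = z) → g = 1) (U : NAffine T.Y)
    (g : G) (m m' : pushSqrtCodiff T.pi U) :
    T.traceBilin U (galRep T.φ T.pi T.quotientG.invariant U g m)
      (galRep T.φ T.pi T.quotientG.invariant U g m') = T.traceBilin U m m' := by
  have := isGaloisGroup_galField T.quotientG hfaith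
  let σ : GalField T.quotientG ≃ₐ[T.Y.functionField] GalField T.quotientG :=
    MulSemiringAction.toAlgEquiv _ _ g
  refine Eq.trans (congrArg (fieldTrace T.pi) (?_ : _ = σ (show GalField T.quotientG from
    m.1 * m'.1))) (Algebra.trace_eq_of_algEquiv σ _)
  exact (map_mul (galMap T.φ g) _ _).symm

variable [Fintype H] [IsLocallyNoetherian T.X]

/-- Tameness: an `H`-invariant section of `π_* D_{X/Y}^{-1/2}` is a sum over `H`. -/
theorem exists_sum_galRep_eq (hφ : IsRegularTameAction T.φ) (U : NAffine T.Y)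
    (m : pushSqrtCodiff T.pi U)
    (hm : ∀ h ∈ H, galRep T.φ T.pi T.quotientG.invariant U h m = m) :
    ∃ m', ∑ h : H, galRep T.φ T.pi T.quotientG.invariant U h m' = m := by
  have := hφ.faithfulSMul T.quotientG U
  have := isGaloisGroup_galField T.quotientG hφ.faithful
  have hm' : m.1 ∈ T.fixedSections U := ⟨m.2, fun h hh => congrArg Subtype.val (hm h hh)⟩
  obtain ⟨n, hn⟩ := sumFixed_surjective (K := T.Y.functionField) (hφ.isRegularTame T.quotientG U)
    ⟨_, (T.mem_fixedSections_iff U hφ _).1 hm'⟩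
  have hn' : ∑ h : H, (h : G) • (n : GalField T.quotientG) = m.1 := congrArg Subtype.val hn
  refine ⟨⟨n.1, (mem_pushSqrtCodiff_iff T.quotientG U hφ _).2 n.2⟩, Subtype.ext ?_⟩
  refine Eq.trans ?_ hn'
  rw [AddSubmonoidClass.coe_finsetSum]
  rfl

/-- The form on the twist is well defined. -/
theorem invariantsFormWellDefined_tensorRep (hφ : IsRegularTameAction T.φ) (U : NAffine T.Y) :
    InvariantsFormWellDefined (T.tensorRep U) fun x y => T.tensorTrace U x y :=
  invariantsFormWellDefined (tensorForm_tprod (T.traceBilin_galRep hφ.faithful U)) fun x =>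
    (exists_sum_tprod_eq (T.exists_sum_galRep_eq hφ U) x.2).imp' _ fun _ h => h

end

/-- The sections of the twist. -/
abbrev twistSections (U : NAffine T.Y) : Submodule Γ(T.Y, U.opens)
    ((G ⧸ H →₀ Γ(T.Y, U.opens)) ⊗[Γ(T.Y, U.opens)] pushSqrtCodiff T.pi U) :=
  Representation.invariants
    (V := (G ⧸ H →₀ Γ(T.Y, U.opens)) ⊗[Γ(T.Y, U.opens)] pushSqrtCodiff T.pi U) (T.tensorRep U)

/-- The map from the twist to the `H`-invariants that takes the coefficient at the coset `H`. -/
def twistMap (U : NAffine T.Y) :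
    T.twistSections U →ₗ[Γ(T.Y, U.opens)] T.fixedSections U where
  toFun x := ⟨(cosetCoeff _ H (pushSqrtCodiff T.pi U) ((1 : G) : G ⧸ H) x.1).1,
    (cosetCoeff _ H (pushSqrtCodiff T.pi U) ((1 : G) : G ⧸ H) x.1).2, fun _ hh =>
      congrArg Subtype.val (cosetCoeff_one_fixed
        (ρ := galRep T.φ T.pi T.quotientG.invariant U) x.2 hh)⟩
  map_add' x y := Subtype.ext (congrArg Subtype.val
    (map_add (cosetCoeff _ H (pushSqrtCodiff T.pi U) ((1 : G) : G ⧸ H)) x.1 y.1) :)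
  map_smul' r x := Subtype.ext (congrArg Subtype.val
    (map_smul (cosetCoeff _ H (pushSqrtCodiff T.pi U) ((1 : G) : G ⧸ H)) r x.1) :)

theorem twistMap_injective (U : NAffine T.Y) : Function.Injective (T.twistMap U) := fun x y h =>
  Subtype.ext (eq_of_cosetCoeff_one_eq (ρ := galRep T.φ T.pi T.quotientG.invariant U) x.2 y.2
    (Subtype.ext (Subtype.ext_iff.1 h :)))

theorem cosetCoeff_tensorRes {U W : NAffine T.Y} (h : W.opens ≤ U.opens) (q : G ⧸ H) (x) :
    cosetCoeff _ H (pushSqrtCodiff T.pi W) q (T.tensorRes h x) =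
      pushRes T.pi h (cosetCoeff _ H (pushSqrtCodiff T.pi U) q x) := by
  induction x with
  | zero => simp
  | add x y hx hy => rw [map_add, map_add, hx, hy, map_add, map_add]
  | tmul e z => exact ((pushRes T.pi h).map_smulₛₗ (e q) z).symm

variable [Fintype G] [Fintype H] [IsLocallyNoetherian T.X]

theorem twistMap_surjective (hφ : IsRegularTameAction T.φ) (U : NAffine T.Y) :
    Function.Surjective (T.twistMap U) := fun z => by
  obtain ⟨m, hm⟩ := T.exists_sum_galRep_eq hφ U ⟨z.1, z.2.1⟩ fun h hh =>
    Subtype.ext (z.2.2 h hh)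
  refine ⟨⟨∑ g, T.tensorRep U g (Finsupp.single ((1 : G) : G ⧸ H) 1 ⊗ₜ m),
    sum_mem_invariants (V := (G ⧸ H →₀ Γ(T.Y, U.opens)) ⊗[Γ(T.Y, U.opens)] pushSqrtCodiff T.pi U)
      (T.tensorRep U) _⟩, Subtype.ext ?_⟩
  exact (congrArg Subtype.val ((cosetCoeff_one_sum m).trans hm) :)

/-- The map to the `H`-invariants preserves the forms. If `x = ∑ g, g (H ⊗ m)` and `y` has the
coefficient `n` at the coset `H`, both forms take the value `Tr_{X/Y} (m n)` at `x` and `y`, since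
`Tr_{V/Y} ((∑ h, h m) n) = Tr_{V/Y} (∑ h, h (m n)) = Tr_{X/Y} (m n)`. -/
theorem traceVY_twistMap (hφ : IsRegularTameAction T.φ) (U : NAffine T.Y)
    (x y : T.twistSections U) :
    T.traceVY ((T.twistMap U x).1 * (T.twistMap U y).1) =
      invariantsForm (T.tensorRep U) (fun x y => T.tensorTrace U x y) x y := by
  have hwd := T.invariantsFormWellDefined_tensorRep hφ U
  obtain ⟨m, hm⟩ := exists_sum_tprod_eq (T.exists_sum_galRep_eq hφ U) x.2
  have h1 : invariantsForm (T.tensorRep U) (fun x y => T.tensorTrace U x y) x y =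
      T.tensorTrace U (Finsupp.single ((1 : G) : G ⧸ H) 1 ⊗ₜ m) y :=
    hwd.2 _ _ ((Classical.epsilon_spec (hwd.1 x)).trans hm.symm) y
  have h2 : ∑ h : H, galRep T.φ T.pi T.quotientG.invariant U h m =
      cosetCoeff _ H (pushSqrtCodiff T.pi U) ((1 : G) : G ⧸ H) x.1 := by
    rw [← cosetCoeff_one_sum, hm]
  have h3 : ∑ h : H, (h : G) • (show GalField T.quotientG from m.1) = (T.twistMap U x).1 := by
    refine Eq.trans ?_ (congrArg Subtype.val h2 :)
    rw [AddSubmonoidClass.coe_finsetSum]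
    rfl
  rw [h1]
  refine Eq.trans ?_ (tensorForm_single m y.1).symm
  refine Eq.trans ?_ (T.traceVY_sum hφ.faithful (show GalField T.quotientG from
    m.1 * (T.twistMap U y).1))
  refine congrArg T.traceVY ?_
  have h4 : ∑ h : H, (h : G) • ((show GalField T.quotientG from (T.twistMap U y).1) *
      (show GalField T.quotientG from m.1)) = _ :=
    sum_smul_mul_fixed (fun h => (T.twistMap U y).2.2 h h.2) _
  rw [h3] at h4
  rw [mul_comm]
  refine h4.symm.trans ?_
  exact congrArg _ (funext fun h => congrArg _ (mul_comm _ _))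

/-- The twist of `(O_Y[G/H], q)` is isometric to `((π_* D_{X/Y}^{-1/2})^H, Tr_{V/Y})`. -/
def twistIsometry (hφ : IsRegularTameAction T.φ) : T.twist.Isometry T.fixedBundle where
  equiv U := LinearEquiv.ofBijective (T.twistMap U)
    ⟨T.twistMap_injective U, T.twistMap_surjective hφ U⟩
  equiv_res h x := Subtype.ext (congrArg Subtype.val
    (T.cosetCoeff_tensorRes h ((1 : G) : G ⧸ H) (show T.twistSections _ from x).1) :)
  form_equiv := T.traceVY_twistMap hφ

end QuotientTower

end

open WithZero

noncomputable section

/-! ### Points of codimension one of a quotient -/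

theorem pointIdeal_injective {X : Scheme.{u}} {W : X.Opens} (hW : IsAffineOpen W) {x y : X}
    {hx : x ∈ W} {hy : y ∈ W} (h : pointIdeal W x hx = pointIdeal W y hy) : x = y := by
  rw [pointIdeal_eq hW, pointIdeal_eq hW] at h
  have h1 := congrArg hW.fromSpec (PrimeSpectrum.ext h)
  exact (hW.fromSpec_primeIdealOf ⟨x, hx⟩).symm.trans (h1.trans (hW.fromSpec_primeIdealOf ⟨y, hy⟩))

/-- Over a prime of height one in the ring of invariants there is a prime of height one: a minimal
prime over a nonzero element of the given prime. -/
theorem exists_comap_eq_of_height_eq_one {A B : Type*} (G : Type*) [CommRing A] [CommRing B]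
    [Algebra A B] [Group G] [Finite G] [MulSemiringAction G B] [Algebra.IsInvariant A B G]
    [IsDomain A] [IsDomain B] [IsNoetherianRing B] [FaithfulSMul A B] (q : Ideal A) [q.IsPrime]
    (hq : q.height = 1) :
    ∃ P : Ideal B, P.IsPrime ∧ P.height = 1 ∧ P.comap (algebraMap A B) = q := by
  have := Algebra.IsInvariant.isIntegral A B G
  have hinj := FaithfulSMul.algebraMap_injective A B
  obtain ⟨c, hc, hc0⟩ := Submodule.exists_mem_ne_zero_of_ne_bot (p := q) fun h => by
    rw [h, Ideal.height_bot] at hq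
    exact zero_ne_one hq
  have hc0' : algebraMap A B c ≠ 0 := fun h => hc0 (hinj (h.trans (map_zero _).symm))
  obtain ⟨Q, hQ, hQq⟩ := Ideal.exists_ideal_over_prime_of_isIntegral_of_isDomain (S := B) q (by
    rw [(RingHom.injective_iff_ker_eq_bot _).1 hinj]
    exact bot_le)
  obtain ⟨P, hP, hPQ⟩ := Ideal.exists_minimalPrimes_le (I := Ideal.span {algebraMap A B c}) (J := Q)
    (by rw [Ideal.span_singleton_le_iff_mem, ← Ideal.mem_comap, hQq]; exact hc)
  have hPp := hP.isPrime
  have hcP : algebraMap A B c ∈ P := (Ideal.span_singleton_le_iff_mem _).1 hP.1.2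
  refine ⟨P, hPp, le_antisymm (Ideal.height_le_one_of_isPrincipal_of_mem_minimalPrimes _ _ hP)
    (Order.one_le_iff_ne_zero.2 fun h => ?_), eq_of_le_of_height_eq_one (fun h => hc0 ?_)
      ((Ideal.comap_mono hPQ).trans_eq hQq) hq⟩
  · rw [Ideal.height_eq_zero_iff, IsDomain.minimalPrimes_eq_singleton_bot] at h
    exact hc0' ((Submodule.mem_bot B).1 (h ▸ hcP))
  · exact (Submodule.mem_bot A).1 (h ▸ hcP : c ∈ (⊥ : Ideal A))

section Quotient

variable {G : Type v} [Group G] {X Y : Scheme.{u}} [IsIntegral X] [IsIntegral Y]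
  {φ : G →* Aut X} {π : X ⟶ Y} [IsDominant π] [IsLocallyNoetherian X]

theorem IsQuotient.exists_ringKrullDim_eq_one [Finite G] (hπ : IsQuotient φ π) {y : Y}
    (hy : ringKrullDim (Y.presheaf.stalk y) = 1) :
    ∃ x : X, π x = y ∧ ringKrullDim (X.presheaf.stalk x) = 1 := by
  obtain ⟨U, hyU, -⟩ := exists_nAffine (W := ⊤) (y := y) trivial
  have hq : (pointIdeal U.opens y hyU).height = 1 := by
    have h1 := height_pointIdeal U.isAffine y hyU
    rw [hy] at h1
    exact_mod_cast h1
  have : FaithfulSMul Γ(Y, U.opens) (SecRing hπ U) :=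
    (faithfulSMul_iff_algebraMap_injective _ _).2 (hπ.injective U.opens)
  obtain ⟨P, hP, hht, hPq⟩ := exists_comap_eq_of_height_eq_one (B := SecRing hπ U) G
    (pointIdeal U.opens y hyU) hq
  obtain ⟨x, hx, rfl⟩ := exists_pointIdeal_eq (hπ.isAffineOpen_preimage U) P (hP := hP)
  refine ⟨x, pointIdeal_injective U.isAffine (hx := hx) (hy := hyU) ?_, ?_⟩
  · have h := pointIdeal_comap_appLE π U.opens (π ⁻¹ᵁ U.opens) le_rfl x hx
    rw [Scheme.Hom.appLE_eq_app] at h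
    exact h.symm.trans hPq
  · rw [← height_pointIdeal (hπ.isAffineOpen_preimage U) x hx]
    exact_mod_cast hht

variable [Fintype G]

/-- The normalized valuation at a point of codimension one, and its restriction to the function
field of the quotient. -/
theorem IsRegularTameAction.exists_isPrimeVal (hφ : IsRegularTameAction φ) (hπ : IsQuotient φ π)
    {x : X} (hx : ringKrullDim (X.presheaf.stalk x) = 1) :
    ∃ (v : Valuation X.functionField ℤᵐ⁰) (e : ℕ), Odd e ∧
      IsPrimeVal (IsLocalRing.maximalIdeal (X.presheaf.stalk x)) v 1 ∧
      IsPrimeVal (IsLocalRing.maximalIdeal (Y.presheaf.stalk (π x))) (v.comap (ffMap π)) e := by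
  obtain ⟨U, hU, -⟩ := exists_nAffine (W := ⊤) (y := π x) trivial
  have hxU : x ∈ π ⁻¹ᵁ U.opens := hU
  have hht : (secIdeal hπ U hxU).height = 1 := by
    have h1 := height_pointIdeal (hπ.isAffineOpen_preimage U) x hxU
    rw [hx] at h1
    exact_mod_cast h1
  have : (secIdeal hπ U hxU).IsPrime := inferInstanceAs (pointIdeal _ x hxU).IsPrime
  have := hφ.faithfulSMul hπ U
  have hG := hφ.isRegularTame hπ U
  obtain ⟨v, e, hv⟩ := exists_isRamVal (L := GalField hπ) Γ(Y, U.opens) Y.functionField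
    hG (secIdeal hπ U hxU) hht
  exact ⟨v, e, (hG.odd_card_inertia _).of_dvd_nat
    (hv.left.dvd_card_inertia hv.right (hG.card_inertia_notMem _)),
    (isRamVal_secIdeal_iff hπ U hxU (v := v)).1 hv⟩

end Quotient

theorem IsRegularTameAction.subgroup {G : Type v} [Group G] {X : Scheme.{u}} [IsIntegral X]
    {φ : G →* Aut X} (hφ : IsRegularTameAction φ) (H : Subgroup G) [Finite G] :
    IsRegularTameAction (φ.comp H.subtype) := by
  have hdvd (x : X) : Nat.card (inertia (φ.comp H.subtype) x) ∣ Nat.card (inertia φ x) := by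
    have h : (inertia (φ.comp H.subtype) x).map H.subtype ≤ inertia φ x := by
      rintro _ ⟨h, hh, rfl⟩
      exact hh
    rw [← Subgroup.card_map_of_injective (K := inertia (φ.comp H.subtype) x) H.subtype_injective]
    exact Subgroup.card_dvd_of_le h
  refine ⟨fun h hh => Subtype.ext (hφ.faithful h hh), hφ.regular, fun x h0 => ?_,
    fun x => (hφ.odd_card_inertia x).of_dvd_nat (hdvd x)⟩
  obtain ⟨n, hn⟩ := hdvd x
  exact hφ.card_inertia_ne_zero x (by rw [hn, Nat.cast_mul, h0, zero_mul])

/-! ### Comparison with the quotient by `H` -/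

namespace QuotientTower

variable {G : Type v} [Group G] {H : Subgroup G} (T : QuotientTower.{u} H)
  [Fintype G] [Fintype H] [IsLocallyNoetherian T.X]

/-- The condition on the order of a function on `V` at a point of codimension one is the same on `V`
and on `X`. Let `m` and `n = m k` be the ramification indices of `λ` and of `π`, which are odd. The
order on `X` of a function on `V` is a multiple of `m`, and `m (k - 1) / 2` is the largest multiple
of `m` that is at most `(n - 1) / 2`. -/
theorem forall_mem_pow_lam_iff (hφ : IsRegularTameAction T.φ) {x : T.X}
    (hx : ringKrullDim (T.X.presheaf.stalk x) = 1) :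
    ringKrullDim (T.V.presheaf.stalk (T.lam x)) = 1 ∧ ∀ w : T.V.functionField,
    ((∀ a ∈ IsLocalRing.maximalIdeal (T.V.presheaf.stalk (T.lam x)) ^
        ((ramIdx T.gam (T.lam x) - 1) / 2), ∃ b : T.V.presheaf.stalk (T.lam x),
          algebraMap _ T.V.functionField b = algebraMap _ _ a * w) ↔
      ∀ a ∈ IsLocalRing.maximalIdeal (T.X.presheaf.stalk x) ^ ((ramIdx T.pi x - 1) / 2),
        ∃ b : T.X.presheaf.stalk x,
          algebraMap _ T.X.functionField b = algebraMap _ _ a * ffMap T.lam w) := by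
  obtain ⟨v, n, hnodd, hv, hn⟩ := hφ.exists_isPrimeVal T.quotientG hx
  obtain ⟨v', m, hmodd, hv', hm⟩ := (hφ.subgroup H).exists_isPrimeVal T.quotientH hx
  obtain rfl := hv.unique hv'
  have hn' : IsPrimeVal (IsLocalRing.maximalIdeal (T.Y.presheaf.stalk (T.gam (T.lam x))))
      ((v.comap (ffMap T.lam)).comap (ffMap T.gam)) n := by
    have h : (v.comap (ffMap T.lam)).comap (ffMap T.gam) = v.comap (ffMap T.pi) :=
      Valuation.ext fun c => congrArg v (ffMap_comp T.lam T.gam c).symm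
    rw [h]
    exact hn
  refine ⟨hm.ringKrullDim_eq_one, fun w => ?_⟩
  rw [forall_mem_pow_iff hm hn', forall_mem_pow_iff hv hn, Nat.div_one, mul_one,
    Valuation.comap_apply]
  obtain ⟨k, rfl⟩ := dvd_of_isPrimeVal hm hn'
  rw [Nat.mul_div_cancel_left k hm.pos]
  obtain ⟨i, hi⟩ := hmodd
  obtain ⟨j, hj⟩ := Nat.Odd.of_mul_right hnodd
  have h1 : m * k = 2 * (j * m + i) + 1 := by rw [hj, hi]; ring
  have h2 : (k - 1) / 2 = j := by omega
  have h3 : (m * k - 1) / 2 = j * m + i := by omega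
  rw [h2, h3]
  rcases eq_or_ne w 0 with rfl | hw
  · simp [zero_le]
  obtain ⟨l, hl⟩ := hm.exists_eq_exp hw
  rw [Valuation.comap_apply] at hl
  rw [hl, exp_le_exp, exp_le_exp]
  have hm0 : (0 : ℤ) < m := by exact_mod_cast hm.pos
  have hi' : (i : ℤ) < m := by omega
  push_cast
  constructor
  · intro h
    omega
  · intro h
    have h4 : l < j + 1 := by
      by_contra h5
      nlinarith
    exact mul_le_mul_of_nonneg_right (by omega) hm0.le

/-- The points of codimension one of `V` are the images of those of `X`, so that the conditions on a
function on `V` can be compared there. -/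
theorem mem_pushSqrtCodiff_gam_iff (hφ : IsRegularTameAction T.φ) (U : NAffine T.Y)
    (w : T.V.functionField) :
    w ∈ pushSqrtCodiff T.gam U ↔ (show ExtField T.pi from ffMap T.lam w) ∈ T.fixedSections U := by
  constructor
  · refine fun h => ⟨fun x hx hd => ?_, fun g hg => ?_⟩
    · obtain ⟨h1, h2⟩ := T.forall_mem_pow_lam_iff hφ hd
      exact (h2 w).1 (h (T.lam x) hx h1)
    · exact (ffMap_comp _ _ w).symm.trans (ffMap_congr (T.quotientH.invariant ⟨g, hg⟩⁻¹) w)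
  · intro h y hy hd
    obtain ⟨x, rfl, hx⟩ := T.quotientH.exists_ringKrullDim_eq_one hd
    exact ((T.forall_mem_pow_lam_iff hφ hx).2 w).2 (h.1 x hy hx)

/-- The map `γ_* D_{V/Y}^{-1/2} → (π_* D_{X/Y}^{-1/2})^H`. -/
def gamMap (hφ : IsRegularTameAction T.φ) (U : NAffine T.Y) :
    pushSqrtCodiff T.gam U →ₗ[Γ(T.Y, U.opens)] T.fixedSections U where
  toFun w := ⟨ffMap T.lam w.1, (T.mem_pushSqrtCodiff_gam_iff hφ U w.1).1 w.2⟩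
  map_add' w w' := Subtype.ext (map_add (ffMap T.lam) w.1 w'.1)
  map_smul' r w := Subtype.ext <| by
    refine (congrArg (ffMap T.lam) (Algebra.smul_def r w.1)).trans ?_
    refine ((map_mul (ffMap T.lam) _ _).trans ?_).trans
      (Algebra.smul_def (A := ExtField T.pi) r _).symm
    exact congrArg (· * ffMap T.lam w.1) (ffMap_comp T.lam T.gam _).symm

theorem gamMap_bijective (hφ : IsRegularTameAction T.φ) (U : NAffine T.Y) :
    Function.Bijective (T.gamMap hφ U) := by
  refine ⟨fun w w' h => Subtype.ext ((ffMap T.lam).injective (Subtype.ext_iff.1 h)), fun z => ?_⟩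
  obtain ⟨w, hw⟩ := T.exists_ffMap_lam_eq z.2.2
  exact ⟨⟨w, (T.mem_pushSqrtCodiff_gam_iff hφ U w).2 (hw ▸ z.2)⟩, Subtype.ext hw⟩

/-- `(γ_* D_{V/Y}^{-1/2}, Tr_{V/Y})` is the bundle of `H`-invariants. -/
def gamIsometry (hφ : IsRegularTameAction T.φ) :
    (sqrtCodiffBundle T.gam).Isometry T.fixedBundle where
  equiv U := LinearEquiv.ofBijective (T.gamMap hφ U) (T.gamMap_bijective hφ U)
  equiv_res _ _ := rfl
  form_equiv _ _ _ := congrArg (fieldTrace T.gam)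
    ((congrArg _ (map_mul (ffMap T.lam) _ _).symm).trans
      (Function.leftInverse_invFun (ffMap T.lam).injective _))

end QuotientTower

end

end FrohlichTwist

theorem proposition2p6 {G : Type v} [Group G] [Fintype G] (H : Subgroup G)
    (T : FrohlichTwist.QuotientTower.{u, v} H)
    (hnoeth : IsLocallyNoetherian T.X)
    (hreg : ∀ x : T.X, IsRegularLocalRing (T.X.presheaf.stalk x))
    (h2 : IsUnit (2 : Γ(T.X, ⊤)))
    (hflat : Flat T.pi)
    (hfree : FrohlichTwist.inertia T.φ (genericPoint T.X) = ⊥)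
    (htame : ∀ x : T.X,
      ((Nat.card (FrohlichTwist.inertia T.φ x) : ℕ) : T.X.residueField x) ≠ 0)
    (hodd : ∀ x : T.X, Odd (Nat.card (FrohlichTwist.inertia T.φ x))) :
    -- the form on the twist and the form `Tr_{V/Y}` on `H`-invariants are well-defined
    (∀ U, FrohlichTwist.InvariantsFormWellDefined (T.tensorRep U)
      (fun x y => T.tensorTrace U x y)) ∧
    (∀ z : T.X.functionField, (∀ h ∈ H, FrohlichTwist.galMap T.φ h z = z) →
      ∃ w : T.V.functionField, FrohlichTwist.ffMap T.lam w = z) ∧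
    -- the twist is the symmetric bundle `((π_* D_{X/Y}^{-1/2})^H, Tr_{V/Y})`
    T.twist.IsSymmetricBundle ∧ T.fixedBundle.IsSymmetricBundle ∧
    Nonempty (T.twist.Isometry T.fixedBundle) ∧
    -- if `X → V` is flat, it is the symmetric bundle `(γ_* D_{V/Y}^{-1/2}, Tr_{V/Y})`
    (Flat T.lam →
      (FrohlichTwist.sqrtCodiffBundle T.gam).IsSymmetricBundle ∧
      ∃ e : (FrohlichTwist.sqrtCodiffBundle T.gam).Isometry T.fixedBundle,
        ∀ (U : FrohlichTwist.NAffine T.Y) (w : FrohlichTwist.pushSqrtCodiff T.gam U),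
          T.fixedVal (e.equiv U w) = FrohlichTwist.ffMap T.lam w.1) := by
  classical
  have hφ : FrohlichTwist.IsRegularTameAction T.φ :=
    ⟨fun g hg => FrohlichTwist.eq_one_of_galMap_eq T.quotientG hfree hg, hreg, htame, hodd⟩
  have hfixed := T.isSymmetricBundle_fixedBundle hφ
  exact ⟨T.invariantsFormWellDefined_tensorRep hφ, fun z => T.exists_ffMap_lam_eq,
    (T.twistIsometry hφ).isSymmetricBundle hfixed, hfixed, ⟨T.twistIsometry hφ⟩, fun _ =>
      ⟨(T.gamIsometry hφ).isSymmetricBundle hfixed, T.gamIsometry hφ, fun _ _ => rfl⟩⟩
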